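/- Let $R$ be a finite commutative ring with $1$, let $n\ge 0$, and let $G=\mathrm{GL}_n(R)$. Let $L\subseteq G$ be the subgroup of diagonal matrices, and let $U$ and $V$ be the subgroups of upper- and lower-triangular unipotent matrices. Write $R\cong R_1\times\cdots\times R_m$ as the product of its local factors (its localisations at its maximal ideals), so that $G\cong \mathrm{GL}_n(R_1)\times\cdots\times \mathrm{GL}_n(R_m)$, and let $W\subseteq G$ be the subgroup corresponding to the product of the groups of permutation matrices in the factors $\mathrm{GL}_n(R_j)$; it normalises $L$. For a subgroup $H\subseteq G$ put $e_H=|H|^{-1}\sum_{h\in H}h\in\mathbb{C}[G]$. Identify complex representations with left modules over the complex group ring, let $\mathrm{Rep}(G)$ and $\mathrm{Rep}(L)$ be the categories of (arbitrary) complex representations, and consider the functors \[ \mathrm{pind}:\mathrm{Rep}(L)\to\mathrm{Rep}(G),\quad X\mapsto \mathbb{C}[G]e_Ue_V\otimes_{\mathbb{C}[L]}X, \qquad \mathrm{pres}:\mathrm{Rep}(G)\to\mathrm{Rep}(L),\quad Y\mapsto e_Ue_V\mathbb{C}[G]\otimes_{\mathbb{C}[G]}Y. \] For $w\in W$ let $w^*:\mathrm{Rep}(L)\to\mathrm{Rep}(L)$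 be the functor sending a representation $\chi$ of $L$ to the representation $l\mapsto\chi(w^{-1}lw)$ on the same space. Then there is a natural isomorphism $\mathrm{pres}\circ\mathrm{pind}\cong\bigoplus_{w\in W}w^*$ of functors on $\mathrm{Rep}(L)$. Consequently, if $\chi$ and $\sigma$ are irreducible representations of $L$, then \[ \dim_{\mathbb{C}}\mathrm{Hom}_G(\mathrm{pind}\,\chi,\mathrm{pind}\,\sigma)=\#\{w\in W : w^*\chi\cong\sigma\}. \] -/

import Mathlib

open CategoryTheory CategoryTheory.Limits Matrix
open scoped MatrixGroups TensorProduct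

universe u v

noncomputable section

/-! ### Bimodules inside a ring, and tensoring with them -/

namespace HC

section Bimodule

variable {A B C : Type*} [Ring A] [Ring B] [Ring C]

/-- Given ring homomorphisms `f : B → A` and `g : C → A`, an additive subgroup of `A` stable under
left multiplication by `f b` and right multiplication by `g c`, for all `b : B` and `c : C`. -/
structure SubBimodule (f : B →+* A) (g : C →+* A) where
  carrier : AddSubgroup A
  left_mem : ∀ (b : B) {x : A}, x ∈ carrier → f b * x ∈ carrier
  right_mem : ∀ (c : C) {x : A}, x ∈ carrier → x * g c ∈ carrier

namespace SubBimodule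

variable {f : B →+* A} {g : C →+* A} (M : SubBimodule f g)

/-- The elements of a sub-bimodule, as a type. -/
abbrev Elem : Type _ := M.carrier

/-- The left `B`-module structure `b • x = f b * x`. -/
instance instModuleLeft : Module B M.Elem where
  smul b x := ⟨f b * x, M.left_mem b x.2⟩
  one_smul x := Subtype.ext (show f 1 * (x : A) = x by simp)
  mul_smul b b' x := Subtype.ext (show f (b * b') * (x : A) = f b * (f b' * x) by
    rw [map_mul, mul_assoc])
  smul_zero b := Subtype.ext (show f b * (0 : A) = 0 by simp)
  smul_add b x y := Subtype.ext (show f b * ((x : A) + y) = f b * x + f b * y by rw [mul_add])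
  add_smul b b' x := Subtype.ext (show f (b + b') * (x : A) = f b * x + f b' * x by
    rw [map_add, add_mul])
  zero_smul x := Subtype.ext (show f 0 * (x : A) = 0 by simp)

/-- Right multiplication `x ↦ x * g c`. -/
def rmul (x : M.Elem) (c : C) : M.Elem := ⟨x * g c, M.right_mem c x.2⟩

@[simp] lemma coe_smul (b : B) (x : M.Elem) : ((b • x : M.Elem) : A) = f b * x := rfl

@[simp] lemma coe_rmul (x : M.Elem) (c : C) : ((M.rmul x c : M.Elem) : A) = x * g c := rfl

variable (X : Type*) [AddCommGroup X] [Module C X]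

/-- The relations `(x * g c) ⊗ y = x ⊗ (c • y)` imposed on the tensor product over `ℤ`. -/
def balanced : Submodule B (M.Elem ⊗[ℤ] X) :=
  Submodule.span B
    {t | ∃ (x : M.Elem) (c : C) (y : X), t = M.rmul x c ⊗ₜ[ℤ] y - x ⊗ₜ[ℤ] (c • y)}

/-- The tensor product `M ⊗_C X` over the (not necessarily commutative) ring `C`,
a left `B`-module via `b • (x ⊗ y) = (b • x) ⊗ y`. -/
abbrev Tensor : Type _ := (M.Elem ⊗[ℤ] X) ⧸ M.balanced X

variable {X} {Y Z : Type*} [AddCommGroup Y] [Module C Y] [AddCommGroup Z] [Module C Z]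

/-- `id ⊗ φ` before passing to the quotient. -/
def preMap (φ : X →ₗ[C] Y) : M.Elem ⊗[ℤ] X →ₗ[B] M.Elem ⊗[ℤ] Y :=
  TensorProduct.AlgebraTensorModule.map LinearMap.id φ.toAddMonoidHom.toIntLinearMap

@[simp] lemma preMap_tmul (φ : X →ₗ[C] Y) (x : M.Elem) (y : X) :
    M.preMap φ (x ⊗ₜ y) = x ⊗ₜ φ y := rfl

lemma balanced_le (φ : X →ₗ[C] Y) :
    M.balanced X ≤ (M.balanced Y).comap (M.preMap φ) := by
  refine Submodule.span_le.2 ?_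
  rintro _ ⟨x, c, y, rfl⟩
  refine Submodule.subset_span ⟨x, c, φ y, ?_⟩
  rw [map_sub, preMap_tmul, preMap_tmul, map_smul]

/-- The map `id ⊗ φ : M ⊗_C X → M ⊗_C Y`. -/
def map (φ : X →ₗ[C] Y) : M.Tensor X →ₗ[B] M.Tensor Y :=
  (M.balanced X).mapQ (M.balanced Y) (M.preMap φ) (M.balanced_le φ)

lemma hom_ext {N : Type*} [AddCommGroup N] [Module B N] {p q : M.Tensor X →ₗ[B] N}
    (h : ∀ x y, p (Submodule.Quotient.mk (x ⊗ₜ y)) = q (Submodule.Quotient.mk (x ⊗ₜ y))) :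
    p = q := by
  refine Submodule.linearMap_qext _ (LinearMap.ext fun t => ?_)
  induction t using TensorProduct.induction_on with
  | zero => rw [map_zero, map_zero]
  | tmul x y => exact h x y
  | add s t hs ht => rw [map_add, map_add, hs, ht]

lemma map_id : M.map (LinearMap.id : X →ₗ[C] X) = LinearMap.id :=
  M.hom_ext fun _ _ => rfl

lemma map_comp (ψ : Y →ₗ[C] Z) (φ : X →ₗ[C] Y) : M.map (ψ ∘ₗ φ) = M.map ψ ∘ₗ M.map φ :=
  M.hom_ext fun _ _ => rfl

end SubBimodule

end Bimodule

/-- The functor `X ↦ M ⊗_C X` from left `C`-modules to left `B`-modules. -/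
def SubBimodule.tensorFunctor {A B C : Type u} [Ring A] [Ring B] [Ring C]
    {f : B →+* A} {g : C →+* A} (M : SubBimodule f g) :
    ModuleCat.{max u v} C ⥤ ModuleCat.{max u v} B where
  obj X := ModuleCat.of B (M.Tensor X)
  map φ := ModuleCat.ofHom (M.map φ.hom)
  map_id X := by
    rw [ModuleCat.hom_id, M.map_id]; rfl
  map_comp φ ψ := by
    rw [ModuleCat.hom_comp, M.map_comp]; rfl

/-! ### Subgroups of the general linear group -/

section Groups

variable (R : Type u) [CommRing R] (n : ℕ)

/-- The group `G = GL_n(R)`. -/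
abbrev G : Type u := GL (Fin n) R

/-- The subgroup `L` of diagonal matrices. -/
def L : Subgroup (G R n) where
  carrier := {g | ∀ i j, i ≠ j → (g : Matrix (Fin n) (Fin n) R) i j = 0}
  one_mem' i j h := Matrix.one_apply_ne h
  mul_mem' {a b} ha hb i j h := by
    rw [Units.val_mul, Matrix.mul_apply]
    refine Finset.sum_eq_zero fun k _ => ?_
    by_cases hk : i = k
    · rw [hb k j (hk ▸ h), mul_zero]
    · rw [ha i k hk, zero_mul]
  inv_mem' {a} ha i j h := by
    have key : ∀ k, (a : Matrix (Fin n) (Fin n) R) i i * (a⁻¹ : G R n).val i k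
        = (1 : Matrix (Fin n) (Fin n) R) i k := fun k => by
      rw [← Units.mul_inv a, Matrix.mul_apply, Finset.sum_eq_single i]
      · intro m _ hm
        rw [ha i m hm.symm, zero_mul]
      · exact fun h => absurd (Finset.mem_univ i) h
    have h1 := key i
    have h2 := key j
    rw [Matrix.one_apply_eq] at h1
    rw [Matrix.one_apply_ne h] at h2
    calc (a⁻¹ : G R n).val i j
        = (a.val i i * (a⁻¹ : G R n).val i i) * (a⁻¹ : G R n).val i j := by rw [h1, one_mul]
      _ = (a⁻¹ : G R n).val i i * (a.val i i * (a⁻¹ : G R n).val i j) := by ring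
      _ = 0 := by rw [h2, mul_zero]

variable {n} in
/-- The invertible matrices with ones on the diagonal and zeros in the positions `(i, j)` with
`b j < b i`. -/
def unipotent {α : Type} [LinearOrder α] (b : Fin n ≃ α) : Subgroup (G R n) where
  carrier := {g | (∀ i, (g : Matrix (Fin n) (Fin n) R) i i = 1) ∧
    ∀ i j, b j < b i → (g : Matrix (Fin n) (Fin n) R) i j = 0}
  one_mem' := ⟨fun i => by simp, fun i j h => by
    simp [show i ≠ j by rintro rfl; exact lt_irrefl _ h]⟩
  mul_mem' {x y} hx hy := by
    refine ⟨fun i => ?_, fun i j h => ?_⟩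
    · rw [Units.val_mul, Matrix.mul_apply, Finset.sum_eq_single i, hx.1, hy.1, one_mul]
      · intro k _ hk
        rcases lt_or_gt_of_ne (fun e => hk (b.injective e) : b k ≠ b i) with h | h
        · rw [hx.2 i k h, zero_mul]
        · rw [hy.2 k i h, mul_zero]
      · simp
    · rw [Units.val_mul, Matrix.mul_apply]
      refine Finset.sum_eq_zero fun k _ => ?_
      rcases lt_or_ge (b k) (b i) with hk | hk
      · rw [hx.2 i k hk, zero_mul]
      · rw [hy.2 k j (h.trans_le hk), mul_zero]
  inv_mem' {x} hx := by
    have hB : Matrix.BlockTriangular (x⁻¹ : G R n).val b := by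
      rw [Matrix.coe_units_inv]
      have : Invertible (x : Matrix (Fin n) (Fin n) R) := x.invertible
      exact Matrix.blockTriangular_inv_of_blockTriangular fun i j h => hx.2 i j h
    refine ⟨fun i => ?_, fun i j h => hB h⟩
    have h1 : ((x : Matrix (Fin n) (Fin n) R) * (x⁻¹ : G R n).val) i i = 1 := by
      rw [Units.mul_inv, Matrix.one_apply_eq]
    rw [Matrix.mul_apply, Finset.sum_eq_single i, hx.1, one_mul] at h1
    · exact h1
    · intro k _ hk
      rcases lt_or_gt_of_ne (fun e => hk (b.injective e) : b k ≠ b i) with h | h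
      · rw [hx.2 i k h, zero_mul]
      · rw [hB h, mul_zero]
    · simp

/-- The subgroup `U` of upper-triangular unipotent matrices. -/
def U : Subgroup (G R n) := unipotent R (Equiv.refl (Fin n))

/-- The subgroup `V` of lower-triangular unipotent matrices. -/
def V : Subgroup (G R n) := unipotent R (OrderDual.toDual : Fin n ≃ (Fin n)ᵒᵈ)

/-- The subgroup of permutation matrices. -/
def permSubgroup : Subgroup (G R n) :=
  (Matrix.permMatrixHom (n := Fin n) (R := R)).toHomUnits.range

/-- The group `W`: the matrices in `GL_n(R)` whose image in `GL_n(R_𝔪)` is a permutation matrix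
for each maximal ideal `𝔪` (the permutation may depend on `𝔪`). A finite ring `R` is the product
of its localisations `R_𝔪`, and these are its local factors, so that `W` is the product of the
groups of permutation matrices over the local factors; for `R` local, `W` is the
group of permutation matrices. -/
def W : Subgroup (G R n) :=
  ⨅ m : MaximalSpectrum R,
    (permSubgroup (Localization.AtPrime m.asIdeal) n).comap
      (Matrix.GeneralLinearGroup.map (algebraMap R (Localization.AtPrime m.asIdeal)))

variable {R n}

lemma perm_conj_mem_L {w l : G R n} (hw : w ∈ permSubgroup R n) (hl : l ∈ L R n) :
    w⁻¹ * l * w ∈ L R n := by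
  obtain ⟨s, rfl⟩ := hw
  rw [← map_inv]
  intro i j hij
  have e1 : (((Matrix.permMatrixHom (n := Fin n) (R := R)).toHomUnits s : G R n) :
      Matrix (Fin n) (Fin n) R) = (s⁻¹).permMatrix R := rfl
  have e2 : (((Matrix.permMatrixHom (n := Fin n) (R := R)).toHomUnits s⁻¹ : G R n) :
      Matrix (Fin n) (Fin n) R) = s.permMatrix R := by
    rw [MonoidHom.coe_toHomUnits, Matrix.permMatrixHom_apply, inv_inv]
  rw [Units.val_mul, Units.val_mul, e1, e2, Equiv.Perm.permMatrix, Equiv.Perm.permMatrix,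
    PEquiv.toMatrix_toPEquiv_mul, PEquiv.mul_toMatrix_toPEquiv]
  exact hl _ _ fun h => hij (s.injective h)

lemma conj_mem_L {w l : G R n} (hw : w ∈ W R n) (hl : l ∈ L R n) : w⁻¹ * l * w ∈ L R n := by
  intro i j hij
  refine MaximalSpectrum.toPiLocalization_injective R (funext fun m => ?_)
  rw [map_zero]
  have hw' := (Subgroup.mem_iInf.1 hw) m
  rw [Subgroup.mem_comap] at hw'
  have hl' : Matrix.GeneralLinearGroup.map (algebraMap R (Localization.AtPrime m.asIdeal)) l
      ∈ L (Localization.AtPrime m.asIdeal) n := fun i j h => by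
    rw [Matrix.GeneralLinearGroup.map_apply, hl i j h, map_zero]
  have := perm_conj_mem_L hw' hl' i j hij
  rw [← map_inv, ← map_mul, ← map_mul, Matrix.GeneralLinearGroup.map_apply] at this
  exact this

/-- The homomorphism `Ad_w⁻¹ : L → L`, `l ↦ w⁻¹ l w`. -/
def adInv (w : W R n) : L R n →* L R n where
  toFun l := ⟨(w : G R n)⁻¹ * l * w, conj_mem_L w.2 l.2⟩
  map_one' := Subtype.ext (by simp)
  map_mul' a b := Subtype.ext (by
    change (w : G R n)⁻¹ * (a * b) * w = ((w : G R n)⁻¹ * a * w) * ((w : G R n)⁻¹ * b * w)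
    group)

lemma diag_mul_apply {l : G R n} (hl : l ∈ L R n) (g : G R n) (i j : Fin n) :
    (l * g).val i j = l.val i i * g.val i j := by
  rw [Units.val_mul, Matrix.mul_apply]
  refine Finset.sum_eq_single i (fun k _ hk => ?_) (by simp)
  rw [hl i k hk.symm, zero_mul]

lemma mul_diag_apply {l : G R n} (hl : l ∈ L R n) (g : G R n) (i j : Fin n) :
    (g * l).val i j = g.val i j * l.val j j := by
  rw [Units.val_mul, Matrix.mul_apply]
  refine Finset.sum_eq_single j (fun k _ hk => ?_) (by simp)
  rw [hl k j hk, mul_zero]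

lemma conj_mem_unipotent {α : Type} [LinearOrder α] (b : Fin n ≃ α) {l g : G R n}
    (hl : l ∈ L R n) (hg : g ∈ unipotent R b) : l * g * l⁻¹ ∈ unipotent R b := by
  have hl' := (L R n).inv_mem hl
  refine ⟨fun i => ?_, fun i j h => ?_⟩
  · rw [mul_diag_apply hl', diag_mul_apply hl, hg.1, mul_one, ← diag_mul_apply hl, mul_inv_cancel]
    simp
  · rw [mul_diag_apply hl', diag_mul_apply hl, hg.2 i j h, mul_zero, zero_mul]

end Groups

/-! ### Idempotents in the group ring and the functors -/

section Idempotent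

/-- The element `e_H = |H|⁻¹ ∑_{h ∈ H} h` of the complex group ring of a finite group. -/
def idem {K : Type u} [Group K] [Finite K] (H : Subgroup K) : MonoidAlgebra ℂ K :=
  letI := Fintype.ofFinite H
  (Nat.card H : ℂ)⁻¹ • ∑ h : H, MonoidAlgebra.single (h : K) 1

/-- If `l` normalises `H`, then `l` commutes with `e_H`. -/
lemma commute_idem {K : Type u} [Group K] [Finite K] (H N : Subgroup K)
    (h : ∀ l ∈ N, ∀ g ∈ H, l * g * l⁻¹ ∈ H) {l : K} (hl : l ∈ N) :
    Commute (MonoidAlgebra.single l (1 : ℂ)) (idem H) := by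
  let := Fintype.ofFinite H
  refine Commute.smul_right ?_ _
  change MonoidAlgebra.single l (1 : ℂ) * _ = _ * MonoidAlgebra.single l (1 : ℂ)
  rw [Finset.mul_sum, Finset.sum_mul]
  refine Fintype.sum_bijective (fun g : H => (⟨l * g * l⁻¹, h l hl g g.2⟩ : H)) ⟨?_, ?_⟩ _ _ ?_
  · intro a b hab
    have := congrArg Subtype.val hab
    exact Subtype.ext (by simpa using this)
  · intro a
    refine ⟨⟨l⁻¹ * a * l, by simpa using h l⁻¹ (N.inv_mem hl) a a.2⟩, Subtype.ext ?_⟩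
    change l * (l⁻¹ * a * l) * l⁻¹ = a
    group
  · intro a
    simp [MonoidAlgebra.single_mul_single]

end Idempotent

section Functors

variable (R : Type u) [CommRing R] [Finite R] (n : ℕ)

/-- The complex group ring `ℂ[G]`. -/
abbrev CG : Type u := MonoidAlgebra ℂ (G R n)

/-- The complex group ring `ℂ[L]`. -/
abbrev CL : Type u := MonoidAlgebra ℂ (L R n)

/-- The inclusion `ℂ[L] → ℂ[G]`. -/
def incl : CL R n →+* CG R n := MonoidAlgebra.mapDomainRingHom ℂ (L R n).subtype

/-- The product `e_U e_V` in `ℂ[G]`. -/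
def eUV : CG R n := idem (U R n) * idem (V R n)

lemma commute_eUV (a : CL R n) : Commute (incl R n a) (eUV R n) := by
  induction a using MonoidAlgebra.induction_linear with
  | zero => rw [map_zero]; exact Commute.zero_left _
  | add f g hf hg => rw [map_add]; exact hf.add_left hg
  | single l c =>
    have e : incl R n (MonoidAlgebra.single l c) = c • MonoidAlgebra.single (l : G R n) (1 : ℂ) := by
      simp [incl, MonoidAlgebra.mapDomainRingHom_apply]
    rw [e]
    refine Commute.smul_left (Commute.mul_right ?_ ?_) c
    · exact commute_idem _ (L R n) (fun l hl g hg => conj_mem_unipotent _ hl hg) l.2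
    · exact commute_idem _ (L R n) (fun l hl g hg => conj_mem_unipotent _ hl hg) l.2

/-- The `ℂ[G]`-`ℂ[L]`-bimodule `ℂ[G] e_U e_V`. -/
def indBimodule : SubBimodule (RingHom.id (CG R n)) (incl R n) where
  carrier := (AddMonoidHom.mulRight (eUV R n)).range
  left_mem b x := by
    rintro ⟨a, rfl⟩
    exact ⟨b * a, mul_assoc _ _ _⟩
  right_mem c x := by
    rintro ⟨a, rfl⟩
    refine ⟨a * incl R n c, ?_⟩
    change a * incl R n c * eUV R n = a * eUV R n * incl R n c
    rw [mul_assoc, mul_assoc, (commute_eUV R n c).eq]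

/-- The `ℂ[L]`-`ℂ[G]`-bimodule `e_U e_V ℂ[G]`. -/
def resBimodule : SubBimodule (incl R n) (RingHom.id (CG R n)) where
  carrier := (AddMonoidHom.mulLeft (eUV R n)).range
  left_mem b x := by
    rintro ⟨a, rfl⟩
    refine ⟨incl R n b * a, ?_⟩
    change eUV R n * (incl R n b * a) = incl R n b * (eUV R n * a)
    rw [← mul_assoc, ← mul_assoc, (commute_eUV R n b).eq]
  right_mem c x := by
    rintro ⟨a, rfl⟩
    exact ⟨a * c, (mul_assoc _ _ _).symm⟩

/-- Complex representations of `G`, as left `ℂ[G]`-modules. -/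
abbrev RepG : Type _ := ModuleCat.{max u v} (CG R n)

/-- Complex representations of `L`, as left `ℂ[L]`-modules. -/
abbrev RepL : Type _ := ModuleCat.{max u v} (CL R n)

/-- The induction functor `X ↦ ℂ[G] e_U e_V ⊗_{ℂ[L]} X`. -/
def pind : RepL.{u, v} R n ⥤ RepG.{u, v} R n := (indBimodule R n).tensorFunctor

/-- The restriction functor `Y ↦ e_U e_V ℂ[G] ⊗_{ℂ[G]} Y`. -/
def pres : RepG.{u, v} R n ⥤ RepL.{u, v} R n := (resBimodule R n).tensorFunctor

variable {R n}

/-- The functor `w^*`, which sends a representation `χ` of `L` to `χ ∘ Ad_w⁻¹` on the same space,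
and a morphism to the same linear map. -/
def wStar (w : W R n) : RepL.{u, v} R n ⥤ RepL.{u, v} R n :=
  ModuleCat.restrictScalars (MonoidAlgebra.mapDomainRingHom ℂ (adInv w))

/-- The direct sum `⨁_{w ∈ W} w^*`, as a functor: on objects `X ↦ ⨁_{w ∈ W} w^* X`, and on
morphisms `φ ↦ ⨁_{w ∈ W} w^* φ`. -/
def wSum (R : Type u) [CommRing R] [Finite R] (n : ℕ) : RepL.{u, v} R n ⥤ RepL.{u, v} R n where
  obj X := ModuleCat.of (CL R n) (DirectSum (W R n) fun w => (wStar.{u, v} w).obj X)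
  map φ := ModuleCat.ofHom (DirectSum.lmap fun w => ((wStar.{u, v} w).map φ).hom)
  map_id X := by
    simp only [CategoryTheory.Functor.map_id, ModuleCat.hom_id]
    rw [DirectSum.lmap_id]; rfl
  map_comp φ ψ := by
    simp only [CategoryTheory.Functor.map_comp, ModuleCat.hom_comp]
    rw [DirectSum.lmap_comp]; rfl

end Functors

end HC

end

/-!
# The composite of induction and restriction for `GL_n` of a finite ring

Put `T = e_U e_V`. Both parts of the theorem follow from one statement about the group ring: the
elements `m_w = e_U w T`, for `w ∈ W`, form a basis of `T ℂ[G] T` as a right `ℂ[L]`-module, and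
`l m_w = m_w (w⁻¹ l w)` for `l ∈ L`. Since `ℂ[G]` is semisimple there is `y` with `T y T = T`, so
that `T ℂ[G] ⊗ Y` is identified with `T Y`; and `T (ℂ[G] T ⊗ X) = T ℂ[G] T ⊗ X` is then the direct
sum of the twists `w^* X`. The formula for the dimension follows from the adjunction
`Hom_G(ℂ[G] T ⊗ χ, Y) = Hom_L(χ, T Y)` and Schur's lemma.

For a local ring the statement is proved with the Iwahori subgroup `I` of matrices that are
upper-triangular modulo the maximal ideal, and the congruence subgroups `U₁`, `V₁` of `U`, `V`. The
properties of these groups that matter are collected in `IwahoriDatum`.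

* Upper bound (`IwahoriDatum.finrank_sandwich_le`). With `S = e_U e_{V₁}`, the element `T` equals
  `S e_V`, and also `p S q` for some `p` and `q`. If `A = I ∩ w V w⁻¹`, the factorisations of `U`,
  `V₁` and `A` by `w` give `S ∈ p_w e_A ℂ[I]`, and `I g ⊆ A L w U` whenever `g` lies in the cell of
  `w`. So `S ℂ[G] S` is spanned by the elements `p_w e_A l w S`, and `dim T ℂ[G] T ≤ |W| |L|`.
* Independence (`IwahoriDatum.eq_zero_of_sum_eq_zero`). If `∑ m_w b_w = 0`, then
  `∑ e_U w S b_w = 0`, because `S ∈ T ℂ[G]`. Multiply by the inverse of one `w` and keep only the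
  part supported on the matrices that are diagonal modulo the maximal ideal: the Bruhat
  decomposition over the residue field leaves only the term of this `w`, and shows that
  `e_{V₁} e_{U₁} e_{V₁} b_w = 0`. Positivity of the adjoint on the group ring gives
  `e_{U₁} e_{V₁} b_w = 0`, and the part of this element supported on `L` is a multiple of `b_w`.

The relation `S ∈ T ℂ[G]` used here (`exists_idem_mul_idem_congrV`) says that every left annihilator
of `T` annihilates `S`. With `s` a simple reflection, it is obtained from the implication
`c e_U s S = 0 → c S = 0`, which is a computation in a group generated by two opposite root
subgroups, applied along a chain of simple reflections from the longest permutation to the identity.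

A finite ring is a product of local rings, and everything above is compatible with products
(`IwahoriDatum.pi`, `exists_idem_mul_idem_pi`).
-/

noncomputable section

namespace HC

/-! ### Group elements in the group ring -/

section GroupAlgebra

variable {K : Type u} [Group K]

/-- A group element, as an element of the complex group ring. -/
abbrev elt (g : K) : MonoidAlgebra ℂ K := MonoidAlgebra.single g 1

lemma elt_mul_elt (g h : K) : elt g * elt h = elt (g * h) := by
  simp [MonoidAlgebra.single_mul_single]

lemma elt_one : elt (1 : K) = 1 := rfl

lemma elt_inv_mul (g : K) : elt g⁻¹ * elt g = 1 := by
  rw [elt_mul_elt, inv_mul_cancel, elt_one]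

lemma elt_mul_inv (g : K) : elt g * elt g⁻¹ = 1 := by
  rw [elt_mul_elt, mul_inv_cancel, elt_one]

lemma eq_sum_elt [Fintype K] (x : MonoidAlgebra ℂ K) : x = ∑ g, x.coeff g • elt g := by
  ext h
  simp [MonoidAlgebra.coeff_sum]

/-! ### Restricting supports -/

/-- The projection of the group ring onto the elements supported on a subset. -/
def restr (D : Set K) : MonoidAlgebra ℂ K →ₗ[ℂ] MonoidAlgebra ℂ K where
  toFun x := .ofCoeff (by classical exact x.coeff.filter (· ∈ D))
  map_add' x y := by
    classical
    ext g
    simp only [MonoidAlgebra.coeff_add, Finsupp.filter_add]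
  map_smul' c x := by
    classical
    ext g
    simp only [MonoidAlgebra.coeff_smul, Finsupp.filter_smul]
    rfl

lemma restr_elt_of_mem {A : Type u} {D : Set A} {g : A} (hg : g ∈ D) : restr D (elt g) = elt g := by
  classical
  refine MonoidAlgebra.coeff_injective ?_
  exact Finsupp.filter_single_of_pos _ hg

lemma restr_elt_of_notMem {A : Type u} {D : Set A} {g : A} (hg : g ∉ D) : restr D (elt g) = 0 := by
  classical
  refine MonoidAlgebra.coeff_injective ?_
  exact Finsupp.filter_single_of_neg _ hg

/-- The group ring of a subgroup, inside that of the group. -/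
def groupSubalgebra (M : Subgroup K) : Subalgebra ℂ (MonoidAlgebra ℂ K) :=
  (MonoidAlgebra.mapDomainAlgHom ℂ ℂ M.subtype).range

lemma elt_mem_groupSubalgebra {M : Subgroup K} {g : K} (hg : g ∈ M) :
    elt g ∈ groupSubalgebra M :=
  ⟨MonoidAlgebra.single ⟨g, hg⟩ 1, by simp⟩

lemma groupSubalgebra_induction {M : Subgroup K} {p : MonoidAlgebra ℂ K → Prop}
    (h0 : p 0) (hadd : ∀ x y, p x → p y → p (x + y))
    (hsmul : ∀ (c : ℂ), ∀ g ∈ M, p (c • elt g)) {x : MonoidAlgebra ℂ K}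
    (hx : x ∈ groupSubalgebra M) : p x := by
  obtain ⟨y, rfl⟩ := hx
  induction y using MonoidAlgebra.induction_linear with
  | zero => simpa using h0
  | add a b ha hb => rw [map_add]; exact hadd _ _ ha hb
  | single g c => simpa using hsmul c g g.2

/-- The projection to a union of cosets `M g` commutes with left multiplication by the group ring
of `M`. -/
lemma restr_mul_left {M : Subgroup K} {D : Set K} (hD : ∀ g ∈ M, ∀ x, g * x ∈ D ↔ x ∈ D)
    {y : MonoidAlgebra ℂ K} (hy : y ∈ groupSubalgebra M) (x : MonoidAlgebra ℂ K) :
    restr D (y * x) = y * restr D x := by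
  refine groupSubalgebra_induction (p := fun y => restr D (y * x) = y * restr D x)
    (by simp) (fun a b ha hb => by rw [add_mul, map_add, ha, hb, add_mul]) (fun c g hg => ?_) hy
  rw [smul_mul_assoc, map_smul, smul_mul_assoc]
  congr 1
  induction x using MonoidAlgebra.induction_linear with
  | zero => simp
  | add a b ha hb => rw [mul_add, map_add, map_add, ha, hb, mul_add]
  | single h d =>
    have e : MonoidAlgebra.single h d = d • elt h := by simp
    rw [e, mul_smul_comm, map_smul, map_smul, mul_smul_comm, elt_mul_elt]
    by_cases hh : h ∈ D
    · rw [restr_elt_of_mem hh, restr_elt_of_mem ((hD g hg h).2 hh), elt_mul_elt]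
    · rw [restr_elt_of_notMem hh, restr_elt_of_notMem (fun h' => hh ((hD g hg h).1 h')), mul_zero]

lemma restr_mul_right {M : Subgroup K} {D : Set K} (hD : ∀ g ∈ M, ∀ x, x * g ∈ D ↔ x ∈ D)
    {y : MonoidAlgebra ℂ K} (hy : y ∈ groupSubalgebra M) (x : MonoidAlgebra ℂ K) :
    restr D (x * y) = restr D x * y := by
  refine groupSubalgebra_induction (p := fun y => restr D (x * y) = restr D x * y)
    (by simp) (fun a b ha hb => by rw [mul_add, map_add, ha, hb, mul_add]) (fun c g hg => ?_) hy
  rw [mul_smul_comm, map_smul, mul_smul_comm]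
  congr 1
  induction x using MonoidAlgebra.induction_linear with
  | zero => simp
  | add a b ha hb => rw [add_mul, map_add, map_add, ha, hb, add_mul]
  | single h d =>
    have e : MonoidAlgebra.single h d = d • elt h := by simp
    rw [e, smul_mul_assoc, map_smul, map_smul, smul_mul_assoc, elt_mul_elt]
    by_cases hh : h ∈ D
    · rw [restr_elt_of_mem hh, restr_elt_of_mem ((hD g hg h).2 hh), elt_mul_elt]
    · rw [restr_elt_of_notMem hh, restr_elt_of_notMem (fun h' => hh ((hD g hg h).1 h')), zero_mul]

lemma restr_mem_groupSubalgebra (M : Subgroup K) (x : MonoidAlgebra ℂ K) :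
    restr (M : Set K) x ∈ groupSubalgebra M := by
  induction x using MonoidAlgebra.induction_linear with
  | zero => rw [map_zero]; exact zero_mem _
  | add a b ha hb => rw [map_add]; exact add_mem ha hb
  | single h d =>
    have e : MonoidAlgebra.single h d = d • elt h := by simp
    rw [e, map_smul]
    refine Subalgebra.smul_mem _ ?_ d
    by_cases hh : h ∈ (M : Set K)
    · rw [restr_elt_of_mem hh]; exact elt_mem_groupSubalgebra hh
    · rw [restr_elt_of_notMem hh]; exact zero_mem _

lemma restr_of_mem {M : Subgroup K} {x : MonoidAlgebra ℂ K} (hx : x ∈ groupSubalgebra M) :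
    restr (M : Set K) x = x := by
  refine groupSubalgebra_induction (p := fun y => restr (M : Set K) y = y) (map_zero _)
    (fun a b ha hb => by rw [map_add, ha, hb]) (fun c g hg => ?_) hx
  rw [map_smul, restr_elt_of_mem hg]

/-- The conjugate subgroup `w H w⁻¹`. -/
def conjBy (w : K) (H : Subgroup K) : Subgroup K := H.comap (MulAut.conj w⁻¹).toMonoidHom

lemma mem_conjBy {w x : K} {H : Subgroup K} : x ∈ conjBy w H ↔ w⁻¹ * x * w ∈ H := by
  simp [conjBy]

variable [Finite K]

/-! ### Positivity and semisimplicity -/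

/-- The conjugate-linear anti-automorphism `∑ c_g g ↦ ∑ conj(c_g) g⁻¹` of the group ring. -/
def adj (x : MonoidAlgebra ℂ K) : MonoidAlgebra ℂ K :=
  .ofCoeff (Finsupp.equivFunOnFinite.symm fun g => star (x.coeff g⁻¹))

lemma coeff_adj (x : MonoidAlgebra ℂ K) (g : K) : (adj x).coeff g = star (x.coeff g⁻¹) := rfl

lemma adj_zero : adj (0 : MonoidAlgebra ℂ K) = 0 := by
  ext g; simp [coeff_adj]

lemma adj_add (x y : MonoidAlgebra ℂ K) : adj (x + y) = adj x + adj y := by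
  ext g; simp [coeff_adj]

lemma adj_single (g : K) (c : ℂ) :
    adj (MonoidAlgebra.single g c) = MonoidAlgebra.single g⁻¹ (star c) := by
  classical
  ext h
  simp only [coeff_adj, MonoidAlgebra.coeff_single, Finsupp.single_apply, inv_eq_iff_eq_inv]
  by_cases hh : h = g⁻¹
  · simp [hh]
  · have h1 : g ≠ h⁻¹ := fun e => hh (by rw [e, inv_inv])
    simp [h1]

lemma adj_adj (x : MonoidAlgebra ℂ K) : adj (adj x) = x := by
  ext g; simp [coeff_adj]

lemma adj_mul (x y : MonoidAlgebra ℂ K) : adj (x * y) = adj y * adj x := by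
  induction x using MonoidAlgebra.induction_linear with
  | zero => simp [adj_zero]
  | add a b ha hb => rw [add_mul, adj_add, adj_add, mul_add, ha, hb]
  | single g c =>
    induction y using MonoidAlgebra.induction_linear with
    | zero => simp [adj_zero]
    | add a b ha hb => rw [mul_add, adj_add, adj_add, add_mul, ha, hb]
    | single h d =>
      simp [adj_single, MonoidAlgebra.single_mul_single, mul_comm]

/-- The coefficient of `1` in `x x^*` is `∑ |x_g|²`, so `x x^*` vanishes only for `x = 0`. -/
lemma eq_zero_of_mul_adj {x : MonoidAlgebra ℂ K} (h : x * adj x = 0) : x = 0 := by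
  have := Fintype.ofFinite K
  have h1 : (x * adj x).coeff 1 = ∑ g, x.coeff g * star (x.coeff g) := by
    conv_lhs => rw [eq_sum_elt x, Finset.sum_mul]
    rw [MonoidAlgebra.coeff_sum, Finsupp.finsetSum_apply]
    refine Finset.sum_congr rfl fun g _ => ?_
    rw [smul_mul_assoc, MonoidAlgebra.coeff_smul_apply, MonoidAlgebra.coeff_single_mul_apply,
      ← eq_sum_elt, coeff_adj]
    simp
  rw [h] at h1
  have h2 : ∑ g, ‖x.coeff g‖ ^ 2 = 0 := by
    have : ((∑ g, ‖x.coeff g‖ ^ 2 : ℝ) : ℂ) = 0 := by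
      rw [Complex.ofReal_sum, MonoidAlgebra.coeff_zero, Finsupp.coe_zero, Pi.zero_apply] at *
      rw [h1]
      exact Finset.sum_congr rfl fun g _ => by
        rw [Complex.star_def, Complex.mul_conj, Complex.normSq_eq_norm_sq]
    exact_mod_cast this
  ext g
  have := (Finset.sum_eq_zero_iff_of_nonneg fun _ _ => by positivity).1 h2 g (Finset.mem_univ g)
  simpa using this

/-- The group ring is von Neumann regular: by Maschke's theorem the left ideal generated by `x` has a
complement. -/
lemma exists_mul_mul_eq (x : MonoidAlgebra ℂ K) : ∃ z, x * z * x = x := by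
  obtain ⟨q, hq⟩ := exists_isCompl (Submodule.span (MonoidAlgebra ℂ K) {x})
  have h1 : (1 : MonoidAlgebra ℂ K) ∈ Submodule.span (MonoidAlgebra ℂ K) {x} ⊔ q := by
    rw [hq.sup_eq_top]; trivial
  obtain ⟨a, ha, b, hb, hab⟩ := Submodule.mem_sup.1 h1
  obtain ⟨z, rfl⟩ := Submodule.mem_span_singleton.1 ha
  have hx : x * b = x - x * z * x := by
    rw [eq_sub_iff_add_eq', mul_assoc, ← smul_eq_mul (z), ← mul_add, hab, mul_one]
  have hxb : x * b ∈ Submodule.span (MonoidAlgebra ℂ K) {x} ⊓ q := by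
    refine ⟨?_, q.smul_mem x hb⟩
    rw [hx]
    exact sub_mem (Submodule.mem_span_singleton_self x)
      (Submodule.smul_mem _ _ (Submodule.mem_span_singleton_self x))
  rw [hq.inf_eq_bot, Submodule.mem_bot] at hxb
  exact ⟨z, (sub_eq_zero.1 (hx.symm.trans hxb)).symm⟩

/-- Right ideals of the group ring are determined by their left annihilators. -/
lemma exists_eq_mul_of_annihilator {x y : MonoidAlgebra ℂ K} (h : ∀ c, c * x = 0 → c * y = 0) :
    ∃ z, y = x * z := by
  obtain ⟨z, hz⟩ := exists_mul_mul_eq x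
  have := h (1 - x * z) (by rw [sub_mul, one_mul, hz, sub_self])
  rw [sub_mul, one_mul, sub_eq_zero] at this
  exact ⟨z * y, by rw [← mul_assoc]; exact this⟩

/-! ### The idempotents of subgroups -/

lemma idem_eq [Fintype K] (H : Subgroup K) [Fintype H] :
    idem H = (Nat.card H : ℂ)⁻¹ • ∑ h : H, elt (h : K) := by
  unfold idem
  congr!

lemma card_ne_zero (H : Subgroup K) : (Nat.card H : ℂ) ≠ 0 :=
  Nat.cast_ne_zero.2 Nat.card_pos.ne'

lemma elt_mul_idem {H : Subgroup K} {h : K} (hh : h ∈ H) : elt h * idem H = idem H := by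
  have := Fintype.ofFinite K
  have := Fintype.ofFinite H
  rw [idem_eq, mul_smul_comm, Finset.mul_sum]
  congr 1
  exact Fintype.sum_equiv (Equiv.mulLeft (⟨h, hh⟩ : H)) _ _ fun g => elt_mul_elt _ _

lemma idem_mul_elt {H : Subgroup K} {h : K} (hh : h ∈ H) : idem H * elt h = idem H := by
  have := Fintype.ofFinite K
  have := Fintype.ofFinite H
  rw [idem_eq, smul_mul_assoc, Finset.sum_mul]
  congr 1
  exact Fintype.sum_equiv (Equiv.mulRight (⟨h, hh⟩ : H)) _ _ fun g => elt_mul_elt _ _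

/-- Averaging a constant over a subgroup. -/
lemma mul_idem_mul_eq {H : Subgroup K} {x y c : MonoidAlgebra ℂ K}
    (h : ∀ g ∈ H, x * elt g * y = c) : x * idem H * y = c := by
  have := Fintype.ofFinite K
  have := Fintype.ofFinite H
  rw [idem_eq, mul_smul_comm, smul_mul_assoc, Finset.mul_sum, Finset.sum_mul,
    Finset.sum_congr rfl fun (g : H) _ => h g g.2, Finset.sum_const, Finset.card_univ,
    ← Nat.card_eq_fintype_card, ← Nat.cast_smul_eq_nsmul ℂ, smul_smul,
    inv_mul_cancel₀ (card_ne_zero H), one_smul]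

lemma idem_mul_idem_of_le {H H' : Subgroup K} (h : H ≤ H') : idem H * idem H' = idem H' := by
  rw [← one_mul (idem H)]
  exact mul_idem_mul_eq fun g hg => by rw [one_mul, elt_mul_idem (h hg)]

lemma idem_mul_idem_of_ge {H H' : Subgroup K} (h : H ≤ H') : idem H' * idem H = idem H' := by
  rw [← mul_one (idem H' * idem H)]
  exact mul_idem_mul_eq fun g hg => by rw [mul_one, idem_mul_elt (h hg)]

lemma idem_mul_self (H : Subgroup K) : idem H * idem H = idem H := idem_mul_idem_of_le le_rfl

/-- If `H = H₁ H₂` then `e_H = e_{H₁} e_{H₂}`. -/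
lemma idem_eq_mul {H H₁ H₂ : Subgroup K} (h₁ : H₁ ≤ H) (h₂ : H₂ ≤ H)
    (h : ∀ x ∈ H, ∃ a ∈ H₁, ∃ b ∈ H₂, x = a * b) : idem H = idem H₁ * idem H₂ := by
  have : idem H₁ * idem H * idem H₂ = idem H₁ * idem H₂ := by
    refine mul_idem_mul_eq fun x hx => ?_
    obtain ⟨a, ha, b, hb, rfl⟩ := h x hx
    rw [← elt_mul_elt, ← mul_assoc, idem_mul_elt ha, mul_assoc, elt_mul_idem hb]
  rw [← this, idem_mul_idem_of_le h₁, idem_mul_idem_of_ge h₂]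

/-- If `H = H₁ H₂` then `e_H = e_{H₂} e_{H₁}`. -/
lemma idem_eq_mul' {H H₁ H₂ : Subgroup K} (h₁ : H₁ ≤ H) (h₂ : H₂ ≤ H)
    (h : ∀ x ∈ H, ∃ a ∈ H₁, ∃ b ∈ H₂, x = a * b) : idem H = idem H₂ * idem H₁ := by
  refine idem_eq_mul h₂ h₁ fun x hx => ?_
  obtain ⟨a, ha, b, hb, e⟩ := h _ (inv_mem hx)
  exact ⟨b⁻¹, inv_mem hb, a⁻¹, inv_mem ha, by rw [← _root_.mul_inv_rev, ← e, inv_inv]⟩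

/-- If `w H w⁻¹ = H'` then `w e_H = e_{H'} w`. -/
lemma elt_mul_idem_eq {H H' : Subgroup K} {w : K} (h : ∀ x, x ∈ H ↔ w * x * w⁻¹ ∈ H') :
    elt w * idem H = idem H' * elt w := by
  have h1 : elt w * idem H * elt w⁻¹ = idem H' * (elt w * idem H * elt w⁻¹) := by
    symm
    rw [← mul_one (idem H')]
    rw [mul_assoc, one_mul, ← one_mul (idem H' * _), ← mul_assoc]
    refine mul_idem_mul_eq fun g hg => ?_
    rw [one_mul, show elt g = elt w * elt (w⁻¹ * g * w) * elt w⁻¹ by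
      rw [elt_mul_elt, elt_mul_elt]; congr 1; group]
    have : w⁻¹ * g * w ∈ H := (h _).2 (by simpa [mul_assoc] using hg)
    calc _ = elt w * (elt (w⁻¹ * g * w) * ((elt w⁻¹ * elt w) * idem H)) * elt w⁻¹ := by
          simp only [mul_assoc]
      _ = _ := by rw [elt_inv_mul, one_mul, elt_mul_idem this]
  have h2 : idem H' * (elt w * idem H * elt w⁻¹) = idem H' := by
    rw [mul_assoc (elt w), ← mul_assoc, ← mul_assoc]
    rw [show idem H' * elt w * idem H * elt w⁻¹ = (idem H' * elt w) * idem H * elt w⁻¹ from rfl]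
    refine mul_idem_mul_eq fun g hg => ?_
    rw [mul_assoc, mul_assoc, elt_mul_elt, elt_mul_elt, ← mul_assoc, idem_mul_elt ((h _).1 hg)]
  rw [← h2, ← h1, mul_assoc _ (elt w⁻¹), elt_inv_mul, mul_one]

/-- If `N` normalises `H` then `e_N` and `e_H` commute. -/
lemma idem_comm {H N : Subgroup K} (h : ∀ l ∈ N, ∀ g ∈ H, l * g * l⁻¹ ∈ H) :
    idem N * idem H = idem H * idem N := by
  have := Fintype.ofFinite K
  have := Fintype.ofFinite N
  rw [idem_eq N, smul_mul_assoc, mul_smul_comm, Finset.sum_mul, Finset.mul_sum]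
  congr 1
  exact Finset.sum_congr rfl fun l _ => (commute_idem H N h l.2).eq

lemma adj_idem (H : Subgroup K) : adj (idem H) = idem H := by
  have key : adj (idem H) * idem H = adj (idem H) := by
    rw [← mul_one (adj (idem H) * idem H)]
    refine mul_idem_mul_eq fun g hg => ?_
    rw [mul_one]
    conv_rhs => rw [← elt_mul_idem (inv_mem hg), adj_mul, adj_single, inv_inv, star_one]
  have := congrArg adj key
  rw [adj_mul, adj_adj, key] at this
  exact this

/-- The elements `e_H e_{H'} e_H` and `e_H e_{H'}` have the same left annihilator, since the former
is the product of the latter with its adjoint. -/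
lemma mul_idem_idem_eq_zero {H H' : Subgroup K} {a : MonoidAlgebra ℂ K}
    (h : a * (idem H * idem H' * idem H) = 0) : a * (idem H * idem H') = 0 := by
  refine eq_zero_of_mul_adj ?_
  rw [adj_mul, adj_mul, adj_idem, adj_idem]
  calc a * (idem H * idem H') * (idem H' * idem H * adj a)
      = a * (idem H * (idem H' * idem H') * idem H) * adj a := by simp only [mul_assoc]
    _ = 0 := by rw [idem_mul_self, h, zero_mul]

lemma idem_idem_mul_eq_zero {H H' : Subgroup K} {a : MonoidAlgebra ℂ K}
    (h : idem H * idem H' * idem H * a = 0) : idem H' * idem H * a = 0 := by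
  have h1 := congrArg adj h
  rw [adj_mul, adj_mul, adj_mul, adj_idem, adj_idem, adj_zero, ← mul_assoc (idem H)] at h1
  have h2 := congrArg adj (mul_idem_idem_eq_zero h1)
  rwa [adj_mul, adj_mul, adj_adj, adj_idem, adj_idem, adj_zero] at h2

lemma idem_mem_groupSubalgebra {H M : Subgroup K} (h : H ≤ M) : idem H ∈ groupSubalgebra M := by
  have := Fintype.ofFinite K
  have := Fintype.ofFinite H
  rw [idem_eq]
  exact Subalgebra.smul_mem _ (Subalgebra.sum_mem _ fun g _ =>
    elt_mem_groupSubalgebra (h g.2)) _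

/-- `e_H e_{H'}` and `e_H e_{H'} e_H` generate the same right ideal, already in the group ring of any
subgroup containing `H` and `H'`. -/
lemma exists_idem_mul_idem_eq {H H' I : Subgroup K} (h : H ≤ I) (h' : H' ≤ I) :
    ∃ z ∈ groupSubalgebra I, idem H * idem H' = idem H * idem H' * idem H * z := by
  obtain ⟨z, hz⟩ := exists_eq_mul_of_annihilator fun c (hc : c * (idem H * idem H' * idem H) = 0) =>
    mul_idem_idem_eq_zero hc
  refine ⟨restr I z, restr_mem_groupSubalgebra I z, ?_⟩
  have h1 := idem_mem_groupSubalgebra h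
  have h2 := idem_mem_groupSubalgebra h'
  rw [← restr_mul_left (M := I) (fun g hg x => Subgroup.mul_mem_cancel_left I hg)
    (mul_mem (mul_mem h1 h2) h1), ← hz, restr_of_mem (mul_mem h1 h2)]

end GroupAlgebra

/-! ### Iwahori data -/

section Datum

variable {K : Type u} [Group K]

lemma commute_idem_of_mem [Finite K] {L H : Subgroup K} (hH : ∀ l ∈ L, ∀ g ∈ H, l * g * l⁻¹ ∈ H)
    {b : MonoidAlgebra ℂ K} (hb : b ∈ groupSubalgebra L) : Commute b (idem H) := by
  refine groupSubalgebra_induction (p := fun b => Commute b (idem H)) (Commute.zero_left _)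
    (fun _ _ h h' => h.add_left h') (fun c g hg => ?_) hb
  exact (commute_idem H L hH hg).smul_left c

/-- The properties of a configuration of subgroups on which the description of
`e_U e_V ℂ[K] e_U e_V` rests. In the main example `K` is `GL_n` of a finite local ring, `U`, `V`,
`L` and `W` are as usual, `I` is the Iwahori subgroup of matrices which are upper-triangular modulo
the maximal ideal, `M` the subgroup of matrices which are diagonal modulo the maximal ideal, and
`U₁`, `V₁` are the subgroups of `U`, `V` of matrices congruent to `1`. -/
structure IwahoriDatum (U V L W U₁ V₁ I M : Subgroup K) : Prop where
  U₁_le : U₁ ≤ U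
  V₁_le : V₁ ≤ V
  U_le_I : U ≤ I
  V₁_le_I : V₁ ≤ I
  U₁_le_M : U₁ ≤ M
  V₁_le_M : V₁ ≤ M
  L_le_M : L ≤ M
  conj_U : ∀ l ∈ L, ∀ g ∈ U, l * g * l⁻¹ ∈ U
  conj_V : ∀ l ∈ L, ∀ g ∈ V, l * g * l⁻¹ ∈ V
  conj_V₁ : ∀ l ∈ L, ∀ g ∈ V₁, l * g * l⁻¹ ∈ V₁
  U_factor : ∀ w ∈ W, ∀ x ∈ U, ∃ a ∈ U ⊓ conjBy w V, ∃ b ∈ U ⊓ conjBy w U, x = a * b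
  V_factor : ∀ w ∈ W, ∀ x ∈ V, ∃ a ∈ V ⊓ conjBy w V, ∃ b ∈ V ⊓ conjBy w U, x = a * b
  V₁_factor : ∀ w ∈ W, ∀ x ∈ V₁, ∃ a ∈ V₁ ⊓ conjBy w U, ∃ b ∈ V₁ ⊓ conjBy w V, x = a * b
  I_factor : ∀ w ∈ W, ∀ x ∈ I ⊓ conjBy w V,
    ∃ a ∈ V₁ ⊓ conjBy w V, ∃ b ∈ U ⊓ conjBy w V, x = a * b
  bruhat : ∀ g, ∃ w ∈ W, ∀ i ∈ I, ∃ a ∈ I ⊓ conjBy w V, ∃ l ∈ L, ∃ x ∈ U, i * g = a * l * w * x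
  disjoint_cells : ∀ w ∈ W, ∀ w' ∈ W, ∀ x ∈ U, ∀ y ∈ U, w⁻¹ * x * w' * y ∈ M →
    w = w' ∧ ∃ a ∈ V₁, ∃ b ∈ U₁, w⁻¹ * x * w' * y = a * b
  big_cell : ∀ x ∈ U, ∀ y ∈ V, x * y ∈ L → x = 1 ∧ y = 1

namespace IwahoriDatum

variable {U V L W U₁ V₁ I M : Subgroup K} [Finite K] (D : IwahoriDatum U V L W U₁ V₁ I M)
include D

/-- `e_U w e_U e_V = e_U e_V w e_{V ∩ w⁻¹Uw}`, so that this element lies in both the right and the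
left ideal generated by `e_U e_V`. -/
lemma idem_mul_elt_mul {w : K} (hw : w ∈ W) :
    idem U * elt w * (idem U * idem V) =
      idem U * idem V * (elt w * idem (V ⊓ conjBy w⁻¹ U)) := by
  have hw' := W.inv_mem hw
  have hU : idem U = idem (U ⊓ conjBy w⁻¹ U) * idem (U ⊓ conjBy w⁻¹ V) :=
    idem_eq_mul' inf_le_left inf_le_left (D.U_factor _ hw')
  have hV : idem V = idem (V ⊓ conjBy w⁻¹ V) * idem (V ⊓ conjBy w⁻¹ U) :=
    idem_eq_mul inf_le_left inf_le_left (D.V_factor _ hw')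
  have hV' : idem (conjBy w⁻¹ V) = idem (U ⊓ conjBy w⁻¹ V) * idem (V ⊓ conjBy w⁻¹ V) := by
    refine idem_eq_mul' inf_le_right inf_le_right fun x hx => ?_
    obtain ⟨a, ha, b, hb, e⟩ := D.V_factor w hw _ (mem_conjBy.1 hx)
    refine ⟨w⁻¹ * a * w, ⟨mem_conjBy.1 ha.2, ?_⟩, w⁻¹ * b * w, ⟨mem_conjBy.1 hb.2, ?_⟩, ?_⟩
    · exact mem_conjBy.2 (by simpa [mul_assoc] using ha.1)
    · exact mem_conjBy.2 (by simpa [mul_assoc] using hb.1)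
    · have : x = w⁻¹ * (a * b) * w := by rw [← e]; group
      rw [this]; group
  have c : ∀ H : Subgroup K, elt w * idem (conjBy w⁻¹ H) = idem H * elt w := fun H =>
    elt_mul_idem_eq fun x => by rw [mem_conjBy]; simp
  rw [← c U]
  calc elt w * idem (conjBy w⁻¹ U) * (idem U * idem V)
      = elt w * (idem (conjBy w⁻¹ U) * idem (U ⊓ conjBy w⁻¹ U)) * ((idem (U ⊓ conjBy w⁻¹ V) *
        idem (V ⊓ conjBy w⁻¹ V)) * idem (V ⊓ conjBy w⁻¹ U)) := by
        nth_rw 1 [hU, hV]; simp only [mul_assoc]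
    _ = (elt w * idem (conjBy w⁻¹ U)) * idem (conjBy w⁻¹ V) * idem (V ⊓ conjBy w⁻¹ U) := by
        rw [idem_mul_idem_of_ge inf_le_right, ← hV']; simp only [mul_assoc]
    _ = _ := by rw [c, mul_assoc (idem U), c]; simp only [mul_assoc]

/-- The restriction of `w⁻¹ e_U w' e_U` to the subgroup `M`. -/
lemma exists_restr_eq {w w' : K} (hw : w ∈ W) (hw' : w' ∈ W) :
    (w ≠ w' → restr (M : Set K) (elt w⁻¹ * idem U * elt w' * idem U) = 0) ∧
    (w = w' → ∃ c : ℂ, c ≠ 0 ∧ idem V₁ * restr (M : Set K) (elt w⁻¹ * idem U * elt w' * idem U) *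
      idem U₁ = c • (idem V₁ * idem U₁)) := by
  classical
  have := Fintype.ofFinite K
  have := Fintype.ofFinite U
  have e : elt w⁻¹ * idem U * elt w' * idem U = ((Nat.card U : ℂ)⁻¹ * (Nat.card U : ℂ)⁻¹) •
      ∑ p : U × U, elt (w⁻¹ * p.1 * w' * p.2) := by
    rw [idem_eq, Fintype.sum_prod_type]
    simp only [mul_smul_comm, smul_mul_assoc, smul_smul]
    congr 1
    simp only [Finset.mul_sum, Finset.sum_mul, elt_mul_elt]
    exact Finset.sum_comm
  have hc : (Nat.card U : ℂ)⁻¹ * (Nat.card U : ℂ)⁻¹ ≠ 0 :=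
    mul_ne_zero (inv_ne_zero (card_ne_zero U)) (inv_ne_zero (card_ne_zero U))
  constructor
  · intro hne
    rw [e, map_smul, map_sum, Finset.sum_eq_zero, smul_zero]
    exact fun p _ => restr_elt_of_notMem fun h =>
      hne (D.disjoint_cells w hw w' hw' _ p.1.2 _ p.2.2 h).1
  · rintro rfl
    refine ⟨((Nat.card U : ℂ)⁻¹ * (Nat.card U : ℂ)⁻¹) *
      (Finset.univ.filter fun p : U × U => w⁻¹ * (p.1 : K) * w * p.2 ∈ M).card, ?_, ?_⟩
    · refine mul_ne_zero hc (Nat.cast_ne_zero.2 (Finset.card_ne_zero.2 ⟨(1, 1), ?_⟩))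
      simp
    · rw [e, map_smul, map_sum, mul_smul_comm, smul_mul_assoc, mul_smul _ (Nat.cast _)]
      congr 1
      rw [Finset.mul_sum, Finset.sum_mul, Nat.cast_smul_eq_nsmul, ← Finset.sum_const,
        Finset.sum_filter]
      refine Finset.sum_congr rfl fun p _ => ?_
      split_ifs with h
      · rw [restr_elt_of_mem h]
        obtain ⟨-, a, ha, b, hb, e⟩ := D.disjoint_cells w hw w hw _ p.1.2 _ p.2.2 h
        rw [e, ← elt_mul_elt, ← mul_assoc, idem_mul_elt ha, mul_assoc, elt_mul_idem hb]
      · rw [restr_elt_of_notMem h, mul_zero, zero_mul]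

/-- As `U₁ V₁` meets `L` only in `1`, the part of `e_{U₁} e_{V₁} b` supported on `L` is a nonzero
multiple of `b`. -/
lemma eq_zero_of_idem_mul {b : MonoidAlgebra ℂ K} (hb : b ∈ groupSubalgebra L)
    (h : idem U₁ * idem V₁ * b = 0) : b = 0 := by
  classical
  have := Fintype.ofFinite K
  have := Fintype.ofFinite U₁
  have := Fintype.ofFinite V₁
  have e : idem U₁ * idem V₁ = ((Nat.card U₁ : ℂ)⁻¹ * (Nat.card V₁ : ℂ)⁻¹) •
      ∑ p : U₁ × V₁, elt ((p.1 : K) * p.2) := by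
    rw [idem_eq, idem_eq, Fintype.sum_prod_type, smul_mul_smul_comm]
    congr 1
    simp only [Finset.mul_sum, Finset.sum_mul, elt_mul_elt]
    exact Finset.sum_comm
  have h1 : restr (L : Set K) (idem U₁ * idem V₁) =
      ((Nat.card U₁ : ℂ)⁻¹ * (Nat.card V₁ : ℂ)⁻¹) • 1 := by
    rw [e, map_smul, map_sum, Finset.sum_eq_single (1, 1)]
    · rw [restr_elt_of_mem] <;> simp [elt_one, L.one_mem]
    · rintro ⟨x, y⟩ - hne
      refine restr_elt_of_notMem fun h => hne ?_
      obtain ⟨hx, hy⟩ := D.big_cell _ (D.U₁_le x.2) _ (D.V₁_le y.2) h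
      exact Prod.ext (Subtype.ext hx) (Subtype.ext hy)
    · simp
  have h2 := congrArg (restr (L : Set K)) h
  rw [restr_mul_right (M := L) (fun g hg x => Subgroup.mul_mem_cancel_right L hg) hb, h1, map_zero,
    smul_mul_assoc, one_mul, smul_eq_zero] at h2
  exact h2.resolve_left
    (mul_ne_zero (inv_ne_zero (card_ne_zero _)) (inv_ne_zero (card_ne_zero _)))

/-- The elements `e_U w e_U e_V`, for `w ∈ W`, are independent over the group ring of `L` acting on
the right. -/
theorem eq_zero_of_sum_eq_zero [Fintype W] (hS : ∃ z, idem U * idem V₁ = idem U * idem V * z)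
    (b : W → MonoidAlgebra ℂ K) (hb : ∀ w, b w ∈ groupSubalgebra L)
    (h : ∑ w : W, idem U * elt (w : K) * (idem U * idem V) * b w = 0) (w : W) : b w = 0 := by
  obtain ⟨z, hz⟩ := hS
  -- Replace `e_V` by `e_{V₁}` on the right.
  have h1 : ∑ w : W, idem U * elt (w : K) * idem U * idem U₁ * idem V₁ * b w = 0 := by
    have : (∑ w : W, idem U * elt (w : K) * b w) * (idem U * idem V) = 0 := by
      rw [← h, Finset.sum_mul]
      refine Finset.sum_congr rfl fun w _ => ?_
      rw [mul_assoc _ (b w), mul_assoc _ (idem U * idem V),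
        ((commute_idem_of_mem D.conj_U (hb w)).mul_right (commute_idem_of_mem D.conj_V (hb w))).eq]
    have h2 : (∑ w : W, idem U * elt (w : K) * b w) * (idem U * idem V₁) = 0 := by
      rw [hz, ← mul_assoc, this, zero_mul]
    rw [← h2, Finset.sum_mul]
    refine Finset.sum_congr rfl fun w _ => ?_
    rw [mul_assoc _ (b w),
      ((commute_idem_of_mem D.conj_U (hb w)).mul_right (commute_idem_of_mem D.conj_V₁ (hb w))).eq,
      mul_assoc _ (idem U) (idem U₁), idem_mul_idem_of_ge D.U₁_le]
    simp only [mul_assoc]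
  have hM : ∀ g ∈ M, ∀ x, x * g ∈ (M : Set K) ↔ x ∈ (M : Set K) := fun g hg x =>
    Subgroup.mul_mem_cancel_right M hg
  have hbM : ∀ w, b w ∈ groupSubalgebra M := fun w =>
    groupSubalgebra_induction (p := fun b => b ∈ groupSubalgebra M) (zero_mem _)
      (fun _ _ => add_mem)
      (fun c g hg => Subalgebra.smul_mem _ (elt_mem_groupSubalgebra (D.L_le_M hg)) c) (hb w)
  -- Only the term of `w` survives in the restriction to `M` of the translate by `w⁻¹`.
  have h2 := congrArg (fun x => restr (M : Set K) (elt (w : K)⁻¹ * x)) h1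
  simp only [mul_zero, map_zero, Finset.mul_sum, map_sum] at h2
  obtain ⟨c, hc, hcw⟩ := (D.exists_restr_eq w.2 w.2).2 rfl
  rw [Finset.sum_eq_single w] at h2
  · have h3 : idem V₁ * restr (M : Set K) (elt (w : K)⁻¹ * idem U * elt (w : K) * idem U) *
        idem U₁ * (idem V₁ * b w) = 0 := by
      have e : elt (w : K)⁻¹ * (idem U * elt (w : K) * idem U * idem U₁ * idem V₁ * b w)
          = (elt (w : K)⁻¹ * idem U * elt (w : K) * idem U) * (idem U₁ * idem V₁ * b w) := by
        simp only [mul_assoc]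
      rw [e, restr_mul_right (M := M) hM (mul_mem (mul_mem (idem_mem_groupSubalgebra D.U₁_le_M)
        (idem_mem_groupSubalgebra D.V₁_le_M)) (hbM w))] at h2
      calc _ = idem V₁ * (restr (M : Set K) (elt (w : K)⁻¹ * idem U * elt (w : K) * idem U) *
              (idem U₁ * idem V₁ * b w)) := by simp only [mul_assoc]
        _ = 0 := by rw [h2, mul_zero]
    rw [hcw, smul_mul_assoc, smul_eq_zero] at h3
    refine D.eq_zero_of_idem_mul (hb w) (idem_idem_mul_eq_zero ?_)
    rw [← h3.resolve_left hc]
    simp only [mul_assoc]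
  · intro w' _ hne
    have e : elt (w : K)⁻¹ * (idem U * elt (w' : K) * idem U * idem U₁ * idem V₁ * b w')
        = (elt (w : K)⁻¹ * idem U * elt (w' : K) * idem U) * (idem U₁ * idem V₁ * b w') := by
      simp only [mul_assoc]
    rw [e, restr_mul_right (M := M) hM (mul_mem (mul_mem (idem_mem_groupSubalgebra D.U₁_le_M)
        (idem_mem_groupSubalgebra D.V₁_le_M)) (hbM w')),
        (D.exists_restr_eq w.2 w'.2).1 fun h => hne (Subtype.ext h.symm), zero_mul]
  · simp

/-- The elements `e_{U ∩ wVw⁻¹} e_{U ∩ wUw⁻¹} e_{V₁ ∩ wUw⁻¹} e_{I ∩ wVw⁻¹} l w e_U e_{V₁}`, for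
`w ∈ W` and `l ∈ L`, span `e_U e_{V₁} ℂ[G] e_U e_{V₁}`. -/
lemma sandwich_mem_span (x : MonoidAlgebra ℂ K) :
    idem U * idem V₁ * x * (idem U * idem V₁) ∈ Submodule.span ℂ (Set.range fun p : W × L =>
      idem (U ⊓ conjBy (p.1 : K) V) * idem (U ⊓ conjBy (p.1 : K) U) *
        idem (V₁ ⊓ conjBy (p.1 : K) U) * idem (I ⊓ conjBy (p.1 : K) V) * elt (p.2 : K) *
        elt (p.1 : K) * (idem U * idem V₁)) := by
  set P := Submodule.span ℂ (Set.range fun p : W × L =>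
      idem (U ⊓ conjBy (p.1 : K) V) * idem (U ⊓ conjBy (p.1 : K) U) *
        idem (V₁ ⊓ conjBy (p.1 : K) U) * idem (I ⊓ conjBy (p.1 : K) V) * elt (p.2 : K) *
        elt (p.1 : K) * (idem U * idem V₁)) with hP
  obtain ⟨z, hzI, hz⟩ := exists_idem_mul_idem_eq D.U_le_I D.V₁_le_I
  have := Fintype.ofFinite K
  rw [eq_sum_elt x, Finset.mul_sum, Finset.sum_mul]
  refine Submodule.sum_mem _ fun g _ => ?_
  rw [mul_smul_comm, smul_mul_assoc]
  refine P.smul_mem _ ?_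
  obtain ⟨w, hw, hg⟩ := D.bruhat g
  set p := idem (U ⊓ conjBy w V) * idem (U ⊓ conjBy w U) * idem (V₁ ⊓ conjBy w U) with hp
  have hU : idem U = idem (U ⊓ conjBy w V) * idem (U ⊓ conjBy w U) :=
    idem_eq_mul inf_le_left inf_le_left (D.U_factor w hw)
  have hV₁ : idem V₁ = idem (V₁ ⊓ conjBy w U) * idem (V₁ ⊓ conjBy w V) :=
    idem_eq_mul inf_le_left inf_le_left (D.V₁_factor w hw)
  have hA : idem (I ⊓ conjBy w V) = idem (V₁ ⊓ conjBy w V) * idem (U ⊓ conjBy w V) :=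
    idem_eq_mul (inf_le_inf_right _ D.V₁_le_I) (inf_le_inf_right _ D.U_le_I) (D.I_factor w hw)
  have hS : idem U * idem V₁ = p * idem (I ⊓ conjBy w V) * (idem U * z) := by
    calc idem U * idem V₁ = idem U * idem V₁ * (idem (U ⊓ conjBy w V) * idem U) * z := by
          rw [idem_mul_idem_of_le inf_le_left]; exact hz
      _ = (idem (U ⊓ conjBy w V) * idem (U ⊓ conjBy w U)) *
          (idem (V₁ ⊓ conjBy w U) * idem (V₁ ⊓ conjBy w V)) *
          (idem (U ⊓ conjBy w V) * idem U) * z := by rw [← hU, ← hV₁]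
      _ = _ := by rw [hp, hA]; simp only [mul_assoc]
  have key : ∀ y ∈ groupSubalgebra I, p * idem (I ⊓ conjBy w V) * y * elt g *
      (idem U * idem V₁) ∈ P := by
    intro y hy
    refine groupSubalgebra_induction (p := fun y => p * idem (I ⊓ conjBy w V) * y * elt g *
      (idem U * idem V₁) ∈ P) (by simp) (fun a b ha hb => ?_) (fun c i hi => ?_) hy
    · rw [mul_add, add_mul, add_mul]; exact P.add_mem ha hb
    · rw [mul_smul_comm, smul_mul_assoc, smul_mul_assoc]
      obtain ⟨a, ha, l, hl, x, hx, e⟩ := hg i hi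
      refine P.smul_mem _ (Submodule.subset_span ⟨(⟨w, hw⟩, ⟨l, hl⟩), ?_⟩)
      change p * idem (I ⊓ conjBy w V) * elt l * elt w * (idem U * idem V₁) = _
      calc _ = p * (idem (I ⊓ conjBy w V) * elt a) * elt l * elt w *
            ((elt x * idem U) * idem V₁) := by rw [idem_mul_elt ha, elt_mul_idem hx]
        _ = p * idem (I ⊓ conjBy w V) * (elt a * elt l * elt w * elt x) *
            (idem U * idem V₁) := by simp only [mul_assoc]
        _ = _ := by rw [elt_mul_elt, elt_mul_elt, elt_mul_elt, ← e, ← elt_mul_elt]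
                    simp only [mul_assoc]
  have := key _ (mul_mem (idem_mem_groupSubalgebra D.U_le_I) hzI)
  rwa [← hS] at this

/-- The dimension of `e_U e_V ℂ[K] e_U e_V` is at most `|W| |L|`. -/
theorem finrank_sandwich_le :
    Module.finrank ℂ (LinearMap.range (LinearMap.mulLeftRight ℂ
      (idem U * idem V, idem U * idem V))) ≤ Nat.card W * Nat.card L := by
  classical
  have := Fintype.ofFinite W
  have := Fintype.ofFinite L
  set T := idem U * idem V
  set S := idem U * idem V₁ with hS
  have hTS : T = S * idem V := by
    rw [mul_assoc, idem_mul_idem_of_le D.V₁_le]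
  -- `e_U e_V` and `e_U e_V e_U = e_U e_V e_{V₁} e_U` generate the same right ideal
  obtain ⟨p, q, hpq⟩ : ∃ p q, T = p * S * q := by
    obtain ⟨z, -, hz⟩ := exists_idem_mul_idem_eq (H := U) (H' := V) (I := ⊤) le_top le_top
    obtain ⟨z', -, hz'⟩ := exists_idem_mul_idem_eq (H := V₁) (H' := U) (I := ⊤) le_top le_top
    refine ⟨idem U * idem V * idem V₁, z' * z, ?_⟩
    calc T = idem U * (idem V * idem V₁) * idem U * z := by
          rw [idem_mul_idem_of_ge D.V₁_le]; exact hz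
      _ = idem U * idem V * (idem V₁ * idem U) * z := by simp only [mul_assoc]
      _ = _ := by rw [hz']; simp only [mul_assoc, hS]
  set f := fun r : W × L =>
      idem (U ⊓ conjBy (r.1 : K) V) * idem (U ⊓ conjBy (r.1 : K) U) *
        idem (V₁ ⊓ conjBy (r.1 : K) U) * idem (I ⊓ conjBy (r.1 : K) V) * elt (r.2 : K) *
        elt (r.1 : K) * (idem U * idem V₁) with hf
  have hle : LinearMap.range (LinearMap.mulLeftRight ℂ (T, T)) ≤
      Submodule.span ℂ (Set.range fun r => p * f r * idem V) := by
    rintro _ ⟨x, rfl⟩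
    have h1 := D.sandwich_mem_span (q * x)
    have h2 := Submodule.mem_map_of_mem (f := LinearMap.mulLeftRight ℂ (p, idem V)) h1
    rw [Submodule.map_span, ← Set.range_comp] at h2
    have e : T * x * T = p * (S * (q * x) * S) * idem V := by
      calc T * x * T = (p * S * q) * x * (S * idem V) := by rw [← hpq, ← hTS]
        _ = _ := by simp only [mul_assoc]
    rw [LinearMap.mulLeftRight_apply, e]
    exact h2
  calc _ ≤ _ := Submodule.finrank_mono hle
    _ ≤ Fintype.card (W × L) := finrank_range_le_card _
    _ = _ := by rw [Fintype.card_prod, Nat.card_eq_fintype_card, Nat.card_eq_fintype_card]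

end IwahoriDatum

end Datum

/-! ### Unipotent and triangular matrices -/

section Matrices

variable {A : Type u} [CommRing A] {n : ℕ}

/-- The permutation matrix of `σ`, sending the `j`-th basis vector to the `σ j`-th one. -/
def perm (A : Type u) [CommRing A] {n : ℕ} : Equiv.Perm (Fin n) →* G A n :=
  (Matrix.permMatrixHom (n := Fin n) (R := A)).toHomUnits

lemma perm_mul_apply (σ : Equiv.Perm (Fin n)) (g : G A n) (i j : Fin n) :
    (perm A σ * g).val i j = g.val (σ⁻¹ i) j := by
  have e : (perm A σ).val = (σ⁻¹).permMatrix A := rfl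
  rw [Units.val_mul, e, Equiv.Perm.permMatrix, PEquiv.toMatrix_toPEquiv_mul]
  rfl

lemma mul_perm_apply (σ : Equiv.Perm (Fin n)) (g : G A n) (i j : Fin n) :
    (g * perm A σ).val i j = g.val i (σ j) := by
  have e : (perm A σ).val = (σ⁻¹).permMatrix A := rfl
  rw [Units.val_mul, e, Equiv.Perm.permMatrix, PEquiv.mul_toMatrix_toPEquiv]
  rfl

lemma conj_perm_apply (σ : Equiv.Perm (Fin n)) (g : G A n) (i j : Fin n) :
    ((perm A σ)⁻¹ * g * perm A σ).val i j = g.val (σ i) (σ j) := by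
  rw [mul_perm_apply, ← map_inv, perm_mul_apply, inv_inv]

lemma mem_U {g : G A n} : g ∈ U A n ↔ (∀ i, g.val i i = 1) ∧ ∀ i j, j < i → g.val i j = 0 := Iff.rfl

lemma mem_V {g : G A n} : g ∈ V A n ↔ (∀ i, g.val i i = 1) ∧ ∀ i j, i < j → g.val i j = 0 := Iff.rfl

lemma eq_one_of_mem {g : G A n} (h1 : g ∈ U A n) (h2 : g ∈ V A n) : g = 1 := by
  refine Units.ext (Matrix.ext fun i j => ?_)
  rcases lt_trichotomy i j with h | rfl | h
  · rw [h2.2 i j h, Units.val_one, Matrix.one_apply_ne h.ne]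
  · rw [h1.1, Units.val_one, Matrix.one_apply_eq]
  · rw [h1.2 i j h, Units.val_one, Matrix.one_apply_ne h.ne']

lemma eq_one_of_mem_U_of_mem_L {g : G A n} (h1 : g ∈ U A n) (h2 : g ∈ L A n) : g = 1 :=
  eq_one_of_mem h1 (mem_V.2 ⟨h1.1, fun i j h => h2 i j h.ne⟩)

lemma eq_one_of_mem_V_of_mem_L {g : G A n} (h1 : g ∈ V A n) (h2 : g ∈ L A n) : g = 1 :=
  eq_one_of_mem ⟨h1.1, fun i j h => h2 i j h.ne'⟩ h1

lemma eq_one_of_mul_mem_L {x y : G A n} (hx : x ∈ U A n) (hy : y ∈ V A n) (h : x * y ∈ L A n) :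
    x = 1 ∧ y = 1 := by
  have e : x = x * y * y⁻¹ := by group
  have hx1 : x = 1 := by
    refine eq_one_of_mem hx ⟨hx.1, fun i j hij => ?_⟩
    rw [e, diag_mul_apply h, ((V A n).inv_mem hy).2 i j hij, mul_zero]
  refine ⟨hx1, eq_one_of_mem_V_of_mem_L hy ?_⟩
  rwa [hx1, one_mul] at h

lemma exists_mem_unipotent {α : Type} [LinearOrder α] (b : Fin n ≃ α)
    {x : Matrix (Fin n) (Fin n) A} (h1 : ∀ i, x i i = 1) (h2 : ∀ i j, b j < b i → x i j = 0) :
    ∃ g ∈ unipotent A b, g.val = x := by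
  have hdet : x.det = 1 := by
    let : LinearOrder (Fin n) := LinearOrder.lift' b b.injective
    rw [Matrix.det_of_isUpperTriangular (M := x) fun i j h => h2 i j h]
    exact Finset.prod_eq_one fun i _ => h1 i
  exact ⟨Matrix.nonsingInvUnit x (by rw [hdet]; exact isUnit_one), ⟨h1, h2⟩, rfl⟩

lemma exists_mem_L (d : Fin n → Aˣ) : ∃ l ∈ L A n, ∀ i, l.val i i = d i := by
  refine ⟨⟨Matrix.diagonal fun i => (d i : A), Matrix.diagonal fun i => ((d i)⁻¹ : Aˣ), ?_, ?_⟩,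
    fun i j h => Matrix.diagonal_apply_ne _ h, fun i => Matrix.diagonal_apply_eq _ i⟩
  · rw [Matrix.diagonal_mul_diagonal, ← Matrix.diagonal_one]; congr; ext; simp
  · rw [Matrix.diagonal_mul_diagonal, ← Matrix.diagonal_one]; congr; ext; simp

/-- Splitting unipotent matrices according to a set of positions. The map sending `g ∈ H` to the
product of its parts at the positions in `P` and outside `P` is an injective self-map of the finite
set `H`, hence surjective. -/
lemma exists_factorization [Finite A] {α : Type} [LinearOrder α] (b : Fin n ≃ α)
    (P : Fin n → Fin n → Prop) {H H₁ H₂ : Subgroup (G A n)} (hH : H ≤ unipotent A b)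
    (hH₁ : H₁ ≤ H) (hH₂ : H₂ ≤ H) (hd : ∀ x ∈ H₁, x ∈ H₂ → x = 1)
    (h₁ : ∀ g ∈ H, ∀ x : G A n, (∀ i, x.val i i = 1) →
      (∀ i j, i ≠ j → P i j → x.val i j = g.val i j) →
      (∀ i j, i ≠ j → ¬ P i j → x.val i j = 0) → x ∈ H₁)
    (h₂ : ∀ g ∈ H, ∀ x : G A n, (∀ i, x.val i i = 1) →
      (∀ i j, i ≠ j → ¬ P i j → x.val i j = g.val i j) →
      (∀ i j, i ≠ j → P i j → x.val i j = 0) → x ∈ H₂) :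
    ∀ x ∈ H, ∃ a ∈ H₁, ∃ b ∈ H₂, x = a * b := by
  classical
  have key : ∀ (Q : Fin n → Fin n → Prop) (g : H), ∃ x : G A n, (∀ i, x.val i i = 1) ∧
      (∀ i j, i ≠ j → Q i j → x.val i j = g.1.val i j) ∧
      (∀ i j, i ≠ j → ¬ Q i j → x.val i j = 0) := by
    intro Q g
    obtain ⟨x, -, hx⟩ := exists_mem_unipotent (A := A) b
      (x := fun i j => if i = j then 1 else if Q i j then g.1.val i j else 0)
      (fun i => if_pos rfl) (fun i j hij => by
        have hne : i ≠ j := by rintro rfl; exact lt_irrefl _ hij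
        simp only [if_neg hne, (hH g.2).2 i j hij, ite_self])
    refine ⟨x, ?_, ?_, ?_⟩
    · intro i; rw [hx]; simp
    · intro i j hij hQ; rw [hx]; simp [hij, hQ]
    · intro i j hij hQ; rw [hx]; simp [hij, hQ]
  choose p hp using key P
  choose q hq using key fun i j => ¬ P i j
  have hp1 : ∀ g, p g ∈ H₁ := fun g => h₁ g g.2 _ (hp g).1 (hp g).2.1 (hp g).2.2
  have hq2 : ∀ g, q g ∈ H₂ := fun g => h₂ g g.2 _ (hq g).1 (hq g).2.1
    fun i j hij h => (hq g).2.2 i j hij (not_not.2 h)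
  let φ : H → H := fun g => ⟨p g * q g, H.mul_mem (hH₁ (hp1 g)) (hH₂ (hq2 g))⟩
  have hφ : Function.Injective φ := by
    intro g g' h
    have h : p g * q g = p g' * q g' := congrArg Subtype.val h
    have e : (p g')⁻¹ * p g = q g' * (q g)⁻¹ := by
      rw [eq_mul_inv_iff_mul_eq, mul_assoc, h]; group
    have h1 : (p g')⁻¹ * p g = 1 := hd _ (H₁.mul_mem (H₁.inv_mem (hp1 g')) (hp1 g))
      (by rw [e]; exact H₂.mul_mem (hq2 g') (H₂.inv_mem (hq2 g)))
    have h2 : p g = p g' := (inv_mul_eq_one.1 h1).symm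
    have h3 : q g = q g' := by rw [h2] at h; exact mul_left_cancel h
    refine Subtype.ext (Units.ext (Matrix.ext fun i j => ?_))
    by_cases hij : i = j
    · rw [hij, (hH g.2).1, (hH g'.2).1]
    · by_cases hP : P i j
      · rw [← (hp g).2.1 i j hij hP, ← (hp g').2.1 i j hij hP, h2]
      · rw [← (hq g).2.1 i j hij hP, ← (hq g').2.1 i j hij hP, h3]
  intro x hx
  obtain ⟨g, hg⟩ := Finite.surjective_of_injective hφ ⟨x, hx⟩
  exact ⟨p g, hp1 g, q g, hq2 g, (congrArg Subtype.val hg).symm⟩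

lemma mem_conjBy_perm_U {σ : Equiv.Perm (Fin n)} {g : G A n} : g ∈ conjBy (perm A σ) (U A n) ↔
    (∀ i, g.val i i = 1) ∧ ∀ i j, σ⁻¹ j < σ⁻¹ i → g.val i j = 0 := by
  rw [mem_conjBy, mem_U]
  simp only [conj_perm_apply]
  refine and_congr ⟨fun h i => by simpa using h (σ⁻¹ i), fun h i => h _⟩
    ⟨fun h i j hij => by simpa using h (σ⁻¹ i) (σ⁻¹ j) hij, fun h i j hij => h _ _ (by simpa)⟩

lemma mem_conjBy_perm_V {σ : Equiv.Perm (Fin n)} {g : G A n} : g ∈ conjBy (perm A σ) (V A n) ↔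
    (∀ i, g.val i i = 1) ∧ ∀ i j, σ⁻¹ i < σ⁻¹ j → g.val i j = 0 := by
  rw [mem_conjBy, mem_V]
  simp only [conj_perm_apply]
  refine and_congr ⟨fun h i => by simpa using h (σ⁻¹ i), fun h i => h _⟩
    ⟨fun h i j hij => by simpa using h (σ⁻¹ i) (σ⁻¹ j) hij, fun h i j hij => h _ _ (by simpa)⟩

lemma eq_one_of_mem_conjBy {w g : G A n} (h1 : g ∈ conjBy w (U A n)) (h2 : g ∈ conjBy w (V A n)) :
    g = 1 := by
  have := eq_one_of_mem (mem_conjBy.1 h1) (mem_conjBy.1 h2)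
  rw [show g = w * (w⁻¹ * g * w) * w⁻¹ by group, this]; group

/-- The subgroup of invertible upper-triangular matrices. -/
def borel (A : Type u) [CommRing A] (n : ℕ) : Subgroup (G A n) where
  carrier := {g | ∀ i j, j < i → g.val i j = 0}
  one_mem' i j h := Matrix.one_apply_ne h.ne'
  mul_mem' {x y} hx hy i j h := by
    rw [Units.val_mul, Matrix.mul_apply]
    refine Finset.sum_eq_zero fun k _ => ?_
    rcases lt_or_ge k i with hk | hk
    · rw [hx i k hk, zero_mul]
    · rw [hy k j (h.trans_le hk), mul_zero]
  inv_mem' {x} hx := by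
    have hB : Matrix.BlockTriangular (x⁻¹ : G A n).val id := by
      rw [Matrix.coe_units_inv]
      have : Invertible (x : Matrix (Fin n) (Fin n) A) := x.invertible
      exact Matrix.blockTriangular_inv_of_blockTriangular fun i j h => hx i j h
    exact fun i j h => hB h

lemma isUnit_of_mem_borel {g : G A n} (hg : g ∈ borel A n) (i : Fin n) : IsUnit (g.val i i) := by
  have h : (g * g⁻¹).val i i = 1 := by rw [mul_inv_cancel]; simp
  rw [Units.val_mul, Matrix.mul_apply, Finset.sum_eq_single i] at h
  · exact IsUnit.of_mul_eq_one _ h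
  · intro k _ hk
    rcases lt_or_gt_of_ne hk with hk | hk
    · rw [hg i k hk, zero_mul]
    · rw [((borel A n).inv_mem hg) k i hk, mul_zero]
  · simp

end Matrices

/-! ### The Iwahori subgroup over a local ring -/

section Local

variable {A : Type u} [CommRing A] [IsLocalRing A] {n : ℕ}

/-- Reduction modulo the maximal ideal. -/
def red (A : Type u) [CommRing A] [IsLocalRing A] (n : ℕ) :
    G A n →* G (IsLocalRing.ResidueField A) n :=
  Matrix.GeneralLinearGroup.map (IsLocalRing.residue A)

lemma red_apply (g : G A n) (i j : Fin n) :
    (red A n g).val i j = IsLocalRing.residue A (g.val i j) := rfl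

variable (A n) in
/-- The upper-triangular unipotent matrices congruent to `1` modulo the maximal ideal. -/
def congrU : Subgroup (G A n) := U A n ⊓ (red A n).ker

variable (A n) in
/-- The lower-triangular unipotent matrices congruent to `1` modulo the maximal ideal. -/
def congrV : Subgroup (G A n) := V A n ⊓ (red A n).ker

variable (A n) in
/-- The Iwahori subgroup of matrices which are upper-triangular modulo the maximal ideal. -/
def iwahori : Subgroup (G A n) := (borel (IsLocalRing.ResidueField A) n).comap (red A n)

variable (A n) in
/-- The subgroup of matrices which are diagonal modulo the maximal ideal. -/
def diagMod : Subgroup (G A n) := (L (IsLocalRing.ResidueField A) n).comap (red A n)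

lemma mem_ker_red {g : G A n} : g ∈ (red A n).ker ↔
    (∀ i, IsLocalRing.residue A (g.val i i) = 1) ∧
      ∀ i j, i ≠ j → IsLocalRing.residue A (g.val i j) = 0 := by
  rw [MonoidHom.mem_ker]
  refine ⟨fun h => ⟨fun i => ?_, fun i j hij => ?_⟩, fun h => Units.ext (Matrix.ext fun i j => ?_)⟩
  · rw [← red_apply, h]; simp
  · rw [← red_apply, h]; simp [hij]
  · rw [red_apply]
    by_cases hij : i = j
    · rw [hij, h.1]; simp
    · rw [h.2 i j hij]; simp [hij]

lemma red_mem_U {g : G A n} (hg : g ∈ U A n) : red A n g ∈ U (IsLocalRing.ResidueField A) n :=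
  ⟨fun i => by rw [red_apply, hg.1, map_one], fun i j h => by rw [red_apply, hg.2 i j h, map_zero]⟩

lemma red_mem_L {g : G A n} (hg : g ∈ L A n) : red A n g ∈ L (IsLocalRing.ResidueField A) n :=
  fun i j h => by rw [red_apply, hg i j h, map_zero]

lemma red_perm (σ : Equiv.Perm (Fin n)) :
    red A n (perm A σ) = perm (IsLocalRing.ResidueField A) σ := by
  refine Units.ext (Matrix.ext fun i j => ?_)
  rw [red_apply, ← mul_one (perm A σ), perm_mul_apply, ← mul_one (perm _ σ), perm_mul_apply,
    Units.val_one, Units.val_one, Matrix.one_apply, Matrix.one_apply]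
  split_ifs <;> simp

lemma ker_le_iwahori : (red A n).ker ≤ iwahori A n := fun g hg => by
  rw [iwahori, Subgroup.mem_comap, MonoidHom.mem_ker.1 hg]; exact one_mem _

lemma U_le_iwahori : U A n ≤ iwahori A n := fun _ hg => (red_mem_U hg).2

lemma L_le_iwahori : L A n ≤ iwahori A n := fun _ hg i j h => red_mem_L hg i j h.ne'

lemma L_le_diagMod : L A n ≤ diagMod A n := fun _ hg => red_mem_L hg

lemma ker_le_diagMod : (red A n).ker ≤ diagMod A n := fun g hg => by
  rw [diagMod, Subgroup.mem_comap, MonoidHom.mem_ker.1 hg]; exact one_mem _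

lemma diagMod_le_iwahori : diagMod A n ≤ iwahori A n := fun _ hg i j h => hg i j h.ne'

omit [IsLocalRing A] in
lemma conj_perm_inv_mem_L (σ : Equiv.Perm (Fin n)) {l : G A n} (hl : l ∈ L A n) :
    perm A σ * l * (perm A σ)⁻¹ ∈ L A n := by
  have h : (perm A σ)⁻¹ ∈ permSubgroup A n := inv_mem ⟨σ, rfl⟩
  simpa using perm_conj_mem_L h hl

variable [Finite A]

/-- The factorisation `I = V₁ L U` of the Iwahori subgroup. The product of the strictly lower,
diagonal and strictly upper parts of `g` is an injective function of `g` in the finite set `I`, hence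
a surjective one. -/
lemma gauss {g : G A n} (hg : g ∈ iwahori A n) :
    ∃ v ∈ congrV A n, ∃ l ∈ L A n, ∃ x ∈ U A n, g = v * l * x := by
  classical
  have hv : ∀ g : iwahori A n, ∃ v ∈ congrV A n, ∀ i j, j < i → v.val i j = g.1.val i j := by
    intro g
    obtain ⟨v, hv, e⟩ := exists_mem_unipotent (A := A) (OrderDual.toDual : Fin n ≃ (Fin n)ᵒᵈ)
      (x := fun i j => if i = j then 1 else if j < i then g.1.val i j else 0)
      (fun i => if_pos rfl) (fun i j hij => by
        have h : i < j := hij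
        simp only [if_neg h.ne, if_neg h.not_gt])
    refine ⟨v, ⟨hv, mem_ker_red.2 ⟨fun i => ?_, fun i j hij => ?_⟩⟩, fun i j hij => ?_⟩
    · rw [hv.1, map_one]
    · rcases lt_or_gt_of_ne hij with h | h
      · rw [hv.2 i j h, map_zero]
      · rw [e]
        simp only [if_neg hij, if_pos h]
        exact g.2 i j h
    · rw [e]; simp only [if_neg hij.ne', if_pos hij]
  have hl : ∀ g : iwahori A n, ∃ l ∈ L A n, ∀ i, l.val i i = g.1.val i i := by
    intro g
    have h : ∀ i, IsUnit (g.1.val i i) := fun i =>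
      (IsLocalRing.residue_ne_zero_iff_isUnit _).1
        (by rw [← red_apply]; exact (isUnit_of_mem_borel g.2 i).ne_zero)
    exact exists_mem_L fun i => (h i).unit
  have hu : ∀ g : iwahori A n, ∃ x ∈ U A n, ∀ i j, i < j → x.val i j = g.1.val i j := by
    intro g
    obtain ⟨v, hv, e⟩ := exists_mem_unipotent (A := A) (Equiv.refl (Fin n))
      (x := fun i j => if i = j then 1 else if i < j then g.1.val i j else 0)
      (fun i => if_pos rfl) (fun i j hij => by
        have h : j < i := hij
        simp only [if_neg h.ne', if_neg h.not_gt])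
    exact ⟨v, hv, fun i j hij => by rw [e]; simp only [if_neg hij.ne, if_pos hij]⟩
  choose v hv hv' using hv
  choose l hl hl' using hl
  choose x hx hx' using hu
  have hmem : ∀ g, v g * l g * x g ∈ iwahori A n := fun g =>
    mul_mem (mul_mem (ker_le_iwahori (hv g).2) (L_le_iwahori (hl g))) (U_le_iwahori (hx g))
  let φ : iwahori A n → iwahori A n := fun g => ⟨_, hmem g⟩
  have hφ : Function.Injective φ := by
    intro g g' h
    have h : v g * l g * x g = v g' * l g' * x g' := congrArg Subtype.val h
    have hV : (l g)⁻¹ * ((v g)⁻¹ * v g') * (l g)⁻¹⁻¹ ∈ V A n :=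
      conj_mem_unipotent _ ((L A n).inv_mem (hl g)) ((V A n).mul_mem
        ((V A n).inv_mem (hv g).1) (hv g').1)
    have hU : x g' * (x g)⁻¹ ∈ U A n := (U A n).mul_mem (hx g') ((U A n).inv_mem (hx g))
    have e1 : x g' * (x g)⁻¹ = (l g')⁻¹ * (v g')⁻¹ * v g * l g := by
      have : x g' = (l g')⁻¹ * (v g')⁻¹ * (v g * l g * x g) := by rw [h]; group
      rw [this]; group
    have e : x g' * (x g)⁻¹ * ((l g)⁻¹ * ((v g)⁻¹ * v g') * (l g)⁻¹⁻¹) = (l g')⁻¹ * l g := by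
      rw [e1]; group
    obtain ⟨h1, h2⟩ := eq_one_of_mul_mem_L hU hV
      (by rw [e]; exact mul_mem (inv_mem (hl g')) (hl g))
    have e1 : x g' = x g := mul_inv_eq_one.1 h1
    have e2 : v g = v g' := inv_mul_eq_one.1 (by
      have := conj_eq_one_iff.1 h2
      exact this)
    have e3 : l g = l g' := by
      rw [e1, e2] at h; exact mul_left_cancel (mul_right_cancel h)
    refine Subtype.ext (Units.ext (Matrix.ext fun i j => ?_))
    rcases lt_trichotomy i j with h | rfl | h
    · rw [← hx' g i j h, ← hx' g' i j h, e1]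
    · rw [← hl', ← hl', e3]
    · rw [← hv' g i j h, ← hv' g' i j h, e2]
  obtain ⟨g', hg'⟩ := Finite.surjective_of_injective hφ ⟨g, hg⟩
  exact ⟨_, hv g', _, hl g', _, hx g', (congrArg Subtype.val hg').symm⟩

lemma gauss_diagMod {g : G A n} (hg : g ∈ diagMod A n) :
    ∃ v ∈ congrV A n, ∃ l ∈ L A n, ∃ x ∈ congrU A n, g = v * l * x := by
  obtain ⟨v, hv, l, hl, x, hx, rfl⟩ := gauss (diagMod_le_iwahori hg)
  refine ⟨v, hv, l, hl, x, ⟨hx, ?_⟩, rfl⟩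
  refine eq_one_of_mem_U_of_mem_L (red_mem_U hx) ?_
  have h : red A n (v * l * x) ∈ L _ n := hg
  rw [map_mul, map_mul, MonoidHom.mem_ker.1 hv.2, one_mul] at h
  exact (Subgroup.mul_mem_cancel_left _ (red_mem_L hl)).1 h

omit [IsLocalRing A] in
/-- The factorisation `U = (U ∩ wVw⁻¹) (U ∩ wUw⁻¹)`. -/
lemma U_factor (σ : Equiv.Perm (Fin n)) : ∀ x ∈ U A n, ∃ a ∈ U A n ⊓ conjBy (perm A σ) (V A n),
    ∃ b ∈ U A n ⊓ conjBy (perm A σ) (U A n), x = a * b := by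
  refine exists_factorization (Equiv.refl (Fin n)) (fun i j => σ⁻¹ j < σ⁻¹ i) le_rfl inf_le_left
    inf_le_left (fun x h1 h2 => eq_one_of_mem_conjBy h2.2 h1.2) ?_ ?_
  · refine fun g hg x h1 h2 h3 => ⟨⟨h1, fun i j hij => ?_⟩,
      mem_conjBy_perm_V.2 ⟨h1, fun i j hij => h3 i j (by rintro rfl; simp at hij) hij.not_gt⟩⟩
    by_cases h : σ⁻¹ j < σ⁻¹ i
    · rw [h2 i j hij.ne' h]; exact hg.2 i j hij
    · exact h3 i j hij.ne' h
  · refine fun g hg x h1 h2 h3 => ⟨⟨h1, fun i j hij => ?_⟩,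
      mem_conjBy_perm_U.2 ⟨h1, fun i j hij => h3 i j (by rintro rfl; simp at hij) hij⟩⟩
    by_cases h : σ⁻¹ j < σ⁻¹ i
    · exact h3 i j hij.ne' h
    · rw [h2 i j hij.ne' h]; exact hg.2 i j hij

omit [IsLocalRing A] in
/-- The factorisation `V = (V ∩ wVw⁻¹) (V ∩ wUw⁻¹)`. -/
lemma V_factor (σ : Equiv.Perm (Fin n)) : ∀ x ∈ V A n, ∃ a ∈ V A n ⊓ conjBy (perm A σ) (V A n),
    ∃ b ∈ V A n ⊓ conjBy (perm A σ) (U A n), x = a * b := by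
  refine exists_factorization (OrderDual.toDual : Fin n ≃ (Fin n)ᵒᵈ) (fun i j => σ⁻¹ j < σ⁻¹ i)
    le_rfl inf_le_left
    inf_le_left (fun x h1 h2 => eq_one_of_mem_conjBy h2.2 h1.2) ?_ ?_
  · refine fun g hg x h1 h2 h3 => ⟨⟨h1, fun i j hij => ?_⟩,
      mem_conjBy_perm_V.2 ⟨h1, fun i j hij => h3 i j (by rintro rfl; simp at hij) hij.not_gt⟩⟩
    have hne : i ≠ j := by rintro rfl; exact lt_irrefl _ hij
    by_cases h : σ⁻¹ j < σ⁻¹ i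
    · rw [h2 i j hne h]; exact hg.2 i j hij
    · exact h3 i j hne h
  · refine fun g hg x h1 h2 h3 => ⟨⟨h1, fun i j hij => ?_⟩,
      mem_conjBy_perm_U.2 ⟨h1, fun i j hij => h3 i j (by rintro rfl; simp at hij) hij⟩⟩
    have hne : i ≠ j := by rintro rfl; exact lt_irrefl _ hij
    by_cases h : σ⁻¹ j < σ⁻¹ i
    · exact h3 i j hne h
    · rw [h2 i j hne h]; exact hg.2 i j hij

/-- The factorisation `V₁ = (V₁ ∩ wUw⁻¹) (V₁ ∩ wVw⁻¹)`. -/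
lemma congrV_factor (σ : Equiv.Perm (Fin n)) :
    ∀ x ∈ congrV A n, ∃ a ∈ congrV A n ⊓ conjBy (perm A σ) (U A n),
    ∃ b ∈ congrV A n ⊓ conjBy (perm A σ) (V A n), x = a * b := by
  refine exists_factorization (OrderDual.toDual : Fin n ≃ (Fin n)ᵒᵈ) (fun i j => ¬ σ⁻¹ j < σ⁻¹ i)
    inf_le_left inf_le_left
    inf_le_left (fun x h1 h2 => eq_one_of_mem_conjBy h1.2 h2.2) ?_ ?_
  · refine fun g hg x h1 h2 h3 => ⟨⟨⟨h1, fun i j hij => ?_⟩, mem_ker_red.2 ⟨fun i => by simp [h1],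
      fun i j hne => ?_⟩⟩, mem_conjBy_perm_U.2 ⟨h1, fun i j hij =>
        h3 i j (by rintro rfl; simp at hij) (not_not.2 hij)⟩⟩
    · have hne : i ≠ j := by rintro rfl; exact lt_irrefl _ hij
      by_cases h : σ⁻¹ j < σ⁻¹ i
      · exact h3 i j hne (not_not.2 h)
      · rw [h2 i j hne h]; exact hg.1.2 i j hij
    · by_cases h : σ⁻¹ j < σ⁻¹ i
      · rw [h3 i j hne (not_not.2 h), map_zero]
      · rw [h2 i j hne h]; exact (mem_ker_red.1 hg.2).2 i j hne
  · refine fun g hg x h1 h2 h3 => ⟨⟨⟨h1, fun i j hij => ?_⟩, mem_ker_red.2 ⟨fun i => by simp [h1],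
      fun i j hne => ?_⟩⟩, mem_conjBy_perm_V.2 ⟨h1, fun i j hij =>
        h3 i j (by rintro rfl; simp at hij) hij.not_gt⟩⟩
    · have hne : i ≠ j := by rintro rfl; exact lt_irrefl _ hij
      by_cases h : σ⁻¹ j < σ⁻¹ i
      · rw [h2 i j hne (not_not.2 h)]; exact hg.1.2 i j hij
      · exact h3 i j hne h
    · by_cases h : σ⁻¹ j < σ⁻¹ i
      · rw [h2 i j hne (not_not.2 h)]; exact (mem_ker_red.1 hg.2).2 i j hne
      · rw [h3 i j hne h, map_zero]

/-- The factorisation `I ∩ wVw⁻¹ = (V₁ ∩ wVw⁻¹) (U ∩ wVw⁻¹)`. -/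
lemma iwahori_factor (σ : Equiv.Perm (Fin n)) :
    ∀ x ∈ iwahori A n ⊓ conjBy (perm A σ) (V A n),
    ∃ a ∈ congrV A n ⊓ conjBy (perm A σ) (V A n),
    ∃ b ∈ U A n ⊓ conjBy (perm A σ) (V A n), x = a * b := by
  refine exists_factorization (σ⁻¹.trans OrderDual.toDual : Fin n ≃ (Fin n)ᵒᵈ) (fun i j => j < i)
    (fun g hg => mem_conjBy_perm_V.1 hg.2)
    (inf_le_inf_right _ fun g hg => ker_le_iwahori hg.2) (inf_le_inf_right _ U_le_iwahori)
    (fun x h1 h2 => eq_one_of_mem h2.1 h1.1.1) ?_ ?_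
  · intro g hg x h1 h2 h3
    have hV : x ∈ V A n := ⟨h1, fun i j hij => h3 i j (by rintro rfl; exact lt_irrefl _ hij)
      (not_lt_of_gt hij)⟩
    refine ⟨⟨hV, mem_ker_red.2 ⟨fun i => by simp [h1], fun i j hne => ?_⟩⟩,
      mem_conjBy_perm_V.2 ⟨h1, fun i j hij => ?_⟩⟩
    · by_cases h : j < i
      · rw [h2 i j hne h]; exact hg.1 i j h
      · rw [h3 i j hne h, map_zero]
    · have hne : i ≠ j := by rintro rfl; exact lt_irrefl _ hij
      by_cases h : j < i
      · rw [h2 i j hne h]; exact (mem_conjBy_perm_V.1 hg.2).2 i j hij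
      · exact h3 i j hne h
  · intro g hg x h1 h2 h3
    refine ⟨⟨h1, fun i j hij => h3 i j (by rintro rfl; exact lt_irrefl _ hij) hij⟩,
      mem_conjBy_perm_V.2 ⟨h1, fun i j hij => ?_⟩⟩
    have hne : i ≠ j := by rintro rfl; exact lt_irrefl _ hij
    by_cases h : j < i
    · exact h3 i j hne h
    · rw [h2 i j hne h]; exact (mem_conjBy_perm_V.1 hg.2).2 i j hij

/-- The decomposition of the Iwahori subgroup with respect to the order given by a permutation. -/
lemma iwahori_decomposition (σ : Equiv.Perm (Fin n)) {g : G A n} (hg : g ∈ iwahori A n) :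
    ∃ a ∈ iwahori A n ⊓ conjBy (perm A σ) (V A n), ∃ l ∈ L A n,
      ∃ b ∈ conjBy (perm A σ) (U A n), g = a * l * b := by
  obtain ⟨v, hv, l, hl, x, hx, e⟩ := gauss (inv_mem hg)
  obtain ⟨y, hy, z, hz, e'⟩ := U_factor σ x⁻¹ (inv_mem hx)
  set w := perm A σ
  -- `g = y k z l⁻¹` with `k` congruent to `1`
  have hk : w⁻¹ * (z * (l⁻¹ * v⁻¹ * l⁻¹⁻¹) * z⁻¹) * w ∈ (red A n).ker := by
    have h1 := (MonoidHom.normal_ker (red A n)).conj_mem _ (inv_mem hv.2) l⁻¹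
    have h2 := (MonoidHom.normal_ker (red A n)).conj_mem _ h1 z
    simpa using (MonoidHom.normal_ker (red A n)).conj_mem _ h2 w⁻¹
  obtain ⟨v', hv', l', hl', x', hx', e''⟩ := gauss_diagMod (ker_le_diagMod hk)
  refine ⟨y * (w * v' * w⁻¹), mul_mem (S := Subgroup (G A n)) ⟨U_le_iwahori hy.1, hy.2⟩ ⟨?_, ?_⟩,
    (w * l' * w⁻¹) * l⁻¹, mul_mem (conj_perm_inv_mem_L σ hl') (inv_mem hl),
    l * ((w * x' * w⁻¹) * z) * l⁻¹, ?_, ?_⟩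
  · exact ker_le_iwahori ((MonoidHom.normal_ker (red A n)).conj_mem _ hv'.2 w)
  · exact mem_conjBy.2 (by simpa [mul_assoc] using hv'.1)
  · rw [mem_conjBy]
    have h1 : (w⁻¹ * l * w) * (x' * (w⁻¹ * z * w)) * (w⁻¹ * l * w)⁻¹ ∈ U A n :=
      conj_mem_unipotent _ (perm_conj_mem_L ⟨σ, rfl⟩ hl) (mul_mem hx'.1 (mem_conjBy.1 hz.2))
    convert h1 using 1
    group
  · have h1 : g = x⁻¹ * (l⁻¹ * v⁻¹) := by
      rw [← inv_inv g, e]; group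
    have h2 : z * (l⁻¹ * v⁻¹ * l⁻¹⁻¹) * z⁻¹ = w * (v' * l' * x') * w⁻¹ := by rw [← e'']; group
    calc g = y * (z * (l⁻¹ * v⁻¹ * l⁻¹⁻¹) * z⁻¹) * z * l⁻¹ := by rw [h1, e']; group
      _ = _ := by rw [h2]; group

omit [Finite A] in
/-- If a product `w⁻¹ x w' y`, with `x` and `y` upper-triangular unipotent, is diagonal modulo the
maximal ideal, then `w = w'`. -/
lemma eq_of_mem_diagMod {σ τ : Equiv.Perm (Fin n)} {x y : G A n} (hx : x ∈ U A n) (hy : y ∈ U A n)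
    (h : (perm A σ)⁻¹ * x * perm A τ * y ∈ diagMod A n) : σ = τ := by
  set d := red A n ((perm A σ)⁻¹ * x * perm A τ * y) with hd
  have hdL : d ∈ L _ n := h
  have e : red A n x * perm _ τ = perm _ σ * (d * (red A n y)⁻¹) := by
    rw [hd, map_mul, map_mul, map_mul, map_inv, red_perm, red_perm]; group
  have hle : ∀ j, σ j ≤ τ j := by
    intro j
    by_contra! hlt
    -- the entry at `(σ j, j)` vanishes on the left and is a unit on the right
    have h1 := congrArg (fun g : G _ n => g.val (σ j) j) e
    simp only [mul_perm_apply, perm_mul_apply, Equiv.Perm.inv_def, Equiv.symm_apply_apply] at h1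
    rw [(mem_U.1 (red_mem_U hx)).2 _ _ hlt, diag_mul_apply hdL, ((U _ n).inv_mem (red_mem_U hy)).1,
      mul_one] at h1
    exact (isUnit_of_mem_borel (fun i j hij => hdL i j hij.ne') j).ne_zero h1.symm
  have hsum : ∑ j, ((σ j : Fin n) : ℕ) = ∑ j, ((τ j : Fin n) : ℕ) := by
    rw [Equiv.sum_comp σ fun j : Fin n => (j : ℕ), Equiv.sum_comp τ fun j : Fin n => (j : ℕ)]
  ext j
  exact (Finset.sum_eq_sum_iff_of_le (f := fun j => ((σ j : Fin n) : ℕ))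
    (g := fun j => ((τ j : Fin n) : ℕ)) fun j _ => Fin.le_def.1 (hle j)).1 hsum j
    (Finset.mem_univ j)

lemma disjoint_cells {σ τ : Equiv.Perm (Fin n)} {x y : G A n} (hx : x ∈ U A n) (hy : y ∈ U A n)
    (h : (perm A σ)⁻¹ * x * perm A τ * y ∈ diagMod A n) :
    σ = τ ∧ ∃ a ∈ congrV A n, ∃ b ∈ congrU A n, (perm A σ)⁻¹ * x * perm A τ * y = a * b := by
  obtain rfl := eq_of_mem_diagMod hx hy h
  refine ⟨rfl, ?_⟩
  obtain ⟨v, hv, l, hl, z, hz, e⟩ := gauss_diagMod h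
  obtain ⟨p, hp, q, hq, rfl⟩ := U_factor σ x hx
  set w := perm A σ
  -- `w⁻¹ p w` is lower-triangular and `(w⁻¹ q w) y` upper-triangular
  have hp' := mem_conjBy.1 hp.2
  have hq' := mem_conjBy.1 hq.2
  have hu : z * ((w⁻¹ * q * w) * y)⁻¹ ∈ U A n := mul_mem hz.1 (inv_mem (mul_mem hq' hy))
  have e1 : z * ((w⁻¹ * q * w) * y)⁻¹ = (v * l)⁻¹ * (w⁻¹ * p * w) := by
    have : z = (v * l)⁻¹ * (w⁻¹ * (p * q) * w * y) := by rw [e]; group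
    rw [this]; group
  have hv' : (w⁻¹ * p * w)⁻¹ * v ∈ V A n := mul_mem (inv_mem hp') hv.1
  have e2 : z * ((w⁻¹ * q * w) * y)⁻¹ * ((w⁻¹ * p * w)⁻¹ * v) = l⁻¹ := by
    rw [e1]; group
  obtain ⟨h1, -⟩ := eq_one_of_mul_mem_L hu hv' (by rw [e2]; exact inv_mem hl)
  have h2 : z = (w⁻¹ * q * w) * y := mul_inv_eq_one.1 h1
  have h3 : v * l = w⁻¹ * p * w := by
    rw [e1, inv_mul_eq_one] at h1; exact h1
  have h4 : l = 1 := by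
    have : l = v⁻¹ * (w⁻¹ * p * w) := by rw [← h3]; group
    refine eq_one_of_mem_V_of_mem_L ?_ hl
    rw [this]; exact mul_mem (inv_mem hv.1) hp'
  exact ⟨v, hv, z, hz, by rw [e, h4, mul_one]⟩

end Local

/-! ### Bruhat cells over a local ring -/

section Bruhat

variable {A : Type u} [CommRing A] [IsLocalRing A] {n : ℕ}

lemma exists_mem_iwahori {x : Matrix (Fin n) (Fin n) A}
    (h1 : ∀ i, IsLocalRing.residue A (x i i) ≠ 0)
    (h2 : ∀ i j, j < i → IsLocalRing.residue A (x i j) = 0) :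
    ∃ g ∈ iwahori A n, g.val = x := by
  have hdet : IsUnit x.det := by
    rw [← IsLocalRing.residue_ne_zero_iff_isUnit, RingHom.map_det,
      Matrix.det_of_isUpperTriangular (M := (IsLocalRing.residue A).mapMatrix x)
        fun i j h => h2 i j h]
    exact Finset.prod_ne_zero_iff.2 fun i _ => h1 i
  exact ⟨Matrix.nonsingInvUnit x hdet, h2, rfl⟩

omit [IsLocalRing A] in
/-- Column `c₀` of `h` can be cleared at the rows of earlier pivots by a right multiplication by
an element of `U` which does not change the other columns. -/
lemma exists_clear (h : G A n) (c₀ : Fin n) (σ : Fin n → Fin n)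
    (hσ : ∀ c < c₀, ∀ c' < c₀, σ c = σ c' → c = c')
    (hh : ∀ c < c₀, ∀ r, h.val r c = if r = σ c then 1 else 0) :
    ∃ x ∈ U A n, (∀ c, c ≠ c₀ → ∀ r, (h * x).val r c = h.val r c) ∧
      ∀ c < c₀, (h * x).val (σ c) c₀ = 0 := by
  obtain ⟨x, hx, e⟩ := exists_mem_unipotent (A := A) (Equiv.refl (Fin n))
    (x := fun r c => if r = c then 1 else if c = c₀ ∧ r < c₀ then - h.val (σ r) c₀ else 0)
    (fun i => if_pos rfl) (fun i j hij => by
      have hij : j < i := hij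
      rw [if_neg hij.ne', if_neg]
      rintro ⟨rfl, h⟩
      exact lt_asymm h hij)
  have e : ∀ r c, x.val r c = if r = c then 1 else if c = c₀ ∧ r < c₀ then - h.val (σ r) c₀ else 0 :=
    fun r c => congrFun (congrFun e r) c
  refine ⟨x, hx, fun c hc r => ?_, fun c hc => ?_⟩
  · rw [Units.val_mul, Matrix.mul_apply, Finset.sum_eq_single c]
    · simp [e]
    · intro k _ hk
      simp [e, hk, hc]
    · simp
  · rw [Units.val_mul, Matrix.mul_apply, Finset.sum_eq_add c c₀ hc.ne]
    · simp [e, hh c hc, hc.ne, hc]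
    · rintro k - ⟨h1, h2⟩
      by_cases hk : k < c₀
      · rw [hh k hk, if_neg, zero_mul]
        exact fun e => h1 (hσ c hc k hk e).symm
      · simp [e, h2, hk]
    · simp
    · simp

/-- The Bruhat decomposition over a local ring, by eliminating one column at a time: once a column is
cleared at the rows of the earlier pivots, its pivot is its lowest entry which is a unit. -/
lemma exists_pivots (g : G A n) (j : ℕ) (hj : j ≤ n) :
    ∃ a ∈ iwahori A n, ∃ b ∈ iwahori A n, ∃ σ : Fin n → Fin n,
      (∀ c : Fin n, (c : ℕ) < j → ∀ c' : Fin n, (c' : ℕ) < j → σ c = σ c' → c = c') ∧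
      ∀ c : Fin n, (c : ℕ) < j → ∀ r, (a * g * b).val r c = if r = σ c then 1 else 0 := by
  classical
  induction j with
  | zero => exact ⟨1, one_mem _, 1, one_mem _, id, fun c hc => absurd hc (Nat.not_lt_zero _),
      fun c hc => absurd hc (Nat.not_lt_zero _)⟩
  | succ j ih =>
    obtain ⟨a, ha, b, hb, σ, hσ, hh⟩ := ih (Nat.le_of_succ_le hj)
    set c₀ : Fin n := ⟨j, hj⟩ with hc₀
    obtain ⟨x, hx, hx1, hx2⟩ := exists_clear (a * g * b) c₀ σ (fun c hc c' hc' => hσ c hc c' hc')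
      fun c hc => hh c hc
    set h := a * g * b * x with hhdef
    have hex : ∃ r, IsLocalRing.residue A (h.val r c₀) ≠ 0 := by
      by_contra! hcon
      have h1 : (h⁻¹ * h).val c₀ c₀ = 1 := by rw [inv_mul_cancel]; simp
      rw [Units.val_mul, Matrix.mul_apply] at h1
      have h2 := congrArg (IsLocalRing.residue A) h1
      rw [map_sum, map_one, Finset.sum_eq_zero fun r _ => by rw [map_mul, hcon, mul_zero]] at h2
      exact zero_ne_one h2
    obtain ⟨i, hi, hmax⟩ := Finset.exists_max_image
      (Finset.univ.filter fun r => IsLocalRing.residue A (h.val r c₀) ≠ 0) id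
      ⟨hex.choose, by simpa using hex.choose_spec⟩
    have hi : IsLocalRing.residue A (h.val i c₀) ≠ 0 := (Finset.mem_filter.1 hi).2
    have hmax : ∀ r, i < r → IsLocalRing.residue A (h.val r c₀) = 0 := fun r hr => by
      by_contra hne
      exact absurd (hmax r (Finset.mem_filter.2 ⟨Finset.mem_univ _, hne⟩)) (not_le.2 hr)
    have hiσ : ∀ c : Fin n, c < c₀ → σ c ≠ i := by
      rintro c hc rfl
      exact hi (by rw [hx2 c hc, map_zero])
    obtain ⟨d, hd, ed⟩ := exists_mem_iwahori (A := A)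
      (x := fun r c => if c = i then h.val r c₀ else if r = c then 1 else 0)
      (fun r => by
        by_cases hr : r = i
        · simpa [hr] using hi
        · simp [hr])
      (fun r c hrc => by
        by_cases hc : c = i
        · simpa [hc] using hmax r (hc ▸ hrc)
        · simp [hc, hrc.ne'])
    -- `d` is the identity matrix with column `i` replaced by the new column of `h`
    refine ⟨d⁻¹ * a, mul_mem (inv_mem hd) ha, b * x, mul_mem hb (U_le_iwahori hx),
      Function.update σ c₀ i, ?_, ?_⟩
    · have hlt : ∀ c : Fin n, (c : ℕ) < j + 1 → c ≠ c₀ → c < c₀ := fun c hc hne =>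
        lt_of_le_of_ne (Fin.le_def.2 (Nat.lt_succ_iff.1 hc)) hne
      intro c hc c' hc' e
      by_cases h1 : c = c₀ <;> by_cases h2 : c' = c₀
      · rw [h1, h2]
      · rw [h1, Function.update_self, Function.update_of_ne h2] at e
        exact absurd e.symm (hiσ c' (hlt c' hc' h2))
      · rw [h2, Function.update_self, Function.update_of_ne h1] at e
        exact absurd e (hiσ c (hlt c hc h1))
      · rw [Function.update_of_ne h1, Function.update_of_ne h2] at e
        exact hσ c (hlt c hc h1) c' (hlt c' hc' h2) e
    · intro c hc r
      have e : d⁻¹ * a * g * (b * x) = d⁻¹ * h := by rw [hhdef]; group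
      -- the column `c` of `h` is the column of `d` at the new pivot
      have hcol : ∀ k, h.val k c = d.val k (Function.update σ c₀ i c) := by
        intro k
        rw [ed]
        by_cases h1 : c = c₀
        · simp [h1]
        · have hlt : c < c₀ := lt_of_le_of_ne (Fin.le_def.2 (Nat.lt_succ_iff.1 hc)) h1
          rw [Function.update_of_ne h1, hx1 c h1, hh c hlt]
          simp [hiσ c hlt]
      rw [e, Units.val_mul, Matrix.mul_apply, Finset.sum_congr rfl fun k _ => by rw [hcol k],
        ← Matrix.mul_apply, Units.inv_mul, Matrix.one_apply]

lemma exists_bruhat (g : G A n) : ∃ a ∈ iwahori A n, ∃ σ, ∃ b ∈ iwahori A n,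
    g = a * perm A σ * b := by
  obtain ⟨a, ha, b, hb, f, hf, h⟩ := exists_pivots g n le_rfl
  have hinj : Function.Injective f := fun c c' e => hf c c.2 c' c'.2 e
  let σ := Equiv.ofBijective f (Finite.injective_iff_bijective.1 hinj)
  refine ⟨a⁻¹, inv_mem ha, σ, b⁻¹, inv_mem hb, ?_⟩
  have e : a * g * b = perm A σ := by
    refine Units.ext (Matrix.ext fun r c => ?_)
    rw [h c c.2, ← one_mul (perm A σ), mul_perm_apply, Units.val_one, Matrix.one_apply]
    rfl
  rw [← e]; group

/-- All the translates `i g`, for `i ∈ I`, lie in the refined cell of one and the same `w`. -/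
lemma exists_cell [Finite A] (g : G A n) : ∃ w ∈ permSubgroup A n, ∀ i ∈ iwahori A n,
    ∃ a ∈ iwahori A n ⊓ conjBy w (V A n), ∃ l ∈ L A n, ∃ x ∈ U A n, i * g = a * l * w * x := by
  obtain ⟨i₁, hi₁, σ, i₂, hi₂, rfl⟩ := exists_bruhat g
  refine ⟨perm A σ, ⟨σ, rfl⟩, fun i hi => ?_⟩
  set w := perm A σ
  obtain ⟨a, ha, l, hl, b, hb, e⟩ := iwahori_decomposition σ (mul_mem hi hi₁)
  obtain ⟨v, hv, l', hl', x, hx, e'⟩ := gauss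
    (mul_mem (U_le_iwahori (mem_conjBy.1 hb)) hi₂)
  have hlw : w⁻¹ * l * w ∈ L A n := perm_conj_mem_L ⟨σ, rfl⟩ hl
  refine ⟨a * (l * (w * v * w⁻¹) * l⁻¹), mul_mem ha ⟨ker_le_iwahori ?_, mem_conjBy.2 ?_⟩,
    l * (w * l' * w⁻¹), mul_mem hl (conj_perm_inv_mem_L σ hl'), x, hx, ?_⟩
  · exact (MonoidHom.normal_ker (red A n)).conj_mem _
      ((MonoidHom.normal_ker (red A n)).conj_mem _ hv.2 w) l
  · have : _ ∈ V A n := conj_mem_unipotent _ hlw hv.1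
    convert this using 1
    group
  · calc i * (i₁ * w * i₂) = (i * i₁) * w * i₂ := by group
      _ = a * l * w * (w⁻¹ * b * w * i₂) := by rw [e]; group
      _ = _ := by rw [e']; group

theorem iwahoriDatum_of_isLocalRing (A : Type u) [CommRing A] [IsLocalRing A] [Finite A] (n : ℕ) :
    IwahoriDatum (U A n) (V A n) (L A n) (permSubgroup A n) (congrU A n) (congrV A n)
      (iwahori A n) (diagMod A n) where
  U₁_le := inf_le_left
  V₁_le := inf_le_left
  U_le_I := U_le_iwahori
  V₁_le_I := inf_le_right.trans ker_le_iwahori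
  U₁_le_M := inf_le_right.trans ker_le_diagMod
  V₁_le_M := inf_le_right.trans ker_le_diagMod
  L_le_M := L_le_diagMod
  conj_U _ hl _ hg := conj_mem_unipotent _ hl hg
  conj_V _ hl _ hg := conj_mem_unipotent _ hl hg
  conj_V₁ l hl g hg := ⟨conj_mem_unipotent _ hl hg.1,
    (MonoidHom.normal_ker (red A n)).conj_mem _ hg.2 l⟩
  U_factor := by rintro _ ⟨σ, rfl⟩; exact U_factor σ
  V_factor := by rintro _ ⟨σ, rfl⟩; exact V_factor σ
  V₁_factor := by rintro _ ⟨σ, rfl⟩; exact congrV_factor σ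
  I_factor := by rintro _ ⟨σ, rfl⟩; exact iwahori_factor σ
  bruhat := exists_cell
  disjoint_cells := by
    rintro _ ⟨σ, rfl⟩ _ ⟨τ, rfl⟩ x hx y hy h
    obtain ⟨rfl, h'⟩ := disjoint_cells hx hy h
    exact ⟨rfl, h'⟩
  big_cell _ hx _ hy h := eq_one_of_mul_mem_L hx hy h

end Bruhat

/-! ### The rank one computation -/

section RankOne

variable {K : Type u} [Group K] [Finite K]

lemma sum_elt_eq_smul_idem {ι : Type*} [Fintype ι] {H : Subgroup K} {f : ι → K}
    (hf : Function.Injective f) (hH : ∀ g, g ∈ H ↔ ∃ x, g = f x) :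
    ∑ x, elt (f x) = (Nat.card H : ℂ) • idem H := by
  have := Fintype.ofFinite K
  have := Fintype.ofFinite H
  rw [idem_eq, smul_smul, mul_inv_cancel₀ (card_ne_zero H), one_smul]
  let e : ι → H := fun x => ⟨f x, (hH _).2 ⟨x, rfl⟩⟩
  have he : Function.Bijective e := ⟨fun x y h => hf (congrArg Subtype.val h), fun g => by
    obtain ⟨x, hx⟩ := (hH _).1 g.2
    exact ⟨x, Subtype.ext hx.symm⟩⟩
  exact Fintype.sum_bijective e he _ _ fun x => rfl

/-- The rank one computation. Let `Y = {f x}` be parametrised by a local ring, with `Y₁`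
corresponding to the maximal ideal. If `f x ∈ X m X` for an element `m` conjugating `X` to `Y`
whenever `x` is a unit, then `e_X (f x) e_X = e_X e_Y m` for these `x`, and so
`e_X e_{Y₁} e_X` lies in `e_X e_Y ℂ[K]`. -/
lemma mul_idem_mul_idem_eq_zero_of_rank_one {A : Type*} [CommRing A] [IsLocalRing A] [Finite A]
    {X Y Y₁ : Subgroup K} {f : A → K} (hf : Function.Injective f)
    (hY : ∀ g, g ∈ Y ↔ ∃ x, g = f x)
    (hY₁ : ∀ g, g ∈ Y₁ ↔ ∃ x ∈ IsLocalRing.maximalIdeal A, g = f x)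
    (hm : ∀ x, IsUnit x → ∃ m, ∃ a ∈ X, ∃ b ∈ X, f x = a * m * b ∧
      elt m * idem X = idem Y * elt m)
    {c : MonoidAlgebra ℂ K} (h : c * (idem X * idem Y) = 0) : c * (idem X * idem Y₁) = 0 := by
  classical
  have := Fintype.ofFinite A
  have hunit : ∀ x, IsUnit x → c * idem X * elt (f x) * idem X = 0 := by
    intro x hx
    obtain ⟨m, a, ha, b, hb, e, hmX⟩ := hm x hx
    rw [e, ← elt_mul_elt, ← elt_mul_elt]
    calc c * idem X * (elt a * elt m * elt b) * idem X
        = c * (idem X * elt a) * elt m * (elt b * idem X) := by simp only [mul_assoc]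
      _ = c * idem X * (elt m * idem X) := by
          rw [idem_mul_elt ha, elt_mul_idem hb, mul_assoc]
      _ = c * (idem X * idem Y) * elt m := by rw [hmX]; simp only [mul_assoc]
      _ = 0 := by rw [h, zero_mul]
  have hall : c * idem X * (∑ x, elt (f x)) * idem X = 0 := by
    rw [sum_elt_eq_smul_idem hf hY, mul_smul_comm, smul_mul_assoc, mul_assoc c, h, zero_mul,
      smul_zero]
  have hnon : c * idem X * (∑ x : {x // x ∈ IsLocalRing.maximalIdeal A}, elt (f x)) * idem X
      = 0 := by
    rw [← hall, ← Fintype.sum_subtype_add_sum_subtype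
      (fun x : A => x ∈ IsLocalRing.maximalIdeal A) (fun x => elt (f x)), mul_add, add_mul,
      left_eq_add, Finset.mul_sum, Finset.sum_mul]
    exact Finset.sum_eq_zero fun x _ => hunit x (by
      by_contra hx
      exact x.2 ((IsLocalRing.mem_maximalIdeal _).2 hx))
  rw [sum_elt_eq_smul_idem (H := Y₁) (fun x y hxy => Subtype.ext (hf hxy))
    (fun g => by rw [hY₁]; exact ⟨fun ⟨x, hx, e⟩ => ⟨⟨x, hx⟩, e⟩, fun ⟨x, e⟩ => ⟨x, x.2, e⟩⟩),
    mul_smul_comm, smul_mul_assoc, smul_eq_zero] at hnon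
  refine mul_idem_idem_eq_zero ?_
  rw [← hnon.resolve_left (card_ne_zero Y₁)]
  simp only [mul_assoc]

omit [Finite K] in
lemma mem_inf_conjBy_iff {s : K} (hs : s * s = 1) {H H' : Subgroup K} (x : K) :
    x ∈ H ⊓ conjBy s H' ↔ s * x * s⁻¹ ∈ H' ⊓ conjBy s H := by
  have e : s⁻¹ = s := inv_eq_of_mul_eq_one_left hs
  rw [Subgroup.mem_inf, Subgroup.mem_inf, mem_conjBy, mem_conjBy, and_comm]
  have : s⁻¹ * (s * x * s⁻¹) * s = x := by group
  rw [this, e]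

lemma elt_mul_idem_inf {s : K} (hs : s * s = 1) (H H' : Subgroup K) :
    elt s * idem (H ⊓ conjBy s H') = idem (H' ⊓ conjBy s H) * elt s :=
  elt_mul_idem_eq (mem_inf_conjBy_iff hs)

end RankOne

/-! ### Root subgroups of neighbouring indices -/

section RootSubgroups

/-- The relation by which a Weyl element of `SL₂` conjugates one root subgroup to the other, written
with two matrix units `e`, `f` in an algebra. -/
lemma weyl_element_mul {A S : Type*} [CommRing A] [Ring S] [Algebra A S] {e f : S} (hee : e * e = 0)
    (hff : f * f = 0) (hefe : e * (f * e) = e) (hfef : f * (e * f) = f) {a x : A} (hax : a * x = -1)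
    (y : A) :
    (1 + a • e) * (1 + x • f) * (1 + a • e) * (1 + y • e) =
      (1 + (-(x * x * y)) • f) * ((1 + a • e) * (1 + x • f) * (1 + a • e)) := by
  have hm : (1 + a • e) * (1 + x • f) * (1 + a • e) = 1 + a • e + x • f - e * f - f * e := by
    simp only [add_mul, mul_add, one_mul, mul_one, smul_mul_assoc, mul_smul_comm, mul_assoc, hee,
      hefe, smul_zero]
    linear_combination (norm := module) hax • (a • e) + hax • (e * f) + hax • (f * e)
  rw [hm]
  simp only [add_mul, mul_add, sub_mul, mul_sub, one_mul, mul_one, smul_mul_assoc, mul_smul_comm,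
    mul_assoc, hee, hff, hefe, hfef, smul_zero, mul_zero, ← mul_assoc f f e, zero_mul]
  linear_combination (norm := module) (x * y) • hax • (f * e)

variable {A : Type u} [CommRing A] {n : ℕ}

/-- The elementary matrix with entry `x` at the position `(i, j)`. -/
def elem {i j : Fin n} (h : i ≠ j) (x : A) : G A n where
  val := Matrix.transvection i j x
  inv := Matrix.transvection i j (-x)
  val_inv := by rw [Matrix.transvection_mul_transvection_same _ _ h, add_neg_cancel,
    Matrix.transvection_zero]
  inv_val := by rw [Matrix.transvection_mul_transvection_same _ _ h, neg_add_cancel,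
    Matrix.transvection_zero]

lemma elem_apply {i j : Fin n} (h : i ≠ j) (x : A) (k l : Fin n) :
    (elem h x).val k l = (if k = l then 1 else 0) + if i = k ∧ j = l then x else 0 := by
  change Matrix.transvection i j x k l = _
  rw [Matrix.transvection, Matrix.add_apply, Matrix.one_apply, Matrix.single_apply]

lemma elem_mul_elem {i j : Fin n} (h : i ≠ j) (x y : A) :
    elem h x * elem h y = elem h (x + y) :=
  Units.ext (Matrix.transvection_mul_transvection_same _ _ h x y)

lemma elem_injective {i j : Fin n} (h : i ≠ j) : Function.Injective (elem (A := A) h) := by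
  intro x y e
  have := congrArg (fun g : G A n => g.val i j) e
  simpa [elem_apply, h] using this

lemma weyl_mul_elem {i j : Fin n} (h : i ≠ j) {a x : A} (hax : a * x = -1) (y : A) :
    elem h a * elem h.symm x * elem h a * elem h y =
      elem h.symm (-(x * x * y)) * (elem h a * elem h.symm x * elem h a) := by
  have e1 : ∀ {i j : Fin n} (h : i ≠ j) (x : A),
      (elem h x).val = 1 + x • Matrix.single i j (1 : A) := fun h x => by
    change Matrix.transvection _ _ x = _
    rw [Matrix.transvection, Matrix.smul_single, smul_eq_mul, mul_one]
  refine Units.ext ?_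
  simp only [Units.val_mul, e1]
  exact weyl_element_mul (by simp [h.symm]) (by simp [h]) (by simp) (by simp) hax y

/-- For neighbouring `i, j`, the only pair whose order is reversed by the transposition of `i` and
`j` is `(i, j)`. -/
lemma eq_of_swap_le {i j : Fin n} (hij : (i : ℕ) + 1 = j) {k l : Fin n} (h : k < l)
    (h' : Equiv.swap i j l ≤ Equiv.swap i j k) : k = i ∧ l = j := by
  rw [Equiv.swap_apply_def, Equiv.swap_apply_def] at h'
  split_ifs at h' <;> simp only [Fin.ext_iff, Fin.lt_def, Fin.le_def] at * <;> omega

lemma swap_lt_swap {i j : Fin n} (hij : (i : ℕ) + 1 = j) : Equiv.swap i j j < Equiv.swap i j i := by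
  rw [Equiv.swap_apply_left, Equiv.swap_apply_right, Fin.lt_def]; omega

variable {i j : Fin n} (hij : (i : ℕ) + 1 = j) (hne : i ≠ j)
include hij

/-- For neighbouring `i < j`, the group `U ∩ sVs⁻¹`, with `s` the transposition of `i` and `j`, is the
root subgroup of `(i, j)`. -/
lemma mem_root_iff (g : G A n) : g ∈ U A n ⊓ conjBy (perm A (Equiv.swap i j)) (V A n) ↔
    ∃ x, g = elem hne x := by
  have hlt : i < j := Fin.lt_def.2 (by omega)
  rw [Subgroup.mem_inf, mem_conjBy_perm_V, mem_U, Equiv.swap_inv]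
  constructor
  · rintro ⟨h1, h2⟩
    refine ⟨g.val i j, Units.ext (Matrix.ext fun k l => ?_)⟩
    rw [elem_apply]
    rcases lt_trichotomy k l with h | rfl | h
    · rw [if_neg h.ne, zero_add]
      by_cases h' : Equiv.swap i j k < Equiv.swap i j l
      · rw [h2.2 k l h', if_neg]
        rintro ⟨rfl, rfl⟩
        exact lt_asymm h' (swap_lt_swap hij)
      · obtain ⟨rfl, rfl⟩ := eq_of_swap_le hij h (not_lt.1 h')
        simp
    · rw [h1.1, if_pos rfl, if_neg, add_zero]
      rintro ⟨h, h'⟩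
      exact hne (h.trans h'.symm)
    · rw [h1.2 k l h, if_neg h.ne', if_neg, add_zero]
      rintro ⟨rfl, rfl⟩
      exact lt_asymm h hlt
  · rintro ⟨x, rfl⟩
    have hd : ∀ k, (elem hne x).val k k = 1 := fun k => by
      rw [elem_apply, if_pos rfl, if_neg, add_zero]
      rintro ⟨h, h'⟩
      exact hne (h.trans h'.symm)
    refine ⟨⟨hd, fun k l h => ?_⟩, hd, fun k l h => ?_⟩
    · rw [elem_apply, if_neg h.ne', if_neg, add_zero]
      rintro ⟨rfl, rfl⟩
      exact lt_asymm h hlt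
    · rw [elem_apply, if_neg (by rintro rfl; exact lt_irrefl _ h), if_neg, add_zero]
      rintro ⟨rfl, rfl⟩
      exact lt_asymm h (swap_lt_swap hij)

lemma mem_neg_root_iff (g : G A n) : g ∈ V A n ⊓ conjBy (perm A (Equiv.swap i j)) (U A n) ↔
    ∃ x, g = elem hne.symm x := by
  have hlt : i < j := Fin.lt_def.2 (by omega)
  rw [Subgroup.mem_inf, mem_conjBy_perm_U, mem_V, Equiv.swap_inv]
  constructor
  · rintro ⟨h1, h2⟩
    refine ⟨g.val j i, Units.ext (Matrix.ext fun k l => ?_)⟩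
    rw [elem_apply]
    rcases lt_trichotomy l k with h | rfl | h
    · rw [if_neg h.ne', zero_add]
      by_cases h' : Equiv.swap i j l < Equiv.swap i j k
      · rw [h2.2 k l h', if_neg]
        rintro ⟨rfl, rfl⟩
        exact lt_asymm h' (swap_lt_swap hij)
      · obtain ⟨rfl, rfl⟩ := eq_of_swap_le hij h (not_lt.1 h')
        simp
    · rw [h1.1, if_pos rfl, if_neg, add_zero]
      rintro ⟨h, h'⟩
      exact hne (h'.trans h.symm)
    · rw [h1.2 k l h, if_neg h.ne, if_neg, add_zero]
      rintro ⟨rfl, rfl⟩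
      exact lt_asymm h hlt
  · rintro ⟨x, rfl⟩
    have hd : ∀ k, (elem hne.symm x).val k k = 1 := fun k => by
      rw [elem_apply, if_pos rfl, if_neg, add_zero]
      rintro ⟨h, h'⟩
      exact hne (h'.trans h.symm)
    refine ⟨⟨hd, fun k l h => ?_⟩, hd, fun k l h => ?_⟩
    · rw [elem_apply, if_neg h.ne, if_neg, add_zero]
      rintro ⟨rfl, rfl⟩
      exact lt_asymm h hlt
    · rw [elem_apply, if_neg (by rintro rfl; exact lt_irrefl _ h), if_neg, add_zero]
      rintro ⟨rfl, rfl⟩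
      exact lt_asymm h (swap_lt_swap hij)

omit hij in
lemma perm_swap_mul_self (i j : Fin n) :
    perm A (Equiv.swap i j) * perm A (Equiv.swap i j) = 1 := by
  rw [← map_mul, Equiv.swap_mul_self, map_one]

lemma mem_U_inf_iff (g : G A n) : g ∈ U A n ⊓ conjBy (perm A (Equiv.swap i j)) (U A n) ↔
    g ∈ U A n ∧ g.val i j = 0 := by
  rw [Subgroup.mem_inf, mem_conjBy_perm_U, Equiv.swap_inv]
  refine and_congr_right fun hg => ⟨fun h => h.2 i j (swap_lt_swap hij), fun h => ⟨hg.1, ?_⟩⟩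
  intro k l hkl
  rcases lt_trichotomy k l with h1 | rfl | h1
  · obtain ⟨rfl, rfl⟩ := eq_of_swap_le hij h1 hkl.le
    exact h
  · exact absurd hkl (lt_irrefl _)
  · exact hg.2 k l h1

lemma mem_V_inf_iff (g : G A n) : g ∈ V A n ⊓ conjBy (perm A (Equiv.swap i j)) (V A n) ↔
    g ∈ V A n ∧ g.val j i = 0 := by
  rw [Subgroup.mem_inf, mem_conjBy_perm_V, Equiv.swap_inv]
  refine and_congr_right fun hg => ⟨fun h => h.2 j i (swap_lt_swap hij), fun h => ⟨hg.1, ?_⟩⟩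
  intro k l hkl
  rcases lt_trichotomy l k with h1 | rfl | h1
  · obtain ⟨rfl, rfl⟩ := eq_of_swap_le hij h1 hkl.le
    exact h
  · exact absurd hkl (lt_irrefl _)
  · exact hg.2 k l h1

lemma U_mul_apply {g h : G A n} (hg : g ∈ U A n) (hh : h ∈ U A n) :
    (g * h).val i j = g.val i j + h.val i j := by
  have hlt : i < j := Fin.lt_def.2 (by omega)
  rw [Units.val_mul, Matrix.mul_apply, Finset.sum_eq_add i j hlt.ne, hg.1, hh.1, one_mul, mul_one,
    add_comm]
  · rintro k - ⟨h1, h2⟩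
    rcases lt_or_gt_of_ne h1 with h | h
    · rw [hg.2 i k h, zero_mul]
    · rw [hh.2 k j (show j < k by simp only [Fin.lt_def] at *; omega), mul_zero]
  · simp
  · simp

lemma V_mul_apply {g h : G A n} (hg : g ∈ V A n) (hh : h ∈ V A n) :
    (g * h).val j i = g.val j i + h.val j i := by
  have hlt : i < j := Fin.lt_def.2 (by omega)
  rw [Units.val_mul, Matrix.mul_apply, Finset.sum_eq_add i j hlt.ne, hg.1, hh.1, one_mul, mul_one]
  · rintro k - ⟨h1, h2⟩
    rcases lt_or_gt_of_ne h2 with h | h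
    · rw [hh.2 k i (show k < i by simp only [Fin.lt_def] at *; omega), mul_zero]
    · rw [hg.2 j k h, zero_mul]
  · simp
  · simp

lemma conj_mem_U_inf {g h : G A n} (hg : g ∈ U A n)
    (hh : h ∈ U A n ⊓ conjBy (perm A (Equiv.swap i j)) (U A n)) :
    g * h * g⁻¹ ∈ U A n ⊓ conjBy (perm A (Equiv.swap i j)) (U A n) := by
  rw [mem_U_inf_iff hij] at hh ⊢
  refine ⟨mul_mem (mul_mem hg hh.1) (inv_mem hg), ?_⟩
  have h1 : (g * g⁻¹).val i j = 0 := by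
    rw [mul_inv_cancel, Units.val_one, Matrix.one_apply_ne]; rintro rfl; omega
  rw [U_mul_apply hij hg (inv_mem hg)] at h1
  rw [U_mul_apply hij (mul_mem hg hh.1) (inv_mem hg), U_mul_apply hij hg hh.1, hh.2, add_zero, h1]

lemma conj_mem_V_inf {g h : G A n} (hg : g ∈ V A n)
    (hh : h ∈ V A n ⊓ conjBy (perm A (Equiv.swap i j)) (V A n)) :
    g * h * g⁻¹ ∈ V A n ⊓ conjBy (perm A (Equiv.swap i j)) (V A n) := by
  rw [mem_V_inf_iff hij] at hh ⊢
  refine ⟨mul_mem (mul_mem hg hh.1) (inv_mem hg), ?_⟩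
  have h1 : (g * g⁻¹).val j i = 0 := by
    rw [mul_inv_cancel, Units.val_one, Matrix.one_apply_ne]; rintro rfl; omega
  rw [V_mul_apply hij hg (inv_mem hg)] at h1
  rw [V_mul_apply hij (mul_mem hg hh.1) (inv_mem hg), V_mul_apply hij hg hh.1, hh.2, add_zero, h1]

omit hij in
/-- Normalising `H ∩ sHs⁻¹` is invariant under conjugation by the involution `s`. -/
lemma conj_mem_of_swap {s : G A n} (hs : s * s = 1) {H X : Subgroup (G A n)}
    (h : ∀ g ∈ X, ∀ x ∈ H ⊓ conjBy s H, g * x * g⁻¹ ∈ H ⊓ conjBy s H) {g : G A n}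
    (hg : s * g * s⁻¹ ∈ X) : ∀ x ∈ H ⊓ conjBy s H, g * x * g⁻¹ ∈ H ⊓ conjBy s H := by
  intro x hx
  rw [mem_inf_conjBy_iff hs] at hx ⊢
  convert h _ hg _ hx using 1
  group

end RootSubgroups

/-! ### A chain of Borel subgroups -/

section Chain

variable {A : Type u} [CommRing A] [IsLocalRing A] {n : ℕ}

lemma elem_mem_ker_iff {i j : Fin n} (h : i ≠ j) (x : A) :
    elem h x ∈ (red A n).ker ↔ x ∈ IsLocalRing.maximalIdeal A := by
  rw [← IsLocalRing.residue_eq_zero_iff, mem_ker_red]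
  constructor
  · intro h'
    have := h'.2 i j h
    simpa [elem_apply, h] using this
  · intro hx
    refine ⟨fun k => ?_, fun k l hkl => ?_⟩
    · rw [elem_apply, if_pos rfl, if_neg, add_zero, map_one]
      rintro ⟨h1, h2⟩
      exact h (h1.trans h2.symm)
    · rw [elem_apply, if_neg hkl, zero_add]
      split_ifs
      · exact hx
      · exact map_zero _

lemma mem_congrV_root_iff {i j : Fin n} (hij : (i : ℕ) + 1 = j) (hne : i ≠ j) (g : G A n) :
    g ∈ congrV A n ⊓ conjBy (perm A (Equiv.swap i j)) (U A n) ↔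
      ∃ x ∈ IsLocalRing.maximalIdeal A, g = elem hne.symm x := by
  have h := mem_neg_root_iff hij hne g
  constructor
  · rintro ⟨h1, h2⟩
    obtain ⟨x, rfl⟩ := h.1 ⟨h1.1, h2⟩
    exact ⟨x, (elem_mem_ker_iff _ x).1 h1.2, rfl⟩
  · rintro ⟨x, hx, rfl⟩
    obtain ⟨h1, h2⟩ := h.2 ⟨x, rfl⟩
    exact ⟨⟨h1, (elem_mem_ker_iff _ x).2 hx⟩, h2⟩

lemma mem_congrV_inf_iff {s : G A n} (g : G A n) :
    g ∈ congrV A n ⊓ conjBy s (V A n) ↔ g ∈ V A n ⊓ conjBy s (V A n) ∧ g ∈ (red A n).ker :=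
  ⟨fun h => ⟨⟨h.1.1, h.2⟩, h.1.2⟩, fun h => ⟨⟨h.1.1, h.2⟩, h.1.2⟩⟩

lemma inf_conjBy_congrV (s : G A n) :
    V A n ⊓ conjBy s (congrV A n) = congrV A n ⊓ conjBy s (V A n) := by
  ext g
  rw [mem_congrV_inf_iff]
  constructor
  · rintro ⟨h1, h2⟩
    have h2 := mem_conjBy.1 h2
    refine ⟨⟨h1, mem_conjBy.2 h2.1⟩, ?_⟩
    have := (MonoidHom.normal_ker (red A n)).conj_mem _ h2.2 s
    convert this using 1
    group
  · rintro ⟨h1, h2⟩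
    have h3 := (MonoidHom.normal_ker (red A n)).conj_mem _ h2 s⁻¹
    exact ⟨h1.1, mem_conjBy.2 ⟨mem_conjBy.1 h1.2, by simpa using h3⟩⟩

variable [Finite A] {i j : Fin n} (hij : (i : ℕ) + 1 = j)
include hij

/-- The step from a Borel subgroup to a neighbouring one. Write `U = X N` and `V₁ = Y₁ N₁`, where
`N` and `N₁` are stable under the simple reflection `s`, and `Y = sXs⁻¹ ⊇ Y₁`. As `N`, `N₁` are
normalised by the root subgroups `X` and `Y`, their idempotents can be moved out of the way, which
reduces the claim to the rank one computation for `X`, `Y` and `Y₁`. -/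
lemma mul_eq_zero_of_swap {c : MonoidAlgebra ℂ (G A n)}
    (h : c * (idem (U A n) * elt (perm A (Equiv.swap i j)) *
      (idem (U A n) * idem (congrV A n))) = 0) :
    c * (idem (U A n) * idem (congrV A n)) = 0 := by
  have hne : i ≠ j := by rintro rfl; omega
  set s := perm A (Equiv.swap i j) with hs
  have hss : s * s = 1 := perm_swap_mul_self i j
  set X := U A n ⊓ conjBy s (V A n) with hX
  set N := U A n ⊓ conjBy s (U A n) with hN
  set Y := V A n ⊓ conjBy s (U A n) with hY
  set Y₁ := congrV A n ⊓ conjBy s (U A n) with hY₁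
  set N₁ := congrV A n ⊓ conjBy s (V A n) with hN₁
  set X₁ := U A n ⊓ conjBy s (congrV A n) with hX₁
  have hX₁X : X₁ ≤ X := inf_le_inf_left _ (Subgroup.comap_mono inf_le_left)
  have eU : idem (U A n) = idem X * idem N :=
    idem_eq_mul inf_le_left inf_le_left (U_factor _)
  have eU' : idem (U A n) = idem N * idem X :=
    idem_eq_mul' inf_le_left inf_le_left (U_factor _)
  have eV₁ : idem (congrV A n) = idem Y₁ * idem N₁ :=
    idem_eq_mul inf_le_left inf_le_left (congrV_factor _)
  have eV₁' : idem (congrV A n) = idem N₁ * idem Y₁ :=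
    idem_eq_mul' inf_le_left inf_le_left (congrV_factor _)
  have sX : elt s * idem X = idem Y * elt s := elt_mul_idem_inf hss _ _
  have sN : elt s * idem N = idem N * elt s := elt_mul_idem_inf hss _ _
  have sY₁ : elt s * idem Y₁ = idem X₁ * elt s := elt_mul_idem_inf hss _ _
  have sN₁ : elt s * idem N₁ = idem N₁ * elt s := by
    have := elt_mul_idem_inf hss (congrV A n) (V A n)
    rwa [inf_conjBy_congrV] at this
  have hXN : ∀ g ∈ X, ∀ x ∈ N, g * x * g⁻¹ ∈ N := fun g hg x hx => conj_mem_U_inf hij hg.1 hx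
  have hYN : ∀ g ∈ Y, ∀ x ∈ N, g * x * g⁻¹ ∈ N := fun g hg =>
    conj_mem_of_swap hss hXN ((mem_inf_conjBy_iff hss g).1 hg)
  have hYV : ∀ g ∈ Y, ∀ x ∈ V A n ⊓ conjBy s (V A n), g * x * g⁻¹ ∈ V A n ⊓ conjBy s (V A n) :=
    fun g hg x hx => conj_mem_V_inf hij hg.1 hx
  have hXV : ∀ g ∈ X, ∀ x ∈ V A n ⊓ conjBy s (V A n), g * x * g⁻¹ ∈ V A n ⊓ conjBy s (V A n) :=
    fun g hg => conj_mem_of_swap hss hYV ((mem_inf_conjBy_iff hss g).1 hg)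
  have hN₁' : ∀ {Z : Subgroup (G A n)}, (∀ g ∈ Z, ∀ x ∈ V A n ⊓ conjBy s (V A n),
      g * x * g⁻¹ ∈ V A n ⊓ conjBy s (V A n)) → ∀ g ∈ Z, ∀ x ∈ N₁, g * x * g⁻¹ ∈ N₁ := by
    intro Z hZ g hg x hx
    rw [mem_congrV_inf_iff] at hx ⊢
    exact ⟨hZ g hg x hx.1, (MonoidHom.normal_ker (red A n)).conj_mem _ hx.2 g⟩
  have cXN := idem_comm hXN
  have cYN := idem_comm hYN
  have cXN₁ := idem_comm (hN₁' hXV)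
  have cYN₁ := idem_comm (hN₁' hYV)
  -- Move `s` to the right and both `N` and `N₁` to the left.
  have h1 : c * (idem N * idem N₁) * (idem X * idem Y * idem X) = 0 := by
    have e : idem (U A n) * elt s * (idem (U A n) * idem (congrV A n)) * (elt s⁻¹ * idem X) =
        idem N * idem N₁ * (idem X * idem Y * idem X) := by
      calc _ = idem N * idem X * ((elt s * idem X) * idem N * (idem Y₁ * idem N₁)) *
            elt s⁻¹ * idem X := by
            nth_rw 1 [eU']; rw [eU, eV₁]; simp only [mul_assoc]
        _ = idem N * idem X * (idem Y * ((elt s * idem N) * (idem Y₁ * idem N₁))) *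
            elt s⁻¹ * idem X := by rw [sX]; simp only [mul_assoc]
        _ = idem N * idem X * (idem Y * (idem N * ((elt s * idem Y₁) * idem N₁))) *
            elt s⁻¹ * idem X := by rw [sN]; simp only [mul_assoc]
        _ = idem N * idem X * (idem Y * (idem N * (idem X₁ * (elt s * idem N₁)))) *
            elt s⁻¹ * idem X := by rw [sY₁]; simp only [mul_assoc]
        _ = idem N * idem X * (idem Y * idem N * (idem X₁ * idem N₁ * (elt s * elt s⁻¹))) *
            idem X := by rw [sN₁]; simp only [mul_assoc]
        _ = idem N * (idem X * idem N) * idem Y * idem X₁ * (idem N₁ * idem X) := by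
            rw [elt_mul_inv, mul_one, cYN]; simp only [mul_assoc]
        _ = (idem N * idem N) * idem X * idem Y * (idem X₁ * idem X) * idem N₁ := by
            rw [cXN, ← cXN₁]; simp only [mul_assoc]
        _ = idem N * idem X * idem Y * (idem X * idem N₁) := by
            rw [idem_mul_self, idem_mul_idem_of_le hX₁X]; simp only [mul_assoc]
        _ = idem N * idem X * (idem Y * idem N₁) * idem X := by
            rw [cXN₁]; simp only [mul_assoc]
        _ = idem N * (idem X * idem N₁) * idem Y * idem X := by
            rw [cYN₁]; simp only [mul_assoc]
        _ = _ := by rw [cXN₁]; simp only [mul_assoc]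
    rw [mul_assoc, ← e, ← mul_assoc, h, zero_mul]
  have h2 := mul_idem_idem_eq_zero h1
  have h3 : c * (idem N * idem N₁) * (idem X * idem Y₁) = 0 := by
    refine mul_idem_mul_idem_eq_zero_of_rank_one (f := elem (A := A) hne.symm) (elem_injective _)
      (mem_neg_root_iff hij hne) (mem_congrV_root_iff hij hne) (fun x hx => ?_) h2
    obtain ⟨x, rfl⟩ := hx
    have hax : -((x⁻¹ : Aˣ) : A) * (x : A) = -1 := by rw [neg_mul, Units.inv_mul]
    have hmem : ∀ y, elem hne y ∈ X := fun y => (mem_root_iff hij hne _).2 ⟨y, rfl⟩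
    refine ⟨elem hne (-((x⁻¹ : Aˣ) : A)) * elem hne.symm (x : A) * elem hne (-((x⁻¹ : Aˣ) : A)),
      _, hmem ((x⁻¹ : Aˣ) : A), _, hmem ((x⁻¹ : Aˣ) : A), ?_, ?_⟩
    · have e0 : elem hne (0 : A) = 1 := by
        have := elem_mul_elem hne (0 : A) 0
        rwa [add_zero, mul_eq_left] at this
      have e1 : elem hne ((x⁻¹ : Aˣ) : A) * elem hne (-((x⁻¹ : Aˣ) : A)) = 1 := by
        rw [elem_mul_elem, add_neg_cancel, e0]
      have e2 : elem hne (-((x⁻¹ : Aˣ) : A)) * elem hne ((x⁻¹ : Aˣ) : A) = 1 := by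
        rw [elem_mul_elem, neg_add_cancel, e0]
      calc elem hne.symm (x : A) = (elem hne ((x⁻¹ : Aˣ) : A) * elem hne (-((x⁻¹ : Aˣ) : A))) *
            elem hne.symm (x : A) *
            (elem hne (-((x⁻¹ : Aˣ) : A)) * elem hne ((x⁻¹ : Aˣ) : A)) := by
            rw [e1, e2, one_mul, mul_one]
        _ = _ := by simp only [mul_assoc]
    · refine elt_mul_idem_eq fun g => ?_
      set m := elem hne (-((x⁻¹ : Aˣ) : A)) * elem hne.symm (x : A) *
        elem hne (-((x⁻¹ : Aˣ) : A)) with hm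
      have hw : ∀ y : A, m * elem hne y * m⁻¹ = elem hne.symm (-((x : A) * x * y)) := fun y => by
        rw [mul_inv_eq_iff_eq_mul, hm, weyl_mul_elem hne hax]
      constructor
      · intro hg
        obtain ⟨y, rfl⟩ := (mem_root_iff hij hne _).1 hg
        exact (mem_neg_root_iff hij hne _).2 ⟨_, hw y⟩
      · intro hg
        obtain ⟨z, hz⟩ := (mem_neg_root_iff hij hne _).1 hg
        refine (mem_root_iff hij hne _).2 ⟨-((x⁻¹ : Aˣ) * ((x⁻¹ : Aˣ) * z)), ?_⟩
        have h4 := hw (-((x⁻¹ : Aˣ) * ((x⁻¹ : Aˣ) * z)))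
        rw [mul_neg, neg_neg, mul_assoc (x : A), Units.mul_inv_cancel_left, Units.mul_inv_cancel_left,
          ← hz] at h4
        exact (mul_left_cancel (mul_right_cancel h4)).symm
  calc c * (idem (U A n) * idem (congrV A n))
      = c * (idem N * (idem X * idem N₁) * idem Y₁) := by
        rw [eU', eV₁']; simp only [mul_assoc]
    _ = c * (idem N * idem N₁) * (idem X * idem Y₁) := by rw [cXN₁]; simp only [mul_assoc]
    _ = 0 := h3

/-- If `τ` keeps the order of the neighbours `i < j`, then `τ` conjugates the root subgroup of
`(i, j)` into `U`, so that this part of the middle factor `e_U` can be dropped. -/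
lemma idem_mul_perm_swap {τ : Equiv.Perm (Fin n)} (hτ : τ i < τ j) :
    idem (U A n) * elt (perm A τ) * (idem (U A n) * elt (perm A (Equiv.swap i j)) *
      (idem (U A n) * idem (congrV A n))) =
    idem (U A n) * elt (perm A (τ * Equiv.swap i j)) * (idem (U A n) * idem (congrV A n)) := by
  have hne : i ≠ j := by rintro rfl; omega
  set s := perm A (Equiv.swap i j) with hs
  have hss : s * s = 1 := perm_swap_mul_self i j
  have eU : idem (U A n) = idem (U A n ⊓ conjBy s (V A n)) * idem (U A n ⊓ conjBy s (U A n)) :=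
    idem_eq_mul inf_le_left inf_le_left (U_factor _)
  have sN : elt s * idem (U A n ⊓ conjBy s (U A n)) = idem (U A n ⊓ conjBy s (U A n)) * elt s :=
    elt_mul_idem_inf hss _ _
  have h1 : idem (U A n) * elt (perm A τ) * idem (U A n ⊓ conjBy s (V A n)) =
      idem (U A n) * elt (perm A τ) := by
    rw [← mul_one (_ * _ * idem (U A n ⊓ _))]
    refine mul_idem_mul_eq fun g hg => ?_
    have hg' : perm A τ * g * (perm A τ)⁻¹ ∈ U A n := by
      obtain ⟨x, rfl⟩ := (mem_root_iff hij hne g).1 hg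
      have e : ∀ k l, (perm A τ * elem hne x * (perm A τ)⁻¹).val k l =
          (elem hne x).val (τ⁻¹ k) (τ⁻¹ l) := fun k l => by
        rw [← map_inv, mul_perm_apply, perm_mul_apply]
      refine mem_U.2 ⟨fun k => ?_, fun k l hkl => ?_⟩
      · rw [e]; exact hg.1.1 _
      · rw [e, elem_apply, if_neg (fun e => hkl.ne' (τ⁻¹.injective e)), if_neg, add_zero]
        rintro ⟨h1, h2⟩
        rw [Equiv.Perm.eq_inv_iff_eq] at h1 h2
        rw [← h1, ← h2] at hkl
        exact lt_asymm hkl hτ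
    rw [mul_one, mul_assoc, elt_mul_elt,
      show perm A τ * g = (perm A τ * g * (perm A τ)⁻¹) * perm A τ by group, ← elt_mul_elt,
      ← mul_assoc, idem_mul_elt hg']
  calc _ = idem (U A n) * elt (perm A τ) * idem (U A n ⊓ conjBy s (V A n)) *
        (idem (U A n ⊓ conjBy s (U A n)) * elt s) * (idem (U A n) * idem (congrV A n)) := by
        nth_rw 2 [eU]; simp only [mul_assoc]
    _ = idem (U A n) * (elt (perm A τ) * elt s) *
        ((idem (U A n ⊓ conjBy s (U A n)) * idem (U A n)) * idem (congrV A n)) := by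
        rw [h1, ← sN]; simp only [mul_assoc]
    _ = _ := by rw [idem_mul_idem_of_le inf_le_left, elt_mul_elt, map_mul]

omit hij

lemma exists_descent {σ : Equiv.Perm (Fin n)} (hσ : σ ≠ 1) :
    ∃ i j : Fin n, (i : ℕ) + 1 = j ∧ σ j < σ i := by
  by_contra! h
  refine hσ ?_
  have hmono : StrictMono σ := by
    cases n with
    | zero => exact fun a => a.elim0
    | succ n =>
      refine Fin.strictMono_iff_lt_succ.2 fun i => lt_of_le_of_ne (h _ _ (by simp)) fun e => ?_
      have := σ.injective e
      simp [Fin.ext_iff] at this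
  have := (StrictMono.range_inj hmono strictMono_id).1 (by simp)
  exact Equiv.ext fun k => congrFun this k

/-- Going through a chain of neighbouring Borel subgroups between `U` and its conjugate by any
permutation. Removing a descent makes the permutation lexicographically smaller. -/
lemma mul_eq_zero_of_perm (σ : Equiv.Perm (Fin n)) {c : MonoidAlgebra ℂ (G A n)}
    (h : c * (idem (U A n) * elt (perm A σ) * (idem (U A n) * idem (congrV A n))) = 0) :
    c * (idem (U A n) * idem (congrV A n)) = 0 := by
  suffices H : ∀ (f : Lex (Fin n → Fin n)) (σ : Equiv.Perm (Fin n)), f = toLex (σ : Fin n → Fin n) →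
      c * (idem (U A n) * elt (perm A σ) * (idem (U A n) * idem (congrV A n))) = 0 →
      c * (idem (U A n) * idem (congrV A n)) = 0 from H _ σ rfl h
  intro f
  induction f using WellFoundedLT.induction with
  | ind f ih =>
    rintro σ rfl h
    by_cases hσ : σ = 1
    · rw [hσ, map_one, elt_one, mul_one, ← mul_assoc (idem (U A n)) (idem (U A n)),
        idem_mul_self] at h
      exact h
    · obtain ⟨i, j, hij, hlt⟩ := exists_descent hσ
      have hle : i ≤ j := Fin.le_def.2 (by omega)
      refine ih _ (Pi.lex_desc hle hlt) (σ * Equiv.swap i j) rfl ?_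
      have h1 := idem_mul_perm_swap (A := A) hij (τ := σ * Equiv.swap i j) (by simpa using hlt)
      rw [mul_assoc σ, Equiv.swap_mul_self, mul_one] at h1
      rw [← h1, ← mul_assoc c] at h
      have h2 := mul_eq_zero_of_swap hij h
      rwa [mul_assoc c] at h2

/-- `e_U e_{V₁}` lies in the right ideal generated by `e_U e_V`. The longest permutation conjugates
`U` to `V`. -/
theorem exists_idem_mul_idem_congrV (A : Type u) [CommRing A] [IsLocalRing A] [Finite A] (n : ℕ) :
    ∃ z, idem (U A n) * idem (congrV A n) = idem (U A n) * idem (V A n) * z := by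
  refine exists_eq_mul_of_annihilator fun c hc => mul_eq_zero_of_perm Fin.revPerm ?_
  have e : elt (perm A Fin.revPerm) * idem (U A n) = idem (V A n) * elt (perm A Fin.revPerm) := by
    refine elt_mul_idem_eq fun g => ?_
    have hrev : (Fin.revPerm : Equiv.Perm (Fin n))⁻¹ = Fin.revPerm := rfl
    have e : ∀ k l, (perm A Fin.revPerm * g * (perm A Fin.revPerm)⁻¹).val k l =
        g.val k.rev l.rev := fun k l => by
      rw [← map_inv, mul_perm_apply, perm_mul_apply]; rfl
    rw [mem_U, mem_V]
    simp only [e]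
    refine and_congr ⟨fun h i => h _, fun h i => by simpa using h i.rev⟩
      ⟨fun h i j hij => h _ _ (Fin.rev_lt_rev.2 hij), fun h i j hij => ?_⟩
    simpa using h i.rev j.rev (Fin.rev_lt_rev.2 hij)
  calc _ = c * (idem (U A n) * (elt (perm A Fin.revPerm) * idem (U A n)) * idem (congrV A n)) := by
        simp only [mul_assoc]
    _ = c * (idem (U A n) * idem (V A n)) * (elt (perm A Fin.revPerm) * idem (congrV A n)) := by
        rw [e]; simp only [mul_assoc]
    _ = 0 := by rw [hc, zero_mul]

end Chain

/-! ### Products of groups -/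

section Product

variable {ι : Type*} {K : Type u} [Group K] {K' : ι → Type u} [∀ i, Group (K' i)]

/-- The subgroup of elements all of whose components lie in given subgroups. -/
def piSubgroup (π : ∀ i, K →* K' i) (H : ∀ i, Subgroup (K' i)) : Subgroup K :=
  ⨅ i, (H i).comap (π i)

lemma mem_piSubgroup {π : ∀ i, K →* K' i} {H : ∀ i, Subgroup (K' i)} {g : K} :
    g ∈ piSubgroup π H ↔ ∀ i, π i g ∈ H i := by
  simp [piSubgroup, Subgroup.mem_iInf]

variable {π : ∀ i, K →* K' i} (hπ : Function.Bijective fun (g : K) (i : ι) => π i g)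
include hπ

lemma exists_lift (x : ∀ i, K' i) : ∃ g, ∀ i, π i g = x i := by
  obtain ⟨g, hg⟩ := hπ.2 x
  exact ⟨g, fun i => congrFun hg i⟩

lemma ext_of_map {g h : K} (e : ∀ i, π i g = π i h) : g = h := hπ.1 (funext e)

/-- Iwahori data are stable under products. -/
theorem IwahoriDatum.pi {U V L W U₁ V₁ I M : ∀ i, Subgroup (K' i)}
    (D : ∀ i, IwahoriDatum (U i) (V i) (L i) (W i) (U₁ i) (V₁ i) (I i) (M i)) :
    IwahoriDatum (piSubgroup π U) (piSubgroup π V) (piSubgroup π L) (piSubgroup π W)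
      (piSubgroup π U₁) (piSubgroup π V₁) (piSubgroup π I) (piSubgroup π M) := by
  have hle : ∀ {A B : ∀ i, Subgroup (K' i)}, (∀ i, A i ≤ B i) → piSubgroup π A ≤ piSubgroup π B :=
    fun h g hg => mem_piSubgroup.2 fun i => h i (mem_piSubgroup.1 hg i)
  have hconj : ∀ {A B : ∀ i, Subgroup (K' i)}, (∀ i, ∀ l ∈ A i, ∀ g ∈ B i, l * g * l⁻¹ ∈ B i) →
      ∀ l ∈ piSubgroup π A, ∀ g ∈ piSubgroup π B, l * g * l⁻¹ ∈ piSubgroup π B :=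
    fun h l hl g hg => mem_piSubgroup.2 fun i => by
      simpa using h i _ (mem_piSubgroup.1 hl i) _ (mem_piSubgroup.1 hg i)
  have hcj : ∀ {A B : ∀ i, Subgroup (K' i)} {w x : K},
      x ∈ piSubgroup π A ⊓ conjBy w (piSubgroup π B) ↔
        ∀ i, π i x ∈ A i ⊓ conjBy (π i w) (B i) := by
    intro A B w x
    simp only [Subgroup.mem_inf, mem_conjBy, mem_piSubgroup, map_mul, map_inv, forall_and]
  have hfac : ∀ {A B C A' B' C' : ∀ i, Subgroup (K' i)},
      (∀ i, ∀ w ∈ W i, ∀ x ∈ A i ⊓ conjBy w (A' i), ∃ a ∈ B i ⊓ conjBy w (B' i),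
        ∃ b ∈ C i ⊓ conjBy w (C' i), x = a * b) →
      ∀ w ∈ piSubgroup π W, ∀ x ∈ piSubgroup π A ⊓ conjBy w (piSubgroup π A'),
        ∃ a ∈ piSubgroup π B ⊓ conjBy w (piSubgroup π B'),
        ∃ b ∈ piSubgroup π C ⊓ conjBy w (piSubgroup π C'), x = a * b := by
    intro A B C A' B' C' h w hw x hx
    choose a ha b hb e using fun i => h i _ (mem_piSubgroup.1 hw i) _ (hcj.1 hx i)
    obtain ⟨a', ha'⟩ := exists_lift hπ a
    obtain ⟨b', hb'⟩ := exists_lift hπ b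
    exact ⟨a', hcj.2 fun i => ha' i ▸ ha i, b', hcj.2 fun i => hb' i ▸ hb i,
      ext_of_map hπ fun i => by rw [map_mul, ha', hb', e]⟩
  have hfac' : ∀ {A B C B' C' : ∀ i, Subgroup (K' i)},
      (∀ i, ∀ w ∈ W i, ∀ x ∈ A i, ∃ a ∈ B i ⊓ conjBy w (B' i),
        ∃ b ∈ C i ⊓ conjBy w (C' i), x = a * b) →
      ∀ w ∈ piSubgroup π W, ∀ x ∈ piSubgroup π A,
        ∃ a ∈ piSubgroup π B ⊓ conjBy w (piSubgroup π B'),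
        ∃ b ∈ piSubgroup π C ⊓ conjBy w (piSubgroup π C'), x = a * b :=
    fun {A B C B' C'} h w hw x hx => hfac (A' := fun _ => ⊤)
      (fun i w hw x hx => h i w hw x hx.1) w hw x
      (hcj.2 fun i => ⟨mem_piSubgroup.1 hx i, mem_conjBy.2 trivial⟩)
  constructor
  · exact hle fun i => (D i).U₁_le
  · exact hle fun i => (D i).V₁_le
  · exact hle fun i => (D i).U_le_I
  · exact hle fun i => (D i).V₁_le_I
  · exact hle fun i => (D i).U₁_le_M
  · exact hle fun i => (D i).V₁_le_M
  · exact hle fun i => (D i).L_le_M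
  · exact hconj fun i => (D i).conj_U
  · exact hconj fun i => (D i).conj_V
  · exact hconj fun i => (D i).conj_V₁
  · exact hfac' fun i => (D i).U_factor
  · exact hfac' fun i => (D i).V_factor
  · exact hfac' fun i => (D i).V₁_factor
  · exact hfac fun i => (D i).I_factor
  · intro g
    choose w hw h using fun i => (D i).bruhat (π i g)
    obtain ⟨w', hw'⟩ := exists_lift hπ w
    refine ⟨w', mem_piSubgroup.2 fun i => hw' i ▸ hw i, fun x hx => ?_⟩
    choose a ha l hl u hu e using fun i => h i _ (mem_piSubgroup.1 hx i)
    obtain ⟨a', ha'⟩ := exists_lift hπ a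
    obtain ⟨l', hl'⟩ := exists_lift hπ l
    obtain ⟨u', hu'⟩ := exists_lift hπ u
    exact ⟨a', hcj.2 fun i => by rw [ha', hw']; exact ha i, l',
      mem_piSubgroup.2 fun i => hl' i ▸ hl i, u', mem_piSubgroup.2 fun i => hu' i ▸ hu i,
      ext_of_map hπ fun i => by simp only [map_mul, ha', hl', hu', hw', e]⟩
  · intro w hw w' hw' x hx y hy h
    have key := fun i => (D i).disjoint_cells _ (mem_piSubgroup.1 hw i) _ (mem_piSubgroup.1 hw' i)
      _ (mem_piSubgroup.1 hx i) _ (mem_piSubgroup.1 hy i)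
      (by simpa using mem_piSubgroup.1 h i)
    refine ⟨ext_of_map hπ fun i => (key i).1, ?_⟩
    choose a ha b hb e using fun i => (key i).2
    obtain ⟨a', ha'⟩ := exists_lift hπ a
    obtain ⟨b', hb'⟩ := exists_lift hπ b
    exact ⟨a', mem_piSubgroup.2 fun i => ha' i ▸ ha i, b', mem_piSubgroup.2 fun i => hb' i ▸ hb i,
      ext_of_map hπ fun i => by simp only [map_mul, map_inv, ha', hb', e]⟩
  · intro x hx y hy h
    have key := fun i => (D i).big_cell _ (mem_piSubgroup.1 hx i) _ (mem_piSubgroup.1 hy i)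
      (by simpa using mem_piSubgroup.1 h i)
    exact ⟨ext_of_map hπ fun i => by rw [(key i).1, map_one],
      ext_of_map hπ fun i => by rw [(key i).2, map_one]⟩

omit hπ

/-- The element of the group ring of a product of groups with coefficients `∏ i, x_i(g_i)`. -/
def tensorElt [Finite K] [Fintype ι] (π : ∀ i, K →* K' i) (x : ∀ i, MonoidAlgebra ℂ (K' i)) :
    MonoidAlgebra ℂ K :=
  .ofCoeff (Finsupp.equivFunOnFinite.symm fun g => ∏ i, (x i).coeff (π i g))

lemma coeff_tensorElt [Finite K] [Fintype ι] (x : ∀ i, MonoidAlgebra ℂ (K' i)) (g : K) :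
    (tensorElt π x).coeff g = ∏ i, (x i).coeff (π i g) := rfl

lemma coeff_mul_eq_sum [Fintype K] (x y : MonoidAlgebra ℂ K) (g : K) :
    (x * y).coeff g = ∑ h, x.coeff h * y.coeff (h⁻¹ * g) := by
  conv_lhs => rw [eq_sum_elt x, Finset.sum_mul]
  rw [MonoidAlgebra.coeff_sum, Finsupp.finsetSum_apply]
  refine Finset.sum_congr rfl fun h _ => ?_
  rw [smul_mul_assoc, MonoidAlgebra.coeff_smul_apply, MonoidAlgebra.coeff_single_mul_apply,
    one_mul, smul_eq_mul]

lemma coeff_idem [Finite K] (H : Subgroup K) [DecidablePred (· ∈ H)] (g : K) :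
    (idem H).coeff g = if g ∈ H then (Nat.card H : ℂ)⁻¹ else 0 := by
  classical
  have := Fintype.ofFinite K
  have := Fintype.ofFinite H
  rw [idem_eq, MonoidAlgebra.coeff_smul_apply, MonoidAlgebra.coeff_sum, Finsupp.finsetSum_apply,
    smul_eq_mul]
  split_ifs with h
  · rw [Finset.sum_eq_single ⟨g, h⟩]
    · simp
    · intro x _ hx
      simp only [MonoidAlgebra.coeff_single]
      exact Finsupp.single_eq_of_ne fun e => hx (Subtype.ext e.symm)
    · simp
  · rw [Finset.sum_eq_zero, mul_zero]
    intro x _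
    simp only [MonoidAlgebra.coeff_single]
    exact Finsupp.single_eq_of_ne fun e => h (e ▸ x.2)

include hπ

lemma tensorElt_mul [Finite K] [∀ i, Finite (K' i)] [Fintype ι]
    (x y : ∀ i, MonoidAlgebra ℂ (K' i)) :
    tensorElt π (fun i => x i * y i) = tensorElt π x * tensorElt π y := by
  classical
  have := Fintype.ofFinite K
  have := fun i => Fintype.ofFinite (K' i)
  ext g
  rw [coeff_mul_eq_sum, coeff_tensorElt]
  simp only [coeff_mul_eq_sum]
  rw [Finset.prod_univ_sum, Fintype.piFinset_univ]
  symm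
  refine Fintype.sum_bijective _ hπ _ _ fun h => ?_
  rw [coeff_tensorElt, coeff_tensorElt, Finset.prod_mul_distrib]
  simp only [map_mul, map_inv]

lemma tensorElt_idem [Finite K] [∀ i, Finite (K' i)] [Fintype ι] (H : ∀ i, Subgroup (K' i)) :
    tensorElt π (fun i => idem (H i)) = idem (piSubgroup π H) := by
  classical
  have hcard : Nat.card (piSubgroup π H) = ∏ i, Nat.card (H i) := by
    rw [← Nat.card_pi]
    refine Nat.card_congr (Equiv.ofBijective
      (fun g i => ⟨π i g, mem_piSubgroup.1 g.2 i⟩) ⟨fun g h e => ?_, fun x => ?_⟩)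
    · exact Subtype.ext (ext_of_map hπ fun i => congrArg Subtype.val (congrFun e i))
    · obtain ⟨g, hg⟩ := exists_lift hπ fun i => (x i : K' i)
      exact ⟨⟨g, mem_piSubgroup.2 fun i => by rw [hg]; exact (x i).2⟩,
        funext fun i => Subtype.ext (hg i)⟩
  ext g
  rw [coeff_tensorElt]
  simp only [coeff_idem]
  rw [Fintype.prod_ite_zero, hcard, Nat.cast_prod, Finset.prod_inv_distrib]
  simp only [mem_piSubgroup]

theorem exists_idem_mul_idem_pi [Finite K] [∀ i, Finite (K' i)] [Finite ι]
    {A B C E : ∀ i, Subgroup (K' i)}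
    (h : ∀ i, ∃ z, idem (A i) * idem (B i) = idem (C i) * idem (E i) * z) :
    ∃ z, idem (piSubgroup π A) * idem (piSubgroup π B) =
      idem (piSubgroup π C) * idem (piSubgroup π E) * z := by
  have := Fintype.ofFinite ι
  choose z hz using h
  refine ⟨tensorElt π z, ?_⟩
  simp only [← tensorElt_idem hπ, ← tensorElt_mul hπ, hz]

end Product

/-! ### Finite rings as products of local rings -/

section FiniteRing

variable (R : Type u) [CommRing R] [Finite R] (n : ℕ)

/-- The projection to the general linear group over a local factor. -/
def toLocal (m : MaximalSpectrum R) : G R n →* G (Localization.AtPrime m.asIdeal) n :=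
  Matrix.GeneralLinearGroup.map (algebraMap R (Localization.AtPrime m.asIdeal))

omit [Finite R] in
lemma toLocal_apply (m : MaximalSpectrum R) (g : G R n) (i j : Fin n) :
    (toLocal R n m g).val i j = algebraMap R (Localization.AtPrime m.asIdeal) (g.val i j) := rfl

lemma toPiLocalization_bijective : Function.Bijective (MaximalSpectrum.toPiLocalization R) := by
  refine ⟨MaximalSpectrum.toPiLocalization_injective R, ?_⟩
  rw [← PrimeSpectrum.piLocalizationToMaximal_comp_toPiLocalization]
  exact (PrimeSpectrum.piLocalizationToMaximal_surjective R).comp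
    PrimeSpectrum.toPiLocalization_bijective.2

omit [Finite R] in
lemma eq_of_localizations {x y : R}
    (h : ∀ m : MaximalSpectrum R, algebraMap R (Localization.AtPrime m.asIdeal) x =
      algebraMap R (Localization.AtPrime m.asIdeal) y) : x = y :=
  MaximalSpectrum.toPiLocalization_injective R (funext h)

lemma toLocal_bijective :
    Function.Bijective fun (g : G R n) (m : MaximalSpectrum R) => toLocal R n m g := by
  constructor
  · intro g h e
    refine Units.ext (Matrix.ext fun i j => eq_of_localizations R fun m => ?_)
    exact congrArg (fun x : G _ n => x.val i j) (congrFun e m)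
  · intro x
    choose a ha using fun i j => (toPiLocalization_bijective R).2 fun m => (x m).val i j
    choose b hb using fun i j => (toPiLocalization_bijective R).2 fun m => (x m)⁻¹.val i j
    have ha' : ∀ m, (algebraMap R (Localization.AtPrime m.asIdeal)).mapMatrix (Matrix.of a) =
        (x m).val := fun m => Matrix.ext fun i j => congrFun (ha i j) m
    have hb' : ∀ m, (algebraMap R (Localization.AtPrime m.asIdeal)).mapMatrix (Matrix.of b) =
        (x m)⁻¹.val := fun m => Matrix.ext fun i j => congrFun (hb i j) m
    have hone : ∀ c : Matrix (Fin n) (Fin n) R, (∀ m : MaximalSpectrum R,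
        (algebraMap R (Localization.AtPrime m.asIdeal)).mapMatrix c = 1) → c = 1 := by
      intro c hc
      refine Matrix.ext fun i j => eq_of_localizations R fun m => ?_
      have := congrFun (congrFun ((hc m).trans (map_one
        (algebraMap R (Localization.AtPrime m.asIdeal)).mapMatrix).symm) i) j
      exact this
    refine ⟨⟨Matrix.of a, Matrix.of b, hone _ fun m => ?_, hone _ fun m => ?_⟩,
      funext fun m => Units.ext (ha' m)⟩
    · rw [map_mul, ha', hb', Units.mul_inv]
    · rw [map_mul, ha', hb', Units.inv_mul]

omit [Finite R] in
lemma mem_unipotent_iff_toLocal {α : Type} [LinearOrder α] (b : Fin n ≃ α) (g : G R n) :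
    g ∈ unipotent R b ↔ ∀ m, toLocal R n m g ∈ unipotent (Localization.AtPrime m.asIdeal) b := by
  constructor
  · intro h m
    exact ⟨fun i => by rw [toLocal_apply, h.1, map_one],
      fun i j hij => by rw [toLocal_apply, h.2 i j hij, map_zero]⟩
  · intro h
    refine ⟨fun i => eq_of_localizations R fun m => ?_,
      fun i j hij => eq_of_localizations R fun m => ?_⟩
    · rw [map_one]; exact (h m).1 i
    · rw [map_zero]; exact (h m).2 i j hij

omit [Finite R] in
lemma piSubgroup_U : piSubgroup (toLocal R n) (fun m => U (Localization.AtPrime m.asIdeal) n) =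
    U R n := by
  ext g; rw [mem_piSubgroup]; exact (mem_unipotent_iff_toLocal R n _ g).symm

omit [Finite R] in
lemma piSubgroup_V : piSubgroup (toLocal R n) (fun m => V (Localization.AtPrime m.asIdeal) n) =
    V R n := by
  ext g; rw [mem_piSubgroup]; exact (mem_unipotent_iff_toLocal R n _ g).symm

omit [Finite R] in
lemma piSubgroup_L : piSubgroup (toLocal R n) (fun m => L (Localization.AtPrime m.asIdeal) n) =
    L R n := by
  ext g
  rw [mem_piSubgroup]
  refine ⟨fun h i j hij => eq_of_localizations R fun m => ?_, fun h m i j hij => ?_⟩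
  · rw [map_zero]; exact h m i j hij
  · rw [toLocal_apply, h i j hij, map_zero]

theorem exists_iwahoriDatum : ∃ U₁ V₁ I M : Subgroup (G R n),
    IwahoriDatum (U R n) (V R n) (L R n) (W R n) U₁ V₁ I M ∧
      ∃ z, idem (U R n) * idem V₁ = idem (U R n) * idem (V R n) * z := by
  have hfin : ∀ m : MaximalSpectrum R, Finite (Localization.AtPrime m.asIdeal) := fun m =>
    Finite.of_surjective _ (IsArtinianRing.localization_surjective m.asIdeal.primeCompl _)
  refine ⟨piSubgroup (toLocal R n) fun m => congrU _ n, piSubgroup (toLocal R n) fun m => congrV _ n,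
    piSubgroup (toLocal R n) fun m => iwahori _ n, piSubgroup (toLocal R n) fun m => diagMod _ n,
    ?_, ?_⟩
  -- `W R n` is by definition the group of elements whose components are permutation matrices
  · have := IwahoriDatum.pi (toLocal_bijective R n) fun m =>
      iwahoriDatum_of_isLocalRing (Localization.AtPrime m.asIdeal) n
    rwa [piSubgroup_U, piSubgroup_V, piSubgroup_L] at this
  · have := exists_idem_mul_idem_pi (toLocal_bijective R n) fun m =>
      exists_idem_mul_idem_congrV (Localization.AtPrime m.asIdeal) n
    rwa [piSubgroup_U, piSubgroup_V] at this

end FiniteRing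

/-! ### Coordinates on the algebra cut out by `e_U e_V` -/

section Coordinates

variable (R : Type u) [CommRing R] [Finite R] (n : ℕ)

omit [Finite R] in
lemma incl_single (l : L R n) (c : ℂ) :
    incl R n (MonoidAlgebra.single l c) = c • elt (l : G R n) := by
  simp [incl, MonoidAlgebra.mapDomainRingHom_apply]

omit [Finite R] in
lemma incl_smul (c : ℂ) (b : CL R n) : incl R n (c • b) = c • incl R n b :=
  map_smul (MonoidAlgebra.mapDomainAlgHom ℂ ℂ (L R n).subtype) c b

omit [Finite R] in
lemma incl_injective : Function.Injective (incl R n) :=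
  MonoidAlgebra.mapDomain_injective (L R n).subtype_injective

omit [Finite R] in
lemma incl_mem_groupSubalgebra (b : CL R n) : incl R n b ∈ groupSubalgebra (L R n) := ⟨b, rfl⟩

variable {R n}

lemma commute_idem_U (b : CL R n) : Commute (incl R n b) (idem (U R n)) :=
  commute_idem_of_mem (fun _ hl _ hg => conj_mem_unipotent _ hl hg) (incl_mem_groupSubalgebra R n b)

/-- The element `e_U w e_U e_V`, for `w ∈ W`. -/
def cellElt (w : W R n) : CG R n := idem (U R n) * elt (w : G R n) * eUV R n

/-- The algebra endomorphism `Ad_w⁻¹` of the group ring of `L`. -/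
abbrev adRing (w : W R n) : CL R n →+* CL R n := MonoidAlgebra.mapDomainRingHom ℂ (adInv w)

omit [Finite R] in
lemma incl_mul_elt (w : W R n) (b : CL R n) :
    incl R n b * elt (w : G R n) = elt (w : G R n) * incl R n (adRing w b) := by
  induction b using MonoidAlgebra.induction_linear with
  | zero => simp
  | add x y hx hy => rw [map_add, map_add, map_add, add_mul, mul_add, hx, hy]
  | single l c =>
    have e : adRing w (MonoidAlgebra.single l c) = MonoidAlgebra.single (adInv w l) c := by
      simp [adRing, MonoidAlgebra.mapDomainRingHom_apply]
    rw [e, incl_single, incl_single, smul_mul_assoc, mul_smul_comm, elt_mul_elt, elt_mul_elt]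
    congr 2
    change (l : G R n) * w = w * ((w : G R n)⁻¹ * l * w)
    group

/-- Moving the group ring of `L` across the generator attached to `w` twists it by `Ad_w⁻¹`. -/
lemma incl_mul_cellElt (w : W R n) (b : CL R n) :
    incl R n b * cellElt w = cellElt w * incl R n (adRing w b) := by
  rw [cellElt, ← mul_assoc, ← mul_assoc, (commute_idem_U b).eq, mul_assoc (idem _), incl_mul_elt,
    mul_assoc _ (eUV R n), ← (commute_eUV R n _).eq]
  simp only [mul_assoc]

lemma exists_cellElt_eq (w : W R n) : ∃ c, cellElt w = eUV R n * c := by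
  obtain ⟨U₁, V₁, I, M, D, -⟩ := exists_iwahoriDatum R n
  exact ⟨_, D.idem_mul_elt_mul w.2⟩

variable (R n) in
/-- The map `(b_w)_w ↦ ∑_w e_U w e_U e_V b_w`. -/
def cellSum [Fintype (W R n)] : (W R n → CL R n) →ₗ[ℂ] CG R n where
  toFun b := ∑ w, cellElt w * incl R n (b w)
  map_add' b b' := by simp [mul_add, Finset.sum_add_distrib]
  map_smul' c b := by simp [incl_smul, Finset.smul_sum]

lemma cellSum_apply [Fintype (W R n)] (b : W R n → CL R n) :
    cellSum R n b = ∑ w, cellElt w * incl R n (b w) := rfl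

lemma cellSum_single [Fintype (W R n)] [DecidableEq (W R n)] (w : W R n) (b : CL R n) :
    cellSum R n (Pi.single w b) = cellElt w * incl R n b := by
  rw [cellSum_apply, Finset.sum_eq_single w, Pi.single_eq_same]
  · intro w' _ h
    rw [Pi.single_eq_of_ne h, map_zero, mul_zero]
  · simp

lemma cellSum_mul_incl [Fintype (W R n)] (b : W R n → CL R n) (c : CL R n) :
    cellSum R n b * incl R n c = cellSum R n fun w => b w * c := by
  simp only [cellSum_apply, Finset.sum_mul, map_mul, mul_assoc]

lemma cellSum_injective [Fintype (W R n)] : Function.Injective (cellSum R n) := by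
  rw [injective_iff_map_eq_zero]
  intro b hb
  obtain ⟨U₁, V₁, I, M, D, hS⟩ := exists_iwahoriDatum R n
  funext w
  refine incl_injective R n ?_
  rw [Pi.zero_apply, map_zero]
  exact D.eq_zero_of_sum_eq_zero hS (fun w => incl R n (b w))
    (fun w => incl_mem_groupSubalgebra R n _) hb w

variable (R n) in
/-- `e_U e_V` is von Neumann regular, because the group ring is semisimple. -/
lemma exists_eUV_mul_mul_eq : ∃ y, eUV R n * y * eUV R n = eUV R n := exists_mul_mul_eq _

/-- The elements `e_U w e_U e_V` form a basis of `e_U e_V ℂ[G] e_U e_V` as a right module over the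
group ring of `L`: the sums lie in that space, are independent, and fill its dimension. -/
lemma exists_cellSum_eq [Fintype (W R n)] (x : CG R n) :
    ∃ b, cellSum R n b = eUV R n * x * eUV R n := by
  obtain ⟨U₁, V₁, I, M, D, -⟩ := exists_iwahoriDatum R n
  obtain ⟨y, hy⟩ := exists_eUV_mul_mul_eq R n
  have hle : LinearMap.range (cellSum R n) ≤
      LinearMap.range (LinearMap.mulLeftRight ℂ (eUV R n, eUV R n)) := by
    rintro _ ⟨b, rfl⟩
    rw [cellSum_apply]
    refine Submodule.sum_mem _ fun w _ => ?_
    obtain ⟨c, hc⟩ := exists_cellElt_eq w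
    refine ⟨c * y * incl R n (b w), ?_⟩
    rw [LinearMap.mulLeftRight_apply]
    calc eUV R n * (c * y * incl R n (b w)) * eUV R n
        = eUV R n * c * y * (incl R n (b w) * eUV R n) := by simp only [mul_assoc]
      _ = idem (U R n) * elt (w : G R n) * (eUV R n * y * eUV R n) * incl R n (b w) := by
        rw [(commute_eUV R n _).eq, ← hc, cellElt]; simp only [mul_assoc]
      _ = cellElt w * incl R n (b w) := by rw [hy, cellElt]
  have hrank : Module.finrank ℂ (W R n → CL R n) = Nat.card (W R n) * Nat.card (L R n) := by
    have := Fintype.ofFinite (L R n)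
    rw [Module.finrank_pi_fintype, Finset.sum_const, Finset.card_univ, smul_eq_mul,
      Nat.card_eq_fintype_card]
    congr 1
    rw [(MonoidAlgebra.coeffLinearEquiv (M := L R n) (S := ℂ) ℂ).finrank_eq,
      Module.finrank_finsupp_self, Nat.card_eq_fintype_card]
  have := Submodule.eq_of_le_of_finrank_le hle (by
    rw [LinearMap.finrank_range_of_inj cellSum_injective, hrank]
    exact D.finrank_sandwich_le)
  have hx : eUV R n * x * eUV R n ∈ LinearMap.range (cellSum R n) := by
    rw [this]
    exact ⟨x, LinearMap.mulLeftRight_apply ..⟩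
  exact hx

variable (R n) in
lemma exists_coord [Fintype (W R n)] :
    ∃ β : CG R n →ₗ[ℂ] (W R n → CL R n), β ∘ₗ cellSum R n = LinearMap.id :=
  LinearMap.exists_leftInverse_of_injective _ (LinearMap.ker_eq_bot.2 cellSum_injective)

variable (R n) in
/-- Coordinates with respect to the elements `e_U w e_U e_V`. They are meaningful on
`e_U e_V ℂ[G] e_U e_V`, and are extended to `ℂ[G]` in an arbitrary way. -/
def coord [Fintype (W R n)] : CG R n →ₗ[ℂ] (W R n → CL R n) := (exists_coord R n).choose

@[simp] lemma coord_cellSum [Fintype (W R n)] (b : W R n → CL R n) :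
    coord R n (cellSum R n b) = b :=
  LinearMap.congr_fun (exists_coord R n).choose_spec b

lemma cellSum_coord [Fintype (W R n)] (x : CG R n) :
    cellSum R n (coord R n (eUV R n * x * eUV R n)) = eUV R n * x * eUV R n := by
  obtain ⟨b, hb⟩ := exists_cellSum_eq x
  rw [← hb, coord_cellSum]

lemma coord_mul_incl [Fintype (W R n)] (x : CG R n) (c : CL R n) (w : W R n) :
    coord R n (eUV R n * x * eUV R n * incl R n c) w =
      coord R n (eUV R n * x * eUV R n) w * c := by
  obtain ⟨b, hb⟩ := exists_cellSum_eq x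
  rw [← hb, cellSum_mul_incl, coord_cellSum, coord_cellSum]

end Coordinates

/-! ### Balanced maps out of the tensor product -/

namespace SubBimodule

variable {A B C : Type*} [Ring A] [Ring B] [Ring C] {f : B →+* A} {g : C →+* A}
  (M : SubBimodule f g) {X N : Type*} [AddCommGroup X] [Module C X] [AddCommGroup N]

/-- The class of a pure tensor. -/
def tmk (x : M.Elem) (y : X) : M.Tensor X := Submodule.Quotient.mk (x ⊗ₜ[ℤ] y)

lemma tmk_add (x : M.Elem) (y y' : X) : M.tmk x (y + y') = M.tmk x y + M.tmk x y' := by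
  rw [tmk, TensorProduct.tmul_add]; rfl

lemma add_tmk (x x' : M.Elem) (y : X) : M.tmk (x + x') y = M.tmk x y + M.tmk x' y := by
  rw [tmk, TensorProduct.add_tmul]; rfl

lemma smul_tmk (b : B) (x : M.Elem) (y : X) : b • M.tmk x y = M.tmk (b • x) y := rfl

lemma rmul_tmk (x : M.Elem) (c : C) (y : X) : M.tmk (M.rmul x c) y = M.tmk x (c • y) := by
  refine (Submodule.Quotient.eq _).2 ?_
  exact Submodule.subset_span ⟨x, c, y, rfl⟩

lemma sum_tmk {ι : Type*} (s : Finset ι) (x : ι → M.Elem) (y : X) :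
    M.tmk (∑ i ∈ s, x i) y = ∑ i ∈ s, M.tmk (x i) y :=
  map_sum (⟨⟨fun x => M.tmk x y, by
    rw [tmk, TensorProduct.zero_tmul]; rfl⟩, fun x x' => M.add_tmk x x' y⟩ : M.Elem →+ M.Tensor X) x s

lemma tensor_induction {p : M.Tensor X → Prop} (hmk : ∀ x y, p (M.tmk x y))
    (hadd : ∀ s t, p s → p t → p (s + t)) (t : M.Tensor X) : p t := by
  obtain ⟨t, rfl⟩ := Submodule.Quotient.mk_surjective _ t
  induction t using TensorProduct.induction_on with
  | zero =>
    have := hmk 0 (0 : X)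
    rwa [tmk, TensorProduct.zero_tmul] at this
  | tmul x y => exact hmk x y
  | add s t hs ht => exact hadd _ _ hs ht

/-- A biadditive balanced map induces an additive map on the tensor product. -/
def liftAdd (h : M.Elem →+ X →+ N) (hbal : ∀ x c y, h (M.rmul x c) y = h x (c • y)) :
    M.Tensor X →+ N :=
  QuotientAddGroup.lift (M.balanced X).toAddSubgroup (TensorProduct.liftAddHom h fun r m n => by
    rw [map_zsmul, map_zsmul, AddMonoidHom.smul_apply]) (by
    intro t ht
    -- the relations are stable under left multiplication, so their `B`-span is killed as well
    suffices ∀ b : B, TensorProduct.liftAddHom h (fun r m n => by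
        rw [map_zsmul, map_zsmul, AddMonoidHom.smul_apply]) (b • t) = 0 by
      simpa using this 1
    refine Submodule.span_induction ?_ ?_ ?_ ?_ ht
    · rintro _ ⟨x, c, y, rfl⟩ b
      rw [smul_sub, map_sub, TensorProduct.smul_tmul', TensorProduct.smul_tmul']
      have e : b • M.rmul x c = M.rmul (b • x) c := Subtype.ext (mul_assoc _ _ _).symm
      rw [e, TensorProduct.liftAddHom_tmul, TensorProduct.liftAddHom_tmul, hbal, sub_self]
    · intro b; rw [smul_zero, map_zero]
    · intro s t _ _ hs ht b; rw [smul_add, map_add, hs, ht, add_zero]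
    · intro c t _ ht b; rw [smul_smul]; exact ht _)

end SubBimodule

/-! ### The composite functor -/

section Composite

variable (R : Type u) [CommRing R] [Finite R] (n : ℕ)

/-- An element `y` of the group ring with `e_U e_V y e_U e_V = e_U e_V`. -/
def quasiInv : CG R n := (exists_eUV_mul_mul_eq R n).choose

lemma eUV_mul_quasiInv_mul : eUV R n * quasiInv R n * eUV R n = eUV R n :=
  (exists_eUV_mul_mul_eq R n).choose_spec

/-- The idempotent `e_U e_V y`, which generates the right ideal `e_U e_V ℂ[G]`. -/
def resGen : (resBimodule R n).Elem := ⟨eUV R n * quasiInv R n, ⟨_, rfl⟩⟩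

/-- The element `e_U e_V` of `ℂ[G] e_U e_V`. -/
def indGen : (indBimodule R n).Elem := ⟨eUV R n, ⟨1, one_mul _⟩⟩

variable {R n}

lemma resGen_mul (a : (resBimodule R n).Elem) : (resGen R n : CG R n) * a = a := by
  obtain ⟨a, b, rfl⟩ := a
  change eUV R n * quasiInv R n * (eUV R n * b) = eUV R n * b
  rw [← mul_assoc, eUV_mul_quasiInv_mul]

section Res

variable {Y : Type*} [AddCommGroup Y] [Module (CG R n) Y]

lemma tmk_eq_resGen (a : (resBimodule R n).Elem) (y : Y) :
    (resBimodule R n).tmk a y = (resBimodule R n).tmk (resGen R n) ((a : CG R n) • y) := by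
  rw [← SubBimodule.rmul_tmk]
  congr 1
  exact Subtype.ext (resGen_mul a).symm

variable (R n Y) in
/-- The multiplication map `e_U e_V ℂ[G] ⊗ Y → Y`, `a ⊗ y ↦ a y`. -/
def resMul : (resBimodule R n).Tensor Y →+ Y :=
  (resBimodule R n).liftAdd
    (AddMonoidHom.mk' (fun a => DistribSMul.toAddMonoidHom Y (a : CG R n)) fun a b => by
      ext y; exact add_smul _ _ _)
    fun a c y => mul_smul (a : CG R n) c y

lemma resMul_tmk (a : (resBimodule R n).Elem) (y : Y) :
    resMul R n Y ((resBimodule R n).tmk a y) = (a : CG R n) • y := rfl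

/-- The multiplication map identifies the tensor product with `e_U e_V Y`. -/
lemma tmk_resGen_resMul (t : (resBimodule R n).Tensor Y) :
    (resBimodule R n).tmk (resGen R n) (resMul R n Y t) = t := by
  induction t using SubBimodule.tensor_induction with
  | hmk a y => rw [resMul_tmk, ← tmk_eq_resGen]
  | hadd s t hs ht => rw [map_add, SubBimodule.tmk_add, hs, ht]

lemma resMul_smul (l : CL R n) (t : (resBimodule R n).Tensor Y) :
    resMul R n Y (l • t) = incl R n l • resMul R n Y t := by
  induction t using SubBimodule.tensor_induction with
  | hmk a y => exact mul_smul (incl R n l) (a : CG R n) y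
  | hadd s t hs ht => rw [smul_add, map_add, map_add, smul_add, hs, ht]

lemma resGen_smul_resMul (t : (resBimodule R n).Tensor Y) :
    (resGen R n : CG R n) • resMul R n Y t = resMul R n Y t := by
  induction t using SubBimodule.tensor_induction with
  | hmk a y => rw [resMul_tmk, smul_smul, resGen_mul]
  | hadd s t hs ht => rw [map_add, smul_add, hs, ht]

lemma smul_tmk_resGen (l : CL R n) (y : Y) (hy : (resGen R n : CG R n) • y = y) :
    l • (resBimodule R n).tmk (resGen R n) y =
      (resBimodule R n).tmk (resGen R n) (incl R n l • y) := by
  rw [SubBimodule.smul_tmk, tmk_eq_resGen, SubBimodule.coe_smul, mul_smul, hy]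

end Res

section Ind

variable [Fintype (W R n)]

/-- The element `e_U w e_U e_V` of `ℂ[G] e_U e_V`. -/
def cellGen (w : W R n) : (indBimodule R n).Elem := ⟨cellElt w, ⟨_, rfl⟩⟩

omit [Fintype (W R n)] in
lemma resGen_smul_cellGen (w : W R n) : (resGen R n : CG R n) • cellGen w = cellGen w := by
  obtain ⟨c, hc⟩ := exists_cellElt_eq w
  refine Subtype.ext ?_
  change eUV R n * quasiInv R n * cellElt w = cellElt w
  rw [hc, ← mul_assoc, eUV_mul_quasiInv_mul]

omit [Fintype (W R n)] in
lemma resGen_mul_ind (x : (indBimodule R n).Elem) :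
    ∃ z, (resGen R n : CG R n) * x = eUV R n * z * eUV R n := by
  obtain ⟨x, b, rfl⟩ := x
  refine ⟨quasiInv R n * b, ?_⟩
  change eUV R n * quasiInv R n * (b * eUV R n) = _
  simp only [mul_assoc]

variable {X : Type*} [AddCommGroup X] [Module (CL R n) X]

variable (R n X) in
/-- The map `x ⊗ t ↦ (β_w(T y x) • t)_w`, where `T = e_U e_V`, `T y T = T` and the `β_w` are the
coordinates of `T ℂ[G] T`. -/
def indCoord : (indBimodule R n).Tensor X →+ (W R n → X) :=
  (indBimodule R n).liftAdd
    (AddMonoidHom.mk' (fun x => AddMonoidHom.mk'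
        (fun (y : X) w => coord R n ((resGen R n : CG R n) * x) w • y) fun y y' => by
          funext w; exact smul_add _ _ _) fun x x' => by
      ext y w
      change coord R n ((resGen R n : CG R n) * (x + x')) w • y = _
      rw [mul_add, map_add, Pi.add_apply, add_smul]; rfl)
    fun x c y => by
      funext w
      change coord R n ((resGen R n : CG R n) * (x * incl R n c)) w • y =
        coord R n ((resGen R n : CG R n) * x) w • c • y
      obtain ⟨z, hz⟩ := resGen_mul_ind x
      rw [← mul_assoc, hz, coord_mul_incl, mul_smul]

lemma indCoord_tmk (x : (indBimodule R n).Elem) (y : X) (w : W R n) :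
    indCoord R n X ((indBimodule R n).tmk x y) w = coord R n ((resGen R n : CG R n) * x) w • y :=
  rfl

lemma indCoord_cellGen [DecidableEq (W R n)] (w : W R n) (y : X) :
    indCoord R n X ((indBimodule R n).tmk (cellGen w) y) = Pi.single w y := by
  have e : (resGen R n : CG R n) * cellGen w = cellSum R n (Pi.single w 1) := by
    rw [cellSum_single, map_one, mul_one]
    exact congrArg Subtype.val (resGen_smul_cellGen w)
  funext w'
  rw [indCoord_tmk, e, coord_cellSum]
  by_cases h : w' = w
  · subst h; rw [Pi.single_eq_same, Pi.single_eq_same, one_smul]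
  · rw [Pi.single_eq_of_ne h, Pi.single_eq_of_ne h, zero_smul]

/-- Every element in the image of `e_U e_V` is recovered from its coordinates. -/
lemma sum_cellGen_indCoord (t : (indBimodule R n).Tensor X) :
    ∑ w, (indBimodule R n).tmk (cellGen w) (indCoord R n X t w) = (resGen R n : CG R n) • t := by
  induction t using SubBimodule.tensor_induction with
  | hmk x y =>
    obtain ⟨z, hz⟩ := resGen_mul_ind x
    simp only [indCoord_tmk, ← SubBimodule.rmul_tmk]
    rw [← SubBimodule.sum_tmk, SubBimodule.smul_tmk]
    congr 1
    refine Subtype.ext ?_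
    rw [AddSubgroup.val_finsetSum]
    change ∑ w, cellElt w * incl R n _ = (resGen R n : CG R n) * x
    rw [hz, ← cellSum_apply, cellSum_coord]
  | hadd s t hs ht =>
    rw [smul_add, ← hs, ← ht, ← Finset.sum_add_distrib]
    refine Finset.sum_congr rfl fun w _ => ?_
    rw [map_add, Pi.add_apply, SubBimodule.tmk_add]

end Ind

section Iso

/-- The twist `w^* X` of an unbundled `ℂ[L]`-module, on the same additive group. -/
def Twist (_ : W R n) (X : Type*) : Type _ := X

instance (w : W R n) (X : Type*) [AddCommGroup X] : AddCommGroup (Twist w X) :=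
  inferInstanceAs (AddCommGroup X)

instance (w : W R n) (X : Type*) [AddCommGroup X] [Module (CL R n) X] :
    Module (CL R n) (Twist w X) :=
  Module.compHom X (adRing w)

/-- The identity map from the twist to the original module. -/
def untwist (w : W R n) {X : Type*} [AddCommGroup X] : Twist w X →+ X := AddMonoidHom.id X

/-- The identity map from a module to its twist. -/
def twist (w : W R n) {X : Type*} [AddCommGroup X] : X →+ Twist w X := AddMonoidHom.id X

variable {X : Type*} [AddCommGroup X] [Module (CL R n) X]

omit [Finite R] in
lemma untwist_smul (w : W R n) (l : CL R n) (x : Twist w X) :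
    untwist w (l • x) = adRing w l • untwist w x := rfl

/-- The inclusion of the summand `w^* X`, which sends `x` to `T y ⊗ (e_U w T ⊗ x)`, where
`T = e_U e_V` and `T y T = T`. -/
def summandMap (w : W R n) :
    Twist w X →ₗ[CL R n] (resBimodule R n).Tensor ((indBimodule R n).Tensor X) where
  toFun x := (resBimodule R n).tmk (resGen R n) ((indBimodule R n).tmk (cellGen w) (untwist w x))
  map_add' x y := by rw [map_add, SubBimodule.tmk_add, SubBimodule.tmk_add]
  map_smul' l x := by
    rw [RingHom.id_apply, untwist_smul, smul_tmk_resGen, ← SubBimodule.rmul_tmk,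
      SubBimodule.smul_tmk]
    · congr 2
      exact Subtype.ext (incl_mul_cellElt w l).symm
    · rw [SubBimodule.smul_tmk, resGen_smul_cellGen]

variable (R n X) in
/-- The natural map `⨁_w w^* X → pres (pind X)`. -/
def fromSum : (DirectSum (W R n) fun w => Twist w X) →ₗ[CL R n]
    (resBimodule R n).Tensor ((indBimodule R n).Tensor X) := by
  classical exact DirectSum.toModule (CL R n) (W R n) _ summandMap

lemma fromSum_of [DecidableEq (W R n)] (w : W R n) (x : Twist w X) :
    fromSum R n X (DirectSum.of (fun w => Twist w X) w x) = summandMap w x := by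
  rw [fromSum]
  convert DirectSum.toModule_lof (CL R n) (φ := summandMap (X := X)) w x
  rfl

lemma fromSum_bijective : Function.Bijective (fromSum R n X) := by
  classical
  have := Fintype.ofFinite (W R n)
  constructor
  · have key : ∀ (t : DirectSum (W R n) fun w => Twist w X) w,
        twist w (indCoord R n X (resMul R n _ (fromSum R n X t)) w) = t w := by
      intro t w
      induction t using DirectSum.induction_on with
      | zero => simp only [map_zero, Pi.zero_apply]; rfl
      | of w' x =>
        rw [fromSum_of]
        change twist w (indCoord R n X (resMul R n _ ((resBimodule R n).tmk (resGen R n)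
          ((indBimodule R n).tmk (cellGen w') (untwist w' x)))) w) = _
        rw [resMul_tmk, SubBimodule.smul_tmk, resGen_smul_cellGen, indCoord_cellGen]
        by_cases h : w = w'
        · subst h; rw [Pi.single_eq_same, DirectSum.of_eq_same]; rfl
        · rw [Pi.single_eq_of_ne h, DirectSum.of_eq_of_ne _ _ _ h, map_zero]
      | add s t hs ht => rw [map_add, map_add, map_add, Pi.add_apply, map_add, hs, ht]; rfl
    intro s t h
    refine DFinsupp.ext fun w => ?_
    rw [← key s w, ← key t w, h]
  · intro t
    refine ⟨∑ w, DirectSum.of (fun w => Twist w X) w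
      (twist w (indCoord R n X (resMul R n _ t) w)), ?_⟩
    have hsum : ∀ (s : Finset (W R n)) (y : W R n → (indBimodule R n).Tensor X),
        ∑ w ∈ s, (resBimodule R n).tmk (resGen R n) (y w) =
          (resBimodule R n).tmk (resGen R n) (∑ w ∈ s, y w) := fun s y =>
      (map_sum (AddMonoidHom.mk' (fun z => (resBimodule R n).tmk (resGen R n) z)
        ((resBimodule R n).tmk_add (resGen R n))) y s).symm
    rw [map_sum]
    simp only [fromSum_of]
    calc _ = _ := hsum Finset.univ fun w =>
          (indBimodule R n).tmk (cellGen w) (indCoord R n X (resMul R n _ t) w)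
      _ = t := by rw [sum_cellGen_indCoord, resGen_smul_resMul, tmk_resGen_resMul]

variable (R n) in
/-- Composing induction with restriction gives the sum of the twists by the elements of `W`. -/
def compIso : wSum.{u, v} R n ≅ pind.{u, v} R n ⋙ pres.{u, v} R n :=
  NatIso.ofComponents
    (fun X => (LinearEquiv.ofBijective (fromSum R n X) fromSum_bijective).toModuleIso) (by
    intro X Y φ
    classical
    refine ModuleCat.hom_ext (DirectSum.linearMap_ext _ fun w => LinearMap.ext fun x => ?_)
    -- both sides are the summand inclusion at `w`, applied to the image of `x`
    have h1 := DirectSum.lmap_lof (R := CL R n)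
      (fun w => ((wStar.{u, v} w).map φ).hom) w x
    have h2 := congrArg ((resBimodule R n).map ((indBimodule R n).map φ.hom))
      (fromSum_of (X := X) w x)
    exact (congrArg (fromSum R n Y) h1).trans ((fromSum_of (X := Y) w _).trans h2.symm))

end Iso

end Composite

/-! ### Frobenius reciprocity -/

section Adjunction

variable {R : Type u} [CommRing R] [Finite R] {n : ℕ}

section Unbundled

variable {X Y : Type*} [AddCommGroup X] [Module (CL R n) X] [AddCommGroup Y] [Module (CG R n) Y]

lemma tmk_ind_eq (a : CG R n) (x : (indBimodule R n).Elem) (hx : (x : CG R n) = a * eUV R n)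
    (y : X) : (indBimodule R n).tmk x y = a • (indBimodule R n).tmk (indGen R n) y := by
  rw [SubBimodule.smul_tmk]
  congr 1
  exact Subtype.ext hx

lemma smul_tmk_indGen (l : CL R n) (y : X) :
    incl R n l • (indBimodule R n).tmk (indGen R n) y =
      (indBimodule R n).tmk (indGen R n) (l • y) := by
  rw [← SubBimodule.rmul_tmk, SubBimodule.smul_tmk]
  congr 1
  exact Subtype.ext (commute_eUV R n l).eq

lemma resGen_smul_tmk_indGen (y : X) :
    (resGen R n : CG R n) • (indBimodule R n).tmk (indGen R n) y =
      (indBimodule R n).tmk (indGen R n) y := by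
  rw [SubBimodule.smul_tmk]
  congr 1
  exact Subtype.ext (eUV_mul_quasiInv_mul R n)

/-- The adjoint `x ↦ T y ⊗ φ(T ⊗ x)` of a `ℂ[G]`-linear map `φ` out of the induced module, where
`T = e_U e_V` and `T y T = T`. -/
def adjointMap (φ : (indBimodule R n).Tensor X →ₗ[CG R n] Y) :
    X →ₗ[CL R n] (resBimodule R n).Tensor Y where
  toFun x := (resBimodule R n).tmk (resGen R n) (φ ((indBimodule R n).tmk (indGen R n) x))
  map_add' x x' := by rw [SubBimodule.tmk_add, map_add, SubBimodule.tmk_add]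
  map_smul' l x := by
    rw [RingHom.id_apply, smul_tmk_resGen, ← smul_tmk_indGen, map_smul]
    rw [← map_smul, resGen_smul_tmk_indGen]

lemma resMul_adjointMap (φ : (indBimodule R n).Tensor X →ₗ[CG R n] Y) (x : X) :
    resMul R n Y (adjointMap φ x) = φ ((indBimodule R n).tmk (indGen R n) x) := by
  change resMul R n Y ((resBimodule R n).tmk (resGen R n) _) = _
  rw [resMul_tmk, ← map_smul, resGen_smul_tmk_indGen]

lemma adjointMap_injective : Function.Injective (adjointMap (R := R) (n := n) (X := X) (Y := Y)) := by
  intro φ ψ h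
  refine SubBimodule.hom_ext _ fun x y => ?_
  obtain ⟨a, ha⟩ := x.2
  change φ ((indBimodule R n).tmk x y) = ψ ((indBimodule R n).tmk x y)
  rw [tmk_ind_eq a x ha.symm, map_smul, map_smul, ← resMul_adjointMap, ← resMul_adjointMap, h]

lemma mul_quasiInv_smul_resMul (b : CG R n) (t : (resBimodule R n).Tensor Y) :
    (b * eUV R n * quasiInv R n) • resMul R n Y t = b • resMul R n Y t := by
  rw [mul_assoc, mul_smul]
  exact congrArg _ (resGen_smul_resMul t)

lemma mul_incl_mul_quasiInv_smul (ψ : X →ₗ[CL R n] (resBimodule R n).Tensor Y)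
    (a : (indBimodule R n).Elem) (c : CL R n) (x : X) :
    ((a : CG R n) * incl R n c * quasiInv R n) • resMul R n Y (ψ x) =
      ((a : CG R n) * quasiInv R n) • resMul R n Y (ψ (c • x)) := by
  obtain ⟨b, hb⟩ := a.2
  replace hb : b * eUV R n = a := hb
  rw [← hb, mul_assoc b, ← (commute_eUV R n c).eq, ← mul_assoc b, mul_quasiInv_smul_resMul,
    mul_quasiInv_smul_resMul, map_smul, resMul_smul, mul_smul]

/-- The map `a T ⊗ x ↦ a ψ(x)`, where `T = e_U e_V`. It depends only on `a T`, because
`ψ(x) = T y ψ(x)` if `T y T = T`. -/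
def adjointInvAdd (ψ : X →ₗ[CL R n] (resBimodule R n).Tensor Y) :
    (indBimodule R n).Tensor X →+ Y :=
  (indBimodule R n).liftAdd
    (AddMonoidHom.mk' (fun a => AddMonoidHom.mk'
        (fun x => ((a : CG R n) * quasiInv R n) • resMul R n Y (ψ x)) fun x x' => by
          rw [map_add, map_add, smul_add]) fun a a' => by
      ext x
      change (((a : CG R n) + a') * quasiInv R n) • resMul R n Y (ψ x) = _
      rw [add_mul, add_smul]; rfl)
    (mul_incl_mul_quasiInv_smul ψ)

lemma adjointInvAdd_tmk (ψ : X →ₗ[CL R n] (resBimodule R n).Tensor Y)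
    (a : (indBimodule R n).Elem) (x : X) : adjointInvAdd ψ ((indBimodule R n).tmk a x) =
      ((a : CG R n) * quasiInv R n) • resMul R n Y (ψ x) := rfl

/-- The `ℂ[G]`-linear map with a given adjoint. -/
def adjointInv (ψ : X →ₗ[CL R n] (resBimodule R n).Tensor Y) :
    (indBimodule R n).Tensor X →ₗ[CG R n] Y where
  toFun := adjointInvAdd ψ
  map_add' := map_add _
  map_smul' b t := by
    induction t using SubBimodule.tensor_induction with
    | hmk a x =>
      rw [SubBimodule.smul_tmk, adjointInvAdd_tmk, adjointInvAdd_tmk, RingHom.id_apply, smul_smul,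
        ← mul_assoc]
      rfl
    | hadd s t hs ht => rw [smul_add, map_add, map_add, hs, ht, smul_add]

lemma adjointMap_surjective :
    Function.Surjective (adjointMap (R := R) (n := n) (X := X) (Y := Y)) := by
  intro ψ
  refine ⟨adjointInv ψ, LinearMap.ext fun x => ?_⟩
  change (resBimodule R n).tmk (resGen R n)
    (((resGen R n : CG R n)) • resMul R n Y (ψ x)) = ψ x
  rw [resGen_smul_resMul, tmk_resGen_resMul]

end Unbundled

/-- The adjunction between induction and restriction, as an isomorphism of complex vector
spaces. -/
def homEquiv (X : RepL.{u, v} R n) (Y : RepG.{u, v} R n) :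
    ((pind R n).obj X ⟶ Y) ≃ₗ[ℂ] (X ⟶ (pres R n).obj Y) :=
  LinearEquiv.ofBijective
    { toFun φ := ModuleCat.ofHom (adjointMap φ.hom)
      map_add' φ ψ := by
        refine ModuleCat.hom_ext (LinearMap.ext fun x => ?_)
        exact SubBimodule.tmk_add _ _ _ _
      map_smul' c φ := by
        refine ModuleCat.hom_ext (LinearMap.ext fun x => ?_)
        have e : algebraMap ℂ (CG R n) c = incl R n (algebraMap ℂ (CL R n) c) :=
          ((MonoidAlgebra.mapDomainAlgHom ℂ ℂ (L R n).subtype).commutes c).symm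
        change (resBimodule R n).tmk (resGen R n) (algebraMap ℂ (CG R n) c •
          φ.hom ((indBimodule R n).tmk (indGen R n) x)) =
          algebraMap ℂ (CL R n) c • (resBimodule R n).tmk (resGen R n)
            (φ.hom ((indBimodule R n).tmk (indGen R n) x))
        rw [smul_tmk_resGen, e]
        exact (φ.hom.map_smul _ _).symm.trans (congrArg φ.hom (resGen_smul_tmk_indGen x)) }
    ⟨fun φ ψ h => ModuleCat.hom_ext (adjointMap_injective (congrArg ModuleCat.Hom.hom h)),
      fun ψ => by
        obtain ⟨φ, hφ⟩ := adjointMap_surjective ψ.hom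
        exact ⟨ModuleCat.ofHom φ, ModuleCat.hom_ext hφ⟩⟩

end Adjunction

/-! ### Dimensions of spaces of homomorphisms -/

section Hom

/-- Homomorphisms into a finite direct sum are families of homomorphisms. -/
def homDirectSumEquiv {S : Type u} [Ring S] [Algebra ℂ S] {ι : Type u} [Finite ι]
    (X : ModuleCat.{max u v} S) (Z : ι → ModuleCat.{max u v} S) :
    (X ⟶ ModuleCat.of S (DirectSum ι fun i => Z i)) ≃ₗ[ℂ] (∀ i, X ⟶ Z i) := by
  letI := Fintype.ofFinite ι
  let e := DirectSum.linearEquivFunOnFintype S ι fun i => Z i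
  exact
  { toFun φ i := ModuleCat.ofHom (DirectSum.component S ι (fun i => Z i) i ∘ₗ φ.hom)
    map_add' φ ψ := rfl
    map_smul' c φ := rfl
    invFun φ := ModuleCat.ofHom (e.symm.toLinearMap ∘ₗ LinearMap.pi fun i => (φ i).hom)
    left_inv φ := ModuleCat.hom_ext (LinearMap.ext fun x => e.symm_apply_apply (φ.hom x))
    right_inv φ := by
      funext i
      refine ModuleCat.hom_ext (LinearMap.ext fun x => ?_)
      exact congrFun (e.apply_symm_apply fun i => (φ i).hom x) i }

/-- Simple modules over a finite-dimensional algebra have finite-dimensional spaces of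
homomorphisms: evaluation at a generator embeds these into a quotient of the algebra. -/
lemma finiteDimensional_hom {S : Type u} [Ring S] [Algebra ℂ S] [FiniteDimensional ℂ S]
    (X Y : ModuleCat.{v} S) [IsSimpleModule S X] [IsSimpleModule S Y] :
    FiniteDimensional ℂ (X ⟶ Y) := by
  let : Module ℂ Y := Module.compHom Y (algebraMap ℂ S)
  have : Nontrivial X := IsSimpleModule.nontrivial S X
  have : Nontrivial Y := IsSimpleModule.nontrivial S Y
  obtain ⟨x, hx⟩ := exists_ne (0 : X)
  obtain ⟨y, hy⟩ := exists_ne (0 : Y)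
  have hY : FiniteDimensional ℂ Y := by
    let p : S →ₗ[ℂ] Y :=
      { toFun a := a • y
        map_add' a b := add_smul a b y
        map_smul' c a := by
          rw [Algebra.smul_def, mul_smul]; rfl }
    exact Module.Finite.of_surjective p (IsSimpleModule.toSpanSingleton_surjective S hy)
  let ev : (X ⟶ Y) →ₗ[ℂ] Y :=
    { toFun φ := φ.hom x
      map_add' φ ψ := rfl
      map_smul' c φ := rfl }
  refine Module.Finite.of_injective ev fun φ ψ h => ModuleCat.hom_ext (LinearMap.ext fun z => ?_)
  obtain ⟨a, rfl⟩ := IsSimpleModule.toSpanSingleton_surjective S hx z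
  have h' : φ.hom x = ψ.hom x := h
  rw [LinearMap.toSpanSingleton_apply, map_smul, map_smul, h']

variable {R : Type u} [CommRing R] [Finite R] {n : ℕ}

omit [Finite R] in
lemma adRing_adRing_inv (w : W R n) (l : CL R n) : adRing w (adRing w⁻¹ l) = l := by
  induction l using MonoidAlgebra.induction_linear with
  | zero => simp
  | add x y hx hy => rw [map_add, map_add, hx, hy]
  | single l c =>
    have e : ∀ (w : W R n) (l : L R n),
        adRing w (MonoidAlgebra.single l c) = MonoidAlgebra.single (adInv w l) c := fun w l => by
      simp [adRing, MonoidAlgebra.mapDomainRingHom_apply]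
    rw [e, e]
    congr 1
    refine Subtype.ext ?_
    change (w : G R n)⁻¹ * ((w : G R n)⁻¹⁻¹ * l * (w : G R n)⁻¹) * w = l
    group

omit [Finite R] in
lemma isSimpleModule_wStar (w : W R n) (Y : RepL.{u, v} R n) [hY : IsSimpleModule (CL R n) Y] :
    IsSimpleModule (CL R n) ((wStar.{u, v} w).obj Y) := by
  have : RingHomSurjective (adRing w) := ⟨fun l => ⟨_, adRing_adRing_inv w l⟩⟩
  let f : (wStar.{u, v} w).obj Y →ₛₗ[adRing w] Y :=
    { toFun y := y
      map_add' _ _ := rfl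
      map_smul' _ _ := rfl }
  exact (LinearMap.isSimpleModule_iff_of_bijective f Function.bijective_id).2 hY

omit [Finite R] in
/-- Twisting is invertible, so that a twist can be moved to the other side of an isomorphism. -/
lemma nonempty_iso_wStar_iff (w : W R n) (X Y : RepL.{u, v} R n) :
    Nonempty (X ≅ (wStar.{u, v} w).obj Y) ↔ Nonempty ((wStar.{u, v} w⁻¹).obj X ≅ Y) := by
  constructor
  · rintro ⟨e⟩
    let f : X ≃ₗ[CL R n] (wStar.{u, v} w).obj Y := e.toLinearEquiv
    let g : (wStar.{u, v} w⁻¹).obj X ≃ₗ[CL R n] Y :=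
      { f.toAddEquiv with
        map_smul' l x := by
          let x' : X := x
          let y : Y := f x'
          have h : f (adRing w⁻¹ l • x') = adRing w (adRing w⁻¹ l) • y := f.map_smul _ x'
          rw [adRing_adRing_inv] at h
          exact h }
    exact ⟨g.toModuleIso⟩
  · rintro ⟨e⟩
    let f : (wStar.{u, v} w⁻¹).obj X ≃ₗ[CL R n] Y := e.toLinearEquiv
    let g : X ≃ₗ[CL R n] (wStar.{u, v} w).obj Y :=
      { f.toAddEquiv with
        map_smul' l x := by
          have h : f (adRing w⁻¹ (adRing w l) • (x : X)) = adRing w l • (f x : Y) := f.map_smul _ _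
          have h2 := adRing_adRing_inv w⁻¹ l
          rw [inv_inv] at h2
          rw [h2] at h
          exact h }
    exact ⟨g.toModuleIso⟩

/-- The dimension count: by reciprocity and the formula for the composite functor, the space of
homomorphisms is the product of the spaces `Hom_L(χ, w^* σ)`, to which Schur's lemma applies. -/
lemma rank_hom_pind (χ σ : RepL.{u, v} R n) [IsSimpleModule (CL R n) χ]
    [IsSimpleModule (CL R n) σ] :
    Module.rank ℂ ((pind.{u, v} R n).obj χ ⟶ (pind.{u, v} R n).obj σ) =
      (Nat.card {w : W R n // Nonempty ((wStar.{u, v} w).obj χ ≅ σ)} : Cardinal) := by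
  classical
  let := Fintype.ofFinite (W R n)
  let e : ((pind.{u, v} R n).obj χ ⟶ (pind.{u, v} R n).obj σ) ≃ₗ[ℂ]
      (∀ w : W R n, χ ⟶ (wStar.{u, v} w).obj σ) :=
    (homEquiv χ _ ≪≫ₗ Linear.homCongr ℂ (Iso.refl χ) ((compIso R n).symm.app σ)) ≪≫ₗ
      homDirectSumEquiv.{u, v} χ fun w => (wStar.{u, v} w).obj σ
  have hs : ∀ w : W R n, IsSimpleModule (CL R n) ((wStar.{u, v} w).obj σ) :=
    fun w => isSimpleModule_wStar w σ
  have hfd : ∀ w : W R n, FiniteDimensional ℂ (χ ⟶ (wStar.{u, v} w).obj σ) :=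
    fun w => finiteDimensional_hom _ _
  have hfd' : FiniteDimensional ℂ (χ ⟶ χ) := finiteDimensional_hom _ _
  have hdim : ∀ w : W R n, Module.finrank ℂ (χ ⟶ (wStar.{u, v} w).obj σ) =
      if Nonempty (χ ≅ (wStar.{u, v} w).obj σ) then 1 else 0 := by
    intro w
    have : Simple χ := (simple_iff_isSimpleModule' χ).2 inferInstance
    have : Simple ((wStar.{u, v} w).obj σ) := (simple_iff_isSimpleModule' _).2 inferInstance
    have h1 := finrank_hom_simple_simple_eq_one_iff ℂ χ ((wStar.{u, v} w).obj σ)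
    have h2 := finrank_hom_simple_simple_le_one ℂ χ ((wStar.{u, v} w).obj σ)
    split_ifs with h
    · exact h1.2 h
    · have := mt h1.1 h
      omega
  rw [e.rank_eq, ← Module.finrank_eq_rank, Module.finrank_pi_fintype]
  simp only [hdim]
  rw [Finset.sum_boole, ← Fintype.card_subtype, ← Nat.card_eq_fintype_card, Nat.cast_id]
  congr 1
  refine Nat.card_congr ((Equiv.inv (W R n)).subtypeEquiv fun w => ?_)
  exact nonempty_iso_wStar_iff w χ σ

end Hom

end HC

end


theorem theorem1 (R : Type u) [CommRing R] [Finite R] (n : ℕ) :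
    Nonempty (HC.pind.{u, v} R n ⋙ HC.pres.{u, v} R n ≅ HC.wSum.{u, v} R n) ∧
    ∀ χ σ : HC.RepL.{u, v} R n, IsSimpleModule (HC.CL R n) χ → IsSimpleModule (HC.CL R n) σ →
      Module.rank ℂ ((HC.pind.{u, v} R n).obj χ ⟶ (HC.pind.{u, v} R n).obj σ) =
        (Nat.card {w : HC.W R n // Nonempty ((HC.wStar.{u, v} w).obj χ ≅ σ)} : Cardinal) :=
  ⟨⟨(HC.compIso R n).symm⟩, fun χ σ _ _ => HC.rank_hom_pind χ σ⟩
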